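/- A real random variable $X$ is called log-concave if its law has a density of the form $e^{-\phi}$ with respect to Lebesgue measure, where $\phi\colon\mathbb{R}\to(-\infty,+\infty]$ is convex. For $p\in\mathbb{R}\setminus\{0\}$ put $\|X\|_p=(\mathbb{E}|X|^p)^{1/p}\in[0,+\infty]$, and put $\|X\|_0=e^{\mathbb{E}\log|X|}$. At $p=0$ the expression $\Gamma(p+1)^{1/p}$ stands for its limit $e^{-\gamma}$, where $\gamma$ is the Euler--Mascheroni constant. Let $\mathcal{E}$ be a standard exponential random variable (density $e^{-x}$ on $(0,\infty)$), let $D$ be a standard double-exponential random variable (density $\frac12e^{-|x|}$ on $\mathbb{R}$), and for $p\ge1$ let $$C_p=\max\left\{\Gamma(p+1)^{1/p},\ \tfrac{e}{2}\|\mathcal{E}-1\|_p\right\},$$ which is finite. **Theorem.** Let $X$ be a log-concave random variable with mean $0$. Then $$\|X\|_p\ \ge\ \Gamma(p+1)^{1/p}\,\|X\|_1\quad\text{for every } -1<p\le1,\qquad\qquad \|X\|_p\ \le\ C_p\,\|X\|_1\quad\text{for every } p\ge1.$$ Both bounds are sharp. The variables $D$ and $\mathcal{E}-1$ are log-concave with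 mean $0$, and equality holds in the first bound for $X=D$, for every $-1<p\le1$. Moreover, the equation $\Gamma(p+1)^{1/p}=\frac e2\|\mathcal{E}-1\|_p$ has a unique solution $p_0$ in $(1,+\infty)$; it satisfies $2.9414<p_0<2.9415$, and - for $1\le p\le p_0$, $C_p=\Gamma(p+1)^{1/p}$ and equality holds in the second bound for $X=D$; - for $p\ge p_0$, $C_p=\frac e2\|\mathcal{E}-1\|_p$ and equality holds in the second bound for $X=\mathcal{E}-1$. -/

import Mathlib

open MeasureTheory ProbabilityTheory
open scoped ENNReal

noncomputable section

namespace LogConcaveMoments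

/-- Convexity of an extended-valued function `φ : ℝ → (-∞, +∞]`. -/
structure IsConvexPotential (φ : ℝ → EReal) : Prop where
  ne_bot : ∀ x, φ x ≠ ⊥
  convex : ∀ x y a b : ℝ, 0 < a → 0 < b → a + b = 1 →
    φ (a * x + b * y) ≤ (a : EReal) * φ x + (b : EReal) * φ y

/-- `X` is a log-concave random variable: its law has a density `e^{-φ}` with respect to Lebesgue
measure, with `φ : ℝ → (-∞, +∞]` convex (here `EReal.exp ⊥ = 0`). -/
def IsLogConcave {Ω : Type*} [MeasurableSpace Ω] (X : Ω → ℝ) (P : Measure Ω) : Prop :=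
  ∃ φ : ℝ → EReal, IsConvexPotential φ ∧
    HasLaw X ((volume : Measure ℝ).withDensity fun x => EReal.exp (-φ x)) P

/-- `X` has mean zero. -/
def HasMeanZero {Ω : Type*} [MeasurableSpace Ω] (X : Ω → ℝ) (P : Measure Ω) : Prop :=
  Integrable X P ∧ ∫ ω, X ω ∂P = 0

/-- The extended-valued expectation `𝔼 log |X|`, the difference of the expectations of the positive
and the negative part of `log |X|`, where `log 0 = -∞`. -/
def expLogAbs {Ω : Type*} [MeasurableSpace Ω] (X : Ω → ℝ) (P : Measure Ω) : EReal :=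
  ((∫⁻ ω, (ENNReal.log ‖X ω‖ₑ).toENNReal ∂P : ℝ≥0∞) : EReal) -
    ((∫⁻ ω, (-ENNReal.log ‖X ω‖ₑ).toENNReal ∂P : ℝ≥0∞) : EReal)

/-- `‖X‖_p = (𝔼 |X|^p)^{1/p} ∈ [0, ∞]` for real `p ≠ 0` (for `p < 0`, `0 ^ p = ∞` and `∞ ^ p = 0`),
and `‖X‖_0 = exp (𝔼 log |X|)`. -/
def momentNorm {Ω : Type*} [MeasurableSpace Ω] (X : Ω → ℝ) (p : ℝ) (P : Measure Ω) : ℝ≥0∞ :=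
  if p = 0 then EReal.exp (expLogAbs X P)
  else (∫⁻ ω, ‖X ω‖ₑ ^ p ∂P) ^ (1 / p)

/-- `Γ(p+1)^{1/p}`, with its limit `e^{-γ}` as value at `p = 0`. -/
def gammaRoot (p : ℝ) : ℝ :=
  if p = 0 then Real.exp (-Real.eulerMascheroniConstant)
  else Real.Gamma (p + 1) ^ (1 / p)

/-- The value of `gammaRoot` at `0` is the limit of `Γ(p+1)^{1/p}` as `p → 0`. -/
theorem tendsto_gammaRoot_zero :
    Filter.Tendsto (fun p : ℝ => Real.Gamma (p + 1) ^ (1 / p)) (nhdsWithin 0 {0}ᶜ)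
      (nhds (gammaRoot 0)) := by
  have h0 : HasDerivAt (fun p : ℝ => Real.Gamma (p + 1)) (-Real.eulerMascheroniConstant) 0 := by
    have h := Real.hasDerivAt_Gamma_one
    rw [← zero_add (1 : ℝ)] at h
    exact h.comp_add_const 0 1
  have h1 : HasDerivAt (fun p : ℝ => Real.log (Real.Gamma (p + 1)))
      (-Real.eulerMascheroniConstant) 0 := by
    simpa using h0.log (by simp)
  have h2 := (Real.continuous_exp.tendsto _).comp h1.tendsto_slope
  rw [gammaRoot, if_pos rfl]
  refine h2.congr' ?_
  have h3 : ∀ᶠ p : ℝ in nhdsWithin 0 {0}ᶜ, p ∈ Set.Ioi (-1 : ℝ) :=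
    nhdsWithin_le_nhds (Ioi_mem_nhds (by norm_num))
  filter_upwards [h3] with p hp
  have hp' : (0 : ℝ) < p + 1 := by
    have : (-1 : ℝ) < p := hp
    linarith
  rw [Real.rpow_def_of_pos (Real.Gamma_pos_of_pos hp')]
  simp [slope_def_field, div_eq_mul_inv]

/-- The standard double-exponential law, with density `e^{-|x|} / 2`. -/
def doubleExp : Measure ℝ :=
  (volume : Measure ℝ).withDensity fun x => ENNReal.ofReal (Real.exp (-|x|) / 2)

/-- `(e/2) ‖ℰ - 1‖_p` for a standard exponential random variable `ℰ`. -/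
def oneSidedConst (p : ℝ) : ℝ≥0∞ :=
  ENNReal.ofReal (Real.exp 1 / 2) * momentNorm (fun x : ℝ => x - 1) p (expMeasure 1)

/-- `C_p = max {Γ(p+1)^{1/p}, (e/2) ‖ℰ - 1‖_p}`. -/
def sharpConst (p : ℝ) : ℝ≥0∞ :=
  max (ENNReal.ofReal (gammaRoot p)) (oneSidedConst p)

end LogConcaveMoments

end

open LogConcaveMoments

/-!
Normalise a mean-zero log-concave `X` by `𝔼 |X| = 1`. Its stop-loss transform `x ↦ 𝔼 (|X| - x)₊`
is then dominated by that of some member of a one-parameter family of laws, those proportional to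
`(ℰ - 1) - (1 - t) (ℰ' - 1)` with `ℰ'` an independent copy of `ℰ` and `0 ≤ t ≤ 1`, which
interpolates between the double-exponential law (`t = 0`, with transform `exp (-x)`) and that of
`ℰ - 1` (`t = 1`). Every absolute moment of exponent `p ≠ 0, 1` is a weighted integral of the
stop-loss transform, increasing in it for `p < 0` and `1 < p`, decreasing for `0 < p < 1`.

Each extremal transform crosses `exp (-x)` exactly once, so that an inequality between the moments
of one exponent `q > 1` passes to all smaller exponents; this reduces everything to exponents
`p ≥ p₀`. For these, the derivative of the extremal moment in `t` changes sign at most once, from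
negative to positive, because its sign is governed by an incomplete Gamma function with polynomial
coefficients; hence the moment is largest at `t = 0` or at `t = 1`, and `p₀` is where the two
values agree. It is located through rational bounds for `Γ` and for `∫ y in 0..1, y ^ p * exp y`.
The geometric mean `p = 0` is the limit of the exponents `q → 0⁻`.
-/

noncomputable section

namespace LogConcaveMoments

open Filter Topology Set

/-! ### Log-concavity of densities and tails -/

/-- Log-concavity of a function on the line: every ratio `f (x + h) / f x` with `0 ≤ h` is
antitone in `x`. The four-point form has no division, so `f` may vanish or be infinite, and it
passes to tail integrals. -/
def HasAntitoneRatios (f : ℝ → ℝ≥0∞) : Prop :=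
  ∀ ⦃x y h : ℝ⦄, x ≤ y → 0 ≤ h → f x * f (y + h) ≤ f (x + h) * f y

/-- A law with log-concave survival function `x ↦ μ (x, ∞)`. -/
def TailLogConcave (μ : Measure ℝ) : Prop :=
  HasAntitoneRatios fun x => μ (Ioi x)

namespace IsConvexPotential

variable {φ : ℝ → EReal}

theorem le_of_le_of_le (hφ : IsConvexPotential φ) {x y z : ℝ} {c : EReal} (hz : z ∈ Icc x y)
    (hx : φ x ≤ c) (hy : φ y ≤ c) : φ z ≤ c := by
  rcases eq_or_lt_of_le hz.1 with rfl | hxz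
  · exact hx
  rcases eq_or_lt_of_le hz.2 with rfl | hzy
  · exact hy
  obtain ⟨a, b, ha, hb, hab, rfl⟩ := (Convex.mem_Ioo (hxz.trans hzy)).1 ⟨hxz, hzy⟩
  have ha' : (0 : EReal) ≤ a := EReal.coe_nonneg.2 ha.le
  have hb' : (0 : EReal) ≤ b := EReal.coe_nonneg.2 hb.le
  calc φ (a * x + b * y) ≤ a * φ x + b * φ y := hφ.convex x y a b ha hb hab
    _ ≤ a * c + b * c :=
        add_le_add (mul_le_mul_of_nonneg_left hx ha') (mul_le_mul_of_nonneg_left hy hb')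
    _ = c := by
        rw [← EReal.right_distrib_of_nonneg ha' hb', ← EReal.coe_add, hab, EReal.coe_one, one_mul]

protected theorem measurable (hφ : IsConvexPotential φ) : Measurable φ :=
  measurable_of_Iic fun _ =>
    OrdConnected.measurableSet ⟨fun _ hx _ hy _ hz => hφ.le_of_le_of_le hz hx hy⟩

theorem add_le_add_outer (hφ : IsConvexPotential φ) {u v h : ℝ} (huv : u ≤ v) (hh : 0 ≤ h) :
    φ (u + h) + φ v ≤ φ u + φ (v + h) := by
  rcases eq_or_lt_of_le huv with rfl | huv
  · rw [add_comm]
  rcases eq_or_lt_of_le hh with rfl | hh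
  · simp only [add_zero, le_refl]
  obtain ⟨a, b, ha, hb, hab, hu⟩ :=
    (Convex.mem_Ioo (show u < v + h by linarith)).1 ⟨(show u < u + h by linarith), by linarith⟩
  have hv : b * u + a * (v + h) = v := by linear_combination (u + v + h) * hab - hu
  have hconv₁ := hφ.convex u (v + h) a b ha hb hab
  have hconv₂ := hφ.convex u (v + h) b a hb ha (by rwa [add_comm])
  rw [hu] at hconv₁
  rw [hv] at hconv₂
  rcases eq_or_ne (φ u) ⊤ with hA | hA
  · rw [hA, EReal.top_add_of_ne_bot (hφ.ne_bot _)]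
    exact le_top
  rcases eq_or_ne (φ (v + h)) ⊤ with hB | hB
  · rw [hB, EReal.add_top_of_ne_bot (hφ.ne_bot _)]
    exact le_top
  lift φ u to ℝ using ⟨hA, hφ.ne_bot _⟩ with A
  lift φ (v + h) to ℝ using ⟨hB, hφ.ne_bot _⟩ with B
  calc φ (u + h) + φ v ≤ ((a : EReal) * A + b * B) + (b * A + a * B) := add_le_add hconv₁ hconv₂
    _ = (((a + b) * A + (a + b) * B : ℝ) : EReal) := by norm_cast; ring_nf
    _ = A + B := by rw [hab, one_mul, one_mul, EReal.coe_add]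

theorem hasAntitoneRatios_exp_neg (hφ : IsConvexPotential φ) :
    HasAntitoneRatios fun x => EReal.exp (-φ x) := by
  intro u v h huv hh
  have hbot := hφ.ne_bot
  rw [← EReal.exp_add, ← EReal.exp_add, EReal.exp_le_exp_iff, ← sub_eq_add_neg, ← sub_eq_add_neg,
    ← EReal.neg_add (.inl (hbot _)) (.inr (hbot _)),
    ← EReal.neg_add (.inl (hbot _)) (.inr (hbot _)), EReal.neg_le_neg_iff]
  exact hφ.add_le_add_outer huv hh

theorem comp_neg (hφ : IsConvexPotential φ) : IsConvexPotential fun x => φ (-x) where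
  ne_bot x := hφ.ne_bot _
  convex x y a b ha hb hab := by
    simpa only [mul_neg, neg_add] using hφ.convex (-x) (-y) a b ha hb hab

end IsConvexPotential

namespace HasAntitoneRatios

variable {f : ℝ → ℝ≥0∞}

theorem setLIntegral_Ioi_mul_le (hf : HasAntitoneRatios f) (hfm : Measurable f) {x y : ℝ}
    (hxy : x ≤ y) :
    f x * ∫⁻ h in Ioi 0, f (y + h) ≤ f y * ∫⁻ h in Ioi 0, f (x + h) := by
  rw [← lintegral_const_mul _ (by fun_prop), ← lintegral_const_mul _ (by fun_prop)]
  refine setLIntegral_mono' measurableSet_Ioi fun h hh => ?_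
  exact (hf hxy (mem_Ioi.1 hh).le).trans_eq (mul_comm _ _)

theorem withDensity_tailLogConcave (hf : HasAntitoneRatios f) (hfm : Measurable f) :
    TailLogConcave (volume.withDensity f) := by
  intro x y h hxy hh
  set μ := volume.withDensity f with hμ
  have apply_image_add : ∀ s : Set ℝ, MeasurableSet s →
      μ ((· + h) '' s) = ∫⁻ u in s, f (u + h) := by
    intro s hs
    have hemb : MeasurableEmbedding (· + h) := (MeasurableEquiv.addRight h).measurableEmbedding
    rw [hμ, withDensity_apply _ (hemb.measurableSet_image.2 hs),
      ← (measurePreserving_add_right (volume : Measure ℝ) h).setLIntegral_comp_emb hemb]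
  have hIoi : μ (Ioi (y + h)) = ∫⁻ v in Ioi y, f (v + h) := by
    rw [← apply_image_add _ measurableSet_Ioi, image_add_const_Ioi]
  have hIoc : μ (Ioc (x + h) (y + h)) = ∫⁻ u in Ioc x y, f (u + h) := by
    rw [← apply_image_add _ measurableSet_Ioc, image_add_const_Ioc]
  have split : ∀ a b : ℝ, a ≤ b → μ (Ioi a) = μ (Ioc a b) + μ (Ioi b) := fun a b hab => by
    rw [← measure_union Ioc_disjoint_Ioi_same measurableSet_Ioi, Ioc_union_Ioi_eq_Ioi hab]
  have hfh : Measurable fun u => f (u + h) := by fun_prop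
  calc μ (Ioi x) * μ (Ioi (y + h))
      = μ (Ioc x y) * μ (Ioi (y + h)) + μ (Ioi y) * μ (Ioi (y + h)) := by
        rw [split x y hxy, add_mul]
    _ ≤ μ (Ioc (x + h) (y + h)) * μ (Ioi y) + μ (Ioi y) * μ (Ioi (y + h)) := by
        gcongr ?_ + _
        rw [hIoi, hIoc, hμ, withDensity_apply _ measurableSet_Ioc,
          withDensity_apply _ measurableSet_Ioi,
          ← lintegral_lintegral_mul hfm.aemeasurable hfh.aemeasurable,
          ← lintegral_lintegral_mul hfh.aemeasurable hfm.aemeasurable]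
        refine setLIntegral_mono' measurableSet_Ioc fun u hu => ?_
        exact setLIntegral_mono' measurableSet_Ioi fun v hv => hf (hu.2.trans hv.le) hh
    _ = μ (Ioi (x + h)) * μ (Ioi y) := by
        rw [split (x + h) (y + h) (by linarith), add_mul, mul_comm (μ (Ioi y))]

end HasAntitoneRatios

theorem IsConvexPotential.tailLogConcave {φ : ℝ → EReal} (hφ : IsConvexPotential φ) :
    TailLogConcave (volume.withDensity fun x => EReal.exp (-φ x)) :=
  hφ.hasAntitoneRatios_exp_neg.withDensity_tailLogConcave
    (EReal.measurable_exp.comp hφ.measurable.neg)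

theorem antitone_measureReal_Ioi (μ : Measure ℝ) [IsFiniteMeasure μ] :
    Antitone fun x => μ.real (Ioi x) :=
  fun _ _ h => measureReal_mono (Ioi_subset_Ioi h)

theorem continuous_measureReal_Ioi (μ : Measure ℝ) [IsFiniteMeasure μ] [NullSingletonClass μ] :
    Continuous fun x => μ.real (Ioi x) := by
  have h (x : ℝ) : μ.real (Ioi x) = ∫ y, (Iio y).indicator (fun _ => (1 : ℝ)) x ∂μ := by
    rw [← integral_indicator_one measurableSet_Ioi]
    rfl
  simp_rw [h]
  refine continuous_iff_continuousAt.2 fun x => continuousAt_of_dominated (bound := fun _ => 1)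
    (.of_forall fun x => ?_) (.of_forall fun x => .of_forall fun y => ?_) (integrable_const _) ?_
  · exact (measurable_const.indicator (measurableSet_Ioi (a := x))).aestronglyMeasurable
  · exact (norm_indicator_le_norm_self _ _).trans_eq norm_one
  · have hne : ∀ᵐ y ∂μ, y ≠ x := by
      simp only [ae_iff, not_not, ofPred_eq_eq_singleton, measure_singleton]
    filter_upwards [hne] with y hy
    rcases hy.lt_or_gt with hyx | hxy
    · refine (continuousAt_const (y := (0 : ℝ))).congr ?_
      filter_upwards [lt_mem_nhds hyx] with x' hx'
      exact (indicator_of_notMem (notMem_Iio.2 (le_of_lt hx')) fun _ => (1 : ℝ)).symm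
    · refine (continuousAt_const (y := (1 : ℝ))).congr ?_
      filter_upwards [gt_mem_nhds hxy] with x' hx'
      exact (indicator_of_mem (mem_Iio.2 hx') fun _ => (1 : ℝ)).symm

/-! ### One-sided stop-loss transforms -/

/-- The one-sided stop-loss transform `x ↦ 𝔼 (Y - x)₊` of a law `μ` on the line. -/
def upperStopLoss (μ : Measure ℝ) (x : ℝ) : ℝ := ∫ y, max (y - x) 0 ∂μ

section upperStopLoss

variable {μ : Measure ℝ}

theorem upperStopLoss_nonneg (μ : Measure ℝ) (x : ℝ) : 0 ≤ upperStopLoss μ x :=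
  integral_nonneg fun _ => le_max_right _ _

theorem measureReal_Ioi_pos_of_upperStopLoss_pos [IsFiniteMeasure μ] {x : ℝ}
    (hpos : 0 < upperStopLoss μ x) : 0 < μ.real (Ioi x) := by
  refine measureReal_nonneg.lt_of_ne fun h0 => hpos.ne' (integral_eq_zero_of_ae ?_)
  have hnull : ∀ᵐ y ∂μ, y ∉ Ioi x :=
    measure_eq_zero_iff_ae_notMem.1 ((measureReal_eq_zero_iff).1 h0.symm)
  filter_upwards [hnull] with y hy
  exact max_eq_right (sub_nonpos.2 (notMem_Ioi.1 hy))

variable [IsFiniteMeasure μ]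

theorem integrable_max_sub_zero (hμ : Integrable (fun y => y) μ) (x : ℝ) :
    Integrable (fun y => max (y - x) 0) μ :=
  (hμ.sub (integrable_const x)).pos_part

theorem antitone_upperStopLoss (hμ : Integrable (fun y => y) μ) : Antitone (upperStopLoss μ) :=
  fun x y hxy => integral_mono (integrable_max_sub_zero hμ y) (integrable_max_sub_zero hμ x)
    fun u => max_le_max (sub_le_sub_left hxy u) le_rfl

theorem ofReal_upperStopLoss (hμ : Integrable (fun y => y) μ) (x : ℝ) :
    ENNReal.ofReal (upperStopLoss μ x) = ∫⁻ t in Ioi 0, μ (Ioi (x + t)) := by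
  have hi := integrable_max_sub_zero hμ x
  have h0 : 0 ≤ᵐ[μ] fun y => max (y - x) 0 := .of_forall fun y => le_max_right _ _
  rw [upperStopLoss, ofReal_integral_eq_lintegral_ofReal hi h0,
    lintegral_eq_lintegral_meas_lt μ h0 hi.aemeasurable]
  refine setLIntegral_congr_fun measurableSet_Ioi fun t (ht : 0 < t) => congrArg μ ?_
  ext y
  simp only [mem_ofPred_eq, mem_Ioi, lt_max_iff, not_lt_of_gt ht, or_false, lt_sub_iff_add_lt']

theorem upperStopLoss_eq_setIntegral (hμ : Integrable (fun y => y) μ) (x : ℝ) :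
    IntegrableOn (fun u => μ.real (Ioi u)) (Ioi x) ∧
      upperStopLoss μ x = ∫ u in Ioi x, μ.real (Ioi u) := by
  have hS : ∫⁻ u in Ioi x, ENNReal.ofReal (μ.real (Ioi u)) =
      ENNReal.ofReal (upperStopLoss μ x) := by
    have hemb : MeasurableEmbedding (x + ·) := (MeasurableEquiv.addLeft x).measurableEmbedding
    have himage := image_const_add_Ioi x 0
    rw [add_zero] at himage
    rw [ofReal_upperStopLoss hμ, ← himage,
      ← (measurePreserving_add_left (volume : Measure ℝ) x).setLIntegral_comp_emb hemb]
    exact lintegral_congr fun u => ofReal_measureReal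
  have hm : AEStronglyMeasurable (fun u => μ.real (Ioi u)) (volume.restrict (Ioi x)) :=
    (antitone_measureReal_Ioi μ).measurable.aestronglyMeasurable
  have h0 : 0 ≤ᵐ[volume.restrict (Ioi x)] fun u => μ.real (Ioi u) :=
    .of_forall fun u => measureReal_nonneg
  refine ⟨(lintegral_ofReal_ne_top_iff_integrable hm h0).1 ?_, ?_⟩
  · rw [hS]
    exact ENNReal.ofReal_ne_top
  · rw [integral_eq_lintegral_of_nonneg_ae h0 hm, hS,
      ENNReal.toReal_ofReal (upperStopLoss_nonneg μ x)]

theorem hasDerivAt_upperStopLoss [NullSingletonClass μ] (hμ : Integrable (fun y => y) μ) (x : ℝ) :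
    HasDerivAt (upperStopLoss μ) (-μ.real (Ioi x)) x := by
  have hS := continuous_measureReal_Ioi μ
  have heq : upperStopLoss μ = fun u => upperStopLoss μ x - ∫ v in x..u, μ.real (Ioi v) := by
    funext u
    obtain ⟨hx, hx'⟩ := upperStopLoss_eq_setIntegral hμ x
    obtain ⟨hu, hu'⟩ := upperStopLoss_eq_setIntegral hμ u
    rw [← intervalIntegral.integral_Ioi_sub_Ioi' hx hu, hx', hu', sub_sub_cancel]
  rw [heq]
  exact (intervalIntegral.integral_hasDerivAt_right (hS.intervalIntegrable _ _)
    (hS.stronglyMeasurableAtFilter _ _) hS.continuousAt).const_sub _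

end upperStopLoss

namespace TailLogConcave

variable {μ : Measure ℝ} [IsFiniteMeasure μ]

theorem measureReal_mul_upperStopLoss_le (h : TailLogConcave μ) (hμ : Integrable (fun y => y) μ)
    {x y : ℝ} (hxy : x ≤ y) :
    μ.real (Ioi x) * upperStopLoss μ y ≤ μ.real (Ioi y) * upperStopLoss μ x := by
  have hm : Measurable fun x => μ (Ioi x) :=
    Antitone.measurable fun _ _ hab => measure_mono (Ioi_subset_Ioi hab)
  have hratio := h.setLIntegral_Ioi_mul_le hm hxy
  rw [← ofReal_upperStopLoss hμ, ← ofReal_upperStopLoss hμ] at hratio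
  simpa only [ENNReal.toReal_mul, ENNReal.toReal_ofReal (upperStopLoss_nonneg μ _)] using!
    ENNReal.toReal_mono (ENNReal.mul_ne_top (measure_ne_top _ _) ENNReal.ofReal_ne_top) hratio

-- The logarithmic derivative of the stop-loss transform is antitone, so its logarithm lies below
-- each of its tangents.
theorem upperStopLoss_le [NullSingletonClass μ] (h : TailLogConcave μ)
    (hμ : Integrable (fun y => y) μ) {x₀ : ℝ} (hpos : 0 < upperStopLoss μ x₀) (x : ℝ) :
    upperStopLoss μ x ≤ upperStopLoss μ x₀ *
      Real.exp (-(μ.real (Ioi x₀) / upperStopLoss μ x₀ * (x - x₀))) := by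
  set r := μ.real (Ioi x₀) / upperStopLoss μ x₀ with hr
  set G := fun z => upperStopLoss μ z * Real.exp (r * (z - x₀)) with hG
  have hderiv (z : ℝ) : HasDerivAt G
      ((r * upperStopLoss μ z - μ.real (Ioi z)) * Real.exp (r * (z - x₀))) z := by
    have hexp : HasDerivAt (fun z => Real.exp (r * (z - x₀)))
        (Real.exp (r * (z - x₀)) * (r * 1)) z :=
      (((hasDerivAt_id z).sub_const x₀).const_mul r).exp
    exact ((hasDerivAt_upperStopLoss hμ z).mul hexp).congr_deriv (by ring)
  have hcont : Continuous G := continuous_iff_continuousAt.2 fun z => (hderiv z).continuousAt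
  have hle : G x ≤ G x₀ := by
    rcases le_total x₀ x with hx | hx
    · refine antitoneOn_of_deriv_nonpos (convex_Ici x₀) hcont.continuousOn
        (fun z _ => (hderiv z).differentiableAt.differentiableWithinAt) (fun z hz => ?_)
        self_mem_Ici hx hx
      rw [interior_Ici] at hz
      rw [(hderiv z).deriv, hr, div_mul_eq_mul_div]
      refine mul_nonpos_of_nonpos_of_nonneg (sub_nonpos.2 ?_) (Real.exp_pos _).le
      rw [div_le_iff₀ hpos]
      exact h.measureReal_mul_upperStopLoss_le hμ hz.le
    · refine monotoneOn_of_deriv_nonneg (convex_Iic x₀) hcont.continuousOn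
        (fun z _ => (hderiv z).differentiableAt.differentiableWithinAt) (fun z hz => ?_)
        hx self_mem_Iic hx
      rw [interior_Iic] at hz
      rw [(hderiv z).deriv, hr, div_mul_eq_mul_div]
      refine mul_nonneg (sub_nonneg.2 ?_) (Real.exp_pos _).le
      rw [le_div_iff₀ hpos]
      exact h.measureReal_mul_upperStopLoss_le hμ hz.le
  calc upperStopLoss μ x = G x * Real.exp (-(r * (x - x₀))) := by
        rw [hG, mul_assoc, ← Real.exp_add, add_neg_cancel, Real.exp_zero, mul_one]
    _ ≤ G x₀ * Real.exp (-(r * (x - x₀))) := by gcongr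
    _ = upperStopLoss μ x₀ * Real.exp (-(r * (x - x₀))) := by
        simp only [hG, sub_self, mul_zero, Real.exp_zero, mul_one]

theorem measureReal_Ioi_le [NullSingletonClass μ] (h : TailLogConcave μ)
    (hμ : Integrable (fun y => y) μ) {x₀ : ℝ} (hpos : 0 < upperStopLoss μ x₀) {x : ℝ}
    (hx : x ≤ x₀) :
    μ.real (Ioi x) ≤ μ.real (Ioi x₀) *
      Real.exp (-(μ.real (Ioi x₀) / upperStopLoss μ x₀ * (x - x₀))) := by
  refine le_of_mul_le_mul_right ?_ hpos
  calc μ.real (Ioi x) * upperStopLoss μ x₀ ≤ μ.real (Ioi x₀) * upperStopLoss μ x :=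
        h.measureReal_mul_upperStopLoss_le hμ hx
    _ ≤ μ.real (Ioi x₀) * (upperStopLoss μ x₀ * _) := by gcongr; exact h.upperStopLoss_le hμ hpos x
    _ = _ := by ring

end TailLogConcave

/-! ### The extremal stop-loss transforms -/

/-- The stop-loss transform `x ↦ 𝔼 (|Y| - x)₊` of a law `μ` on the line. -/
def stopLoss (μ : Measure ℝ) (x : ℝ) : ℝ := ∫ y, max (|y| - x) 0 ∂μ

/-- The decay rate of the extremal law with parameter `t`, normalised by `𝔼 |Y| = 1`. -/
def extremalRate (t : ℝ) : ℝ := 2 * Real.exp (-t) / (2 - t)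

/-- The stop-loss transform of `|Y|` for `Y` proportional to `(ℰ - 1) - (1 - t) (ℰ' - 1)` with
`ℰ, ℰ'` independent standard exponentials, normalised by `𝔼 |Y| = 1`. It interpolates between
the double-exponential law (`t = 0`) and the one-sided one (`t = 1`). -/
def extremalStopLoss (t x : ℝ) : ℝ :=
  if extremalRate t * x ≤ t then Real.cosh (extremalRate t * x) - x
  else (Real.exp (-(extremalRate t * x)) +
    (1 - t) ^ 2 * Real.exp t * Real.exp (-((extremalRate t * x - t) / (1 - t)))) / 2

/-- The laws to which the extremal problem applies: centred atomless probability laws on the line,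
log-concave in both tails, normalised by `𝔼 |Y| = 1`. -/
structure IsNormalizedLogConcave (μ : Measure ℝ) : Prop where
  isProbabilityMeasure : IsProbabilityMeasure μ
  nullSingletonClass : NullSingletonClass μ
  tailLogConcave : TailLogConcave μ
  tailLogConcave_neg : TailLogConcave (μ.map Neg.neg)
  integrable : Integrable (fun y => y) μ
  integral_eq_zero : ∫ y, y ∂μ = 0
  integral_abs : ∫ y, |y| ∂μ = 1

section reflection

variable {μ : Measure ℝ}

theorem integral_map_neg (f : ℝ → ℝ) (hf : Continuous f) :
    ∫ y, f y ∂μ.map Neg.neg = ∫ y, f (-y) ∂μ :=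
  integral_map measurable_neg.aemeasurable hf.aestronglyMeasurable

theorem nullSingletonClass_map_of_injective {f : ℝ → ℝ} [NullSingletonClass μ] (hf : Measurable f)
    (hinj : Function.Injective f) : NullSingletonClass (μ.map f) where
  measure_singleton x := by
    rw [Measure.map_apply hf (measurableSet_singleton x)]
    exact (subsingleton_singleton.preimage hinj).measure_zero μ

theorem stopLoss_map_neg (μ : Measure ℝ) : stopLoss (μ.map Neg.neg) = stopLoss μ := by
  funext x
  rw [stopLoss, integral_map_neg _ (by fun_prop)]
  simp only [abs_neg, stopLoss]

theorem stopLoss_eq_add [IsFiniteMeasure μ] (hμ : Integrable (fun y => y) μ) {x : ℝ}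
    (hx : 0 ≤ x) : stopLoss μ x = upperStopLoss μ x + upperStopLoss (μ.map Neg.neg) x := by
  have hneg : Integrable (fun y => max (-y - x) 0) μ := (hμ.neg.sub (integrable_const x)).pos_part
  rw [upperStopLoss, upperStopLoss, integral_map_neg _ (by fun_prop),
    ← integral_add (integrable_max_sub_zero hμ x) hneg]
  refine integral_congr_ae (.of_forall fun y => ?_)
  rcases le_total 0 y with hy | hy
  · simp only [abs_of_nonneg hy, max_eq_right (by linarith : -y - x ≤ 0), add_zero]
  · simp only [abs_of_nonpos hy, max_eq_right (by linarith : y - x ≤ 0), zero_add]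

theorem upperStopLoss_map_neg [IsProbabilityMeasure μ] (hμ : Integrable (fun y => y) μ)
    (hmean : ∫ y, y ∂μ = 0) (x : ℝ) :
    upperStopLoss (μ.map Neg.neg) x = upperStopLoss μ (-x) - x := by
  have hx : Integrable (fun y => y + x) μ := hμ.add (integrable_const x)
  calc upperStopLoss (μ.map Neg.neg) x
      = ∫ y, (max (y - -x) 0 - (y + x)) ∂μ := by
        rw [upperStopLoss, integral_map_neg _ (by fun_prop)]
        refine integral_congr_ae (.of_forall fun y => ?_)
        rcases le_total 0 (y + x) with hy | hy
        · simp only [max_eq_right (by linarith : -y - x ≤ 0), sub_neg_eq_add, max_eq_left hy,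
            sub_self]
        · simp only [max_eq_left (by linarith : 0 ≤ -y - x), sub_neg_eq_add, max_eq_right hy,
            zero_sub, neg_add']
    _ = upperStopLoss μ (-x) - x := by
        rw [integral_sub (integrable_max_sub_zero hμ _) hx, integral_add hμ (integrable_const x),
          hmean, zero_add, integral_const, probReal_univ, one_smul, upperStopLoss]

theorem measureReal_map_neg_Ioi [IsProbabilityMeasure μ] [NullSingletonClass μ] (x : ℝ) :
    (μ.map Neg.neg).real (Ioi x) = 1 - μ.real (Ioi (-x)) := by
  rw [map_measureReal_apply measurable_neg measurableSet_Ioi, neg_preimage, neg_Ioi,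
    measureReal_congr Iio_ae_eq_Iic, ← compl_Ioi, probReal_compl_eq_one_sub measurableSet_Ioi]

end reflection

theorem extremalRate_pos {t : ℝ} (ht : t ≤ 1) : 0 < extremalRate t :=
  div_pos (by positivity) (by linarith)

theorem extremalRate_eq {a t : ℝ} (ht : t ≤ 1) (h : Real.exp t * (2 - t) = a⁻¹) :
    extremalRate t = 2 * a := by
  have h2t : 2 - t ≠ 0 := by linarith
  rw [extremalRate, Real.exp_neg, ← inv_inv a, ← h]
  field_simp

theorem exists_exp_mul_two_sub_eq {z : ℝ} (h2 : 2 ≤ z) (he : z ≤ Real.exp 1) :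
    ∃ t ∈ Icc (0 : ℝ) 1, Real.exp t * (2 - t) = z := by
  refine intermediate_value_Icc zero_le_one
    (f := fun t : ℝ => Real.exp t * (2 - t)) (by fun_prop) ⟨?_, ?_⟩
  · simpa only [Real.exp_zero, sub_zero, one_mul]
  · norm_num
    exact he

namespace IsNormalizedLogConcave

variable {μ : Measure ℝ}

protected theorem map_neg (h : IsNormalizedLogConcave μ) :
    IsNormalizedLogConcave (μ.map Neg.neg) where
  isProbabilityMeasure :=
    have := h.isProbabilityMeasure
    Measure.isProbabilityMeasure_map measurable_neg.aemeasurable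
  nullSingletonClass :=
    have := h.nullSingletonClass
    nullSingletonClass_map_of_injective measurable_neg neg_injective
  tailLogConcave := h.tailLogConcave_neg
  tailLogConcave_neg := by
    rw [Measure.map_map measurable_neg measurable_neg, neg_comp_neg, Measure.map_id]
    exact h.tailLogConcave
  integrable := by
    rw [integrable_map_measure (by fun_prop) measurable_neg.aemeasurable]
    exact h.integrable.neg
  integral_eq_zero := by
    rw [integral_map_neg _ continuous_id', integral_neg, h.integral_eq_zero, neg_zero]
  integral_abs := by
    simpa only [integral_map_neg _ continuous_abs, abs_neg] using h.integral_abs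

theorem upperStopLoss_zero (h : IsNormalizedLogConcave μ) : upperStopLoss μ 0 = 1 / 2 := by
  have := h.isProbabilityMeasure
  have hadd := stopLoss_eq_add h.integrable le_rfl
  have hone : stopLoss μ 0 = 1 := by simpa only [stopLoss, sub_zero, abs_nonneg, max_eq_left]
    using h.integral_abs
  rw [hone, upperStopLoss_map_neg h.integrable h.integral_eq_zero, neg_zero, sub_zero] at hadd
  linarith

theorem measureReal_Ioi_zero_pos (h : IsNormalizedLogConcave μ) : 0 < μ.real (Ioi 0) := by
  have := h.isProbabilityMeasure
  exact measureReal_Ioi_pos_of_upperStopLoss_pos (h.upperStopLoss_zero.trans_gt one_half_pos)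

theorem upperStopLoss_le_exp (h : IsNormalizedLogConcave μ) (x : ℝ) :
    upperStopLoss μ x ≤ Real.exp (-(2 * μ.real (Ioi 0) * x)) / 2 := by
  have := h.isProbabilityMeasure
  have := h.nullSingletonClass
  refine (h.tailLogConcave.upperStopLoss_le h.integrable
    (h.upperStopLoss_zero.trans_gt one_half_pos) x).trans_eq ?_
  rw [h.upperStopLoss_zero]
  ring_nf

theorem measureReal_Ioi_le_exp (h : IsNormalizedLogConcave μ) {x : ℝ} (hx : x ≤ 0) :
    μ.real (Ioi x) ≤ μ.real (Ioi 0) * Real.exp (-(2 * μ.real (Ioi 0) * x)) := by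
  have := h.isProbabilityMeasure
  have := h.nullSingletonClass
  refine (h.tailLogConcave.measureReal_Ioi_le h.integrable
    (h.upperStopLoss_zero.trans_gt one_half_pos) hx).trans_eq ?_
  rw [h.upperStopLoss_zero]
  ring_nf

theorem upperStopLoss_map_neg_le (h : IsNormalizedLogConcave μ) (x : ℝ) :
    upperStopLoss (μ.map Neg.neg) x ≤ Real.exp (2 * μ.real (Ioi 0) * x) / 2 - x := by
  have := h.isProbabilityMeasure
  rw [upperStopLoss_map_neg h.integrable h.integral_eq_zero]
  simpa only [mul_neg, neg_neg] using sub_le_sub_right (h.upperStopLoss_le_exp (-x)) x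

-- The inequality of Grünbaum.
theorem inv_measureReal_Ioi_zero_le (h : IsNormalizedLogConcave μ) :
    (μ.real (Ioi 0))⁻¹ ≤ Real.exp 1 := by
  have ha := h.measureReal_Ioi_zero_pos
  set a := μ.real (Ioi 0) with ha_def
  have hle := (upperStopLoss_nonneg _ _).trans
    (h.upperStopLoss_map_neg_le (Real.log a⁻¹ / (2 * a)))
  rw [← ha_def, mul_div_cancel₀ _ (by positivity), Real.exp_log (by positivity), sub_nonneg,
    div_le_iff₀ (by positivity)] at hle
  rw [← Real.log_le_iff_le_exp (by positivity)]
  exact hle.trans_eq (by field_simp)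

section parameter

variable {t : ℝ}

-- At the crossover point `x = t / (2 a)`, with `a = ℙ (Y > 0)`, of the two branches of the
-- extremal transform.
theorem upperStopLoss_map_neg_crossover_le (h : IsNormalizedLogConcave μ)
    (hta : Real.exp t * (2 - t) = (μ.real (Ioi 0))⁻¹) :
    upperStopLoss (μ.map Neg.neg) (t / (2 * μ.real (Ioi 0))) ≤
      (1 - t) ^ 2 * Real.exp t / 2 := by
  have ha := h.measureReal_Ioi_zero_pos
  refine (h.upperStopLoss_map_neg_le _).trans_eq ?_
  rw [mul_div_cancel₀ t (by positivity), div_mul_eq_div_div, div_eq_mul_inv (t / 2), ← hta]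
  ring

theorem le_measureReal_map_neg_Ioi_crossover (h : IsNormalizedLogConcave μ) (ht : 0 ≤ t) :
    1 - μ.real (Ioi 0) * Real.exp t ≤
      (μ.map Neg.neg).real (Ioi (t / (2 * μ.real (Ioi 0)))) := by
  have := h.isProbabilityMeasure
  have := h.nullSingletonClass
  have ha := h.measureReal_Ioi_zero_pos
  have hle := h.measureReal_Ioi_le_exp (x := -(t / (2 * μ.real (Ioi 0))))
    (neg_nonpos.2 (by positivity))
  rw [mul_neg, neg_neg, mul_div_cancel₀ t (by positivity)] at hle
  rw [measureReal_map_neg_Ioi]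
  exact sub_le_sub_left hle 1

theorem rate_le_hazard_crossover (h : IsNormalizedLogConcave μ) (ht : t ∈ Ico (0 : ℝ) 1)
    (hta : Real.exp t * (2 - t) = (μ.real (Ioi 0))⁻¹)
    (hpos : 0 < upperStopLoss (μ.map Neg.neg) (t / (2 * μ.real (Ioi 0)))) :
    2 * μ.real (Ioi 0) / (1 - t) ≤
      (μ.map Neg.neg).real (Ioi (t / (2 * μ.real (Ioi 0)))) /
        upperStopLoss (μ.map Neg.neg) (t / (2 * μ.real (Ioi 0))) := by
  have ha := h.measureReal_Ioi_zero_pos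
  have hs : 0 < 1 - t := sub_pos.2 ht.2
  have hat : μ.real (Ioi 0) * (Real.exp t * (2 - t)) = 1 := by rw [hta, mul_inv_cancel₀ ha.ne']
  rw [div_le_div_iff₀ hs hpos]
  calc 2 * μ.real (Ioi 0) * upperStopLoss (μ.map Neg.neg) (t / (2 * μ.real (Ioi 0)))
      ≤ 2 * μ.real (Ioi 0) * ((1 - t) ^ 2 * Real.exp t / 2) := by
        gcongr
        exact h.upperStopLoss_map_neg_crossover_le hta
    _ = (1 - μ.real (Ioi 0) * Real.exp t) * (1 - t) := by linear_combination (1 - t) * hat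
    _ ≤ _ := by
        gcongr
        exact h.le_measureReal_map_neg_Ioi_crossover ht.1

theorem upperStopLoss_map_neg_le_of_crossover_le (h : IsNormalizedLogConcave μ)
    (ht : t ∈ Icc (0 : ℝ) 1) (hta : Real.exp t * (2 - t) = (μ.real (Ioi 0))⁻¹) {x : ℝ}
    (hx : t / (2 * μ.real (Ioi 0)) ≤ x) :
    upperStopLoss (μ.map Neg.neg) x ≤
      (1 - t) ^ 2 * Real.exp t / 2 * Real.exp (-((2 * μ.real (Ioi 0) * x - t) / (1 - t))) := by
  have ha := h.measureReal_Ioi_zero_pos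
  have hneg := h.map_neg
  have := hneg.isProbabilityMeasure
  have := hneg.nullSingletonClass
  have hτ := h.upperStopLoss_map_neg_crossover_le hta
  set τ := t / (2 * μ.real (Ioi 0)) with hτ_def
  rcases (upperStopLoss_nonneg (μ.map Neg.neg) τ).eq_or_lt with h0 | hpos
  · calc upperStopLoss (μ.map Neg.neg) x ≤ upperStopLoss (μ.map Neg.neg) τ :=
          antitone_upperStopLoss hneg.integrable hx
      _ ≤ _ := by rw [← h0]; positivity
  have ht1 : t < 1 := ht.2.lt_of_ne fun ht1 => by
    rw [ht1, sub_self, zero_pow two_ne_zero, zero_mul, zero_div] at hτ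
    exact hτ.not_gt hpos
  refine (h.tailLogConcave_neg.upperStopLoss_le hneg.integrable hpos x).trans ?_
  have hrate : (2 * μ.real (Ioi 0) * x - t) / (1 - t) ≤
      (μ.map Neg.neg).real (Ioi τ) / upperStopLoss (μ.map Neg.neg) τ * (x - τ) :=
    calc (2 * μ.real (Ioi 0) * x - t) / (1 - t) = 2 * μ.real (Ioi 0) / (1 - t) * (x - τ) := by
          rw [hτ_def]; field_simp
      _ ≤ _ := mul_le_mul_of_nonneg_right (h.rate_le_hazard_crossover ⟨ht.1, ht1⟩ hta hpos)
          (sub_nonneg.2 hx)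
  gcongr

end parameter

theorem exists_stopLoss_le_extremal_of_le_half (h : IsNormalizedLogConcave μ)
    (hhalf : μ.real (Ioi 0) ≤ 1 / 2) :
    ∃ t ∈ Icc (0 : ℝ) 1, ∀ x, 0 ≤ x → stopLoss μ x ≤ extremalStopLoss t x := by
  have := h.isProbabilityMeasure
  have ha := h.measureReal_Ioi_zero_pos
  have h2a : 2 ≤ (μ.real (Ioi 0))⁻¹ := by
    rw [le_inv_comm₀ two_pos ha, ← one_div]
    exact hhalf
  obtain ⟨t, ht, hta⟩ := exists_exp_mul_two_sub_eq h2a h.inv_measureReal_Ioi_zero_le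
  refine ⟨t, ht, fun x hx => ?_⟩
  rw [stopLoss_eq_add h.integrable hx, extremalStopLoss, extremalRate_eq ht.2 hta]
  have hright := h.upperStopLoss_le_exp x
  split_ifs with hxt
  · have hleft := h.upperStopLoss_map_neg_le x
    rw [Real.cosh_eq]
    linarith
  · have hτx : t / (2 * μ.real (Ioi 0)) ≤ x := by
      rw [div_le_iff₀' (by positivity)]
      exact (not_le.1 hxt).le
    have hleft := h.upperStopLoss_map_neg_le_of_crossover_le ht hta hτx
    linarith

theorem exists_stopLoss_le_extremal (h : IsNormalizedLogConcave μ) :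
    ∃ t ∈ Icc (0 : ℝ) 1, ∀ x, 0 ≤ x → stopLoss μ x ≤ extremalStopLoss t x := by
  rcases le_total (μ.real (Ioi 0)) (1 / 2) with hhalf | hhalf
  · exact h.exists_stopLoss_le_extremal_of_le_half hhalf
  · have := h.isProbabilityMeasure
    have := h.nullSingletonClass
    rw [← stopLoss_map_neg]
    refine h.map_neg.exists_stopLoss_le_extremal_of_le_half ?_
    rw [measureReal_map_neg_Ioi, neg_zero]
    linarith

end IsNormalizedLogConcave

/-! ### Moments as integrals of the stop-loss transform -/

/-- The integrand which, up to the weight `x ^ (p - 2)`, represents `m ^ p` when `r = (m - x)₊`.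
According to the range of `p` it is `(m - x)₊`, `min x m` or `(x - m)₊`, written so as to be affine
in `m` and `r` and therefore compatible with expectations. -/
def stopLossKernel (p x m r : ℝ) : ℝ := if 1 < p then r else if 0 < p then m - r else x - m + r

/-- The integral of the stop-loss kernel with `m = 1` against `x ^ (p - 2)`. -/
def stopLossIntegral (p : ℝ) (π : ℝ → ℝ) : ℝ≥0∞ :=
  ∫⁻ x in Ioi 0, ENNReal.ofReal (x ^ (p - 2) * stopLossKernel p x 1 (π x))

/-- The `p`-th absolute moment, for `p ≠ 0, 1`, of a law with `𝔼 |Y| = 1` and stop-loss transform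
`π`. -/
def stopLossMoment (p : ℝ) (π : ℝ → ℝ) : ℝ≥0∞ :=
  ENNReal.ofReal |p * (p - 1)| * stopLossIntegral p π

theorem setLIntegral_ofReal_eq {s : Set ℝ} {f : ℝ → ℝ} {I : ℝ} (hs : MeasurableSet s)
    (hf : IntegrableOn f s) (h0 : ∀ x ∈ s, 0 ≤ f x) (hI : ∫ x in s, f x = I) :
    ∫⁻ x in s, ENNReal.ofReal (f x) = ENNReal.ofReal I := by
  rw [← hI, ofReal_integral_eq_lintegral_ofReal hf]
  exact (ae_restrict_iff' hs).2 (.of_forall h0)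

theorem setLIntegral_Ioi_zero_eq_add {y : ℝ} (hy : 0 ≤ y) (F : ℝ → ℝ≥0∞) :
    ∫⁻ x in Ioi 0, F x = (∫⁻ x in Ioc 0 y, F x) + ∫⁻ x in Ioi y, F x := by
  rw [← Ioc_union_Ioi_eq_Ioi hy, lintegral_union measurableSet_Ioi Ioc_disjoint_Ioi_same]

theorem integral_Ioc_rpow {r y : ℝ} (hr : -1 < r) (hy : 0 ≤ y) :
    ∫ x in Ioc 0 y, x ^ r = y ^ (r + 1) / (r + 1) := by
  rw [← intervalIntegral.integral_of_le hy, integral_rpow (.inl hr), Real.zero_rpow (by linarith),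
    sub_zero]

theorem integrableOn_Ioc_rpow {r : ℝ} (hr : -1 < r) (y : ℝ) :
    IntegrableOn (fun x : ℝ => x ^ r) (Ioc 0 y) :=
  (intervalIntegral.intervalIntegrable_rpow' hr (a := 0) (b := y)).1

theorem rpow_sub_two_mul_self (p : ℝ) {x : ℝ} (hx : 0 < x) : x ^ (p - 2) * x = x ^ (p - 1) := by
  rw [← Real.rpow_add_one hx.ne']
  ring_nf

section powers

variable {p y : ℝ}

theorem lintegral_rpow_mul_max_sub_of_neg (hp : p < 0) (hy : 0 < y) :
    ∫⁻ x in Ioi 0, ENNReal.ofReal (x ^ (p - 2) * max (x - y) 0) =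
      ENNReal.ofReal (y ^ p / (p * (p - 1))) := by
  have hi₁ : IntegrableOn (fun x : ℝ => x ^ (p - 1)) (Ioi y) :=
    integrableOn_Ioi_rpow_of_lt (by linarith) hy
  have hi₂ : IntegrableOn (fun x : ℝ => y * x ^ (p - 2)) (Ioi y) :=
    (integrableOn_Ioi_rpow_of_lt (by linarith) hy).const_mul y
  have hf : EqOn (fun x => x ^ (p - 1) - y * x ^ (p - 2)) (fun x => x ^ (p - 2) * max (x - y) 0)
      (Ioi y) := fun x (hx : y < x) => by
    simp only [max_eq_left (sub_nonneg.2 hx.le), mul_sub, rpow_sub_two_mul_self p (hy.trans hx),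
      mul_comm y]
  have hzero : ∫⁻ x in Ioc 0 y, ENNReal.ofReal (x ^ (p - 2) * max (x - y) 0) = 0 :=
    (setLIntegral_eq_zero_iff measurableSet_Ioc (by fun_prop)).2 (.of_forall fun x hx => by
      rw [max_eq_right (sub_nonpos.2 hx.2), mul_zero, ENNReal.ofReal_zero])
  rw [setLIntegral_Ioi_zero_eq_add hy.le, hzero, zero_add]
  refine setLIntegral_ofReal_eq measurableSet_Ioi ((hi₁.sub hi₂).congr_fun hf measurableSet_Ioi)
    (fun x hx => mul_nonneg (Real.rpow_nonneg (hy.trans hx).le _) (le_max_right _ _)) ?_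
  rw [← setIntegral_congr_fun measurableSet_Ioi hf, integral_sub hi₁ hi₂, integral_const_mul,
    integral_Ioi_rpow_of_lt (by linarith) hy, integral_Ioi_rpow_of_lt (by linarith) hy,
    sub_add_cancel, show p - 2 + 1 = p - 1 by ring, Real.rpow_sub_one hy.ne']
  have hp1 : p - 1 ≠ 0 := by linarith
  have hp0 := hp.ne
  field_simp
  ring

theorem lintegral_rpow_mul_min (hp : 0 < p) (hp1 : p < 1) (hy : 0 < y) :
    ∫⁻ x in Ioi 0, ENNReal.ofReal (x ^ (p - 2) * min x y) =
      ENNReal.ofReal (y ^ p / (p * (1 - p))) := by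
  have hf : EqOn (fun x : ℝ => x ^ (p - 1)) (fun x => x ^ (p - 2) * min x y) (Ioc 0 y) :=
    fun x hx => by simp only [min_eq_left hx.2, rpow_sub_two_mul_self p hx.1]
  have hg : EqOn (fun x : ℝ => x ^ (p - 2) * y) (fun x => x ^ (p - 2) * min x y) (Ioi y) :=
    fun x (hx : y < x) => by simp only [min_eq_right hx.le]
  have hi : IntegrableOn (fun x : ℝ => x ^ (p - 2) * y) (Ioi y) :=
    (integrableOn_Ioi_rpow_of_lt (by linarith) hy).mul_const y
  have hlow : ∫⁻ x in Ioc 0 y, ENNReal.ofReal (x ^ (p - 2) * min x y) =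
      ENNReal.ofReal (y ^ p / p) := by
    refine setLIntegral_ofReal_eq measurableSet_Ioc
      ((integrableOn_Ioc_rpow (by linarith) y).congr_fun hf measurableSet_Ioc)
      (fun x hx => mul_nonneg (Real.rpow_nonneg hx.1.le _) (le_min hx.1.le hy.le)) ?_
    rw [← setIntegral_congr_fun measurableSet_Ioc hf, integral_Ioc_rpow (by linarith) hy.le,
      sub_add_cancel]
  have hhigh : ∫⁻ x in Ioi y, ENNReal.ofReal (x ^ (p - 2) * min x y) =
      ENNReal.ofReal (y ^ p / (1 - p)) := by
    refine setLIntegral_ofReal_eq measurableSet_Ioi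
      (hi.congr_fun hg measurableSet_Ioi)
      (fun x (hx : y < x) => mul_nonneg (Real.rpow_nonneg (hy.trans hx).le _)
        (le_min (hy.trans hx).le hy.le)) ?_
    rw [← setIntegral_congr_fun measurableSet_Ioi hg, integral_mul_const,
      integral_Ioi_rpow_of_lt (by linarith) hy, show p - 2 + 1 = p - 1 by ring, div_mul_eq_mul_div,
      neg_mul, ← Real.rpow_add_one hy.ne', sub_add_cancel, neg_div, ← div_neg, neg_sub]
  rw [setLIntegral_Ioi_zero_eq_add hy.le, hlow, hhigh, ← ENNReal.ofReal_add
    (by positivity) (div_nonneg (by positivity) (sub_nonneg.2 hp1.le))]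
  have hp1' : 1 - p ≠ 0 := by linarith
  congr 1
  field_simp
  ring

theorem lintegral_rpow_mul_max_sub_of_one_lt (hp : 1 < p) (hy : 0 < y) :
    ∫⁻ x in Ioi 0, ENNReal.ofReal (x ^ (p - 2) * max (y - x) 0) =
      ENNReal.ofReal (y ^ p / (p * (p - 1))) := by
  have hi₁ : IntegrableOn (fun x : ℝ => x ^ (p - 1)) (Ioc 0 y) :=
    integrableOn_Ioc_rpow (by linarith) y
  have hi₂ : IntegrableOn (fun x : ℝ => y * x ^ (p - 2)) (Ioc 0 y) :=
    (integrableOn_Ioc_rpow (by linarith) y).const_mul y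
  have hf : EqOn (fun x => y * x ^ (p - 2) - x ^ (p - 1)) (fun x => x ^ (p - 2) * max (y - x) 0)
      (Ioc 0 y) := fun x hx => by
    simp only [max_eq_left (sub_nonneg.2 hx.2), mul_sub, rpow_sub_two_mul_self p hx.1, mul_comm y]
  have hzero : ∫⁻ x in Ioi y, ENNReal.ofReal (x ^ (p - 2) * max (y - x) 0) = 0 :=
    (setLIntegral_eq_zero_iff measurableSet_Ioi (by fun_prop)).2 (.of_forall fun x hx => by
      rw [max_eq_right (sub_nonpos.2 (le_of_lt hx)), mul_zero, ENNReal.ofReal_zero])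
  rw [setLIntegral_Ioi_zero_eq_add hy.le, hzero, add_zero]
  refine setLIntegral_ofReal_eq measurableSet_Ioc ((hi₂.sub hi₁).congr_fun hf measurableSet_Ioc)
    (fun x hx => mul_nonneg (Real.rpow_nonneg hx.1.le _) (le_max_right _ _)) ?_
  rw [← setIntegral_congr_fun measurableSet_Ioc hf, integral_sub hi₂ hi₁, integral_const_mul,
    integral_Ioc_rpow (by linarith) hy.le, integral_Ioc_rpow (by linarith) hy.le,
    sub_add_cancel, show p - 2 + 1 = p - 1 by ring, Real.rpow_sub_one hy.ne']
  have hp1 : p - 1 ≠ 0 := by linarith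
  field_simp
  ring

theorem ofReal_rpow_eq_lintegral_stopLossKernel (hp0 : p ≠ 0) (hp1 : p ≠ 1) (hy : 0 < y) :
    ENNReal.ofReal y ^ p = ENNReal.ofReal |p * (p - 1)| *
      ∫⁻ x in Ioi 0, ENNReal.ofReal (x ^ (p - 2) * stopLossKernel p x y (max (y - x) 0)) := by
  have hne : |p * (p - 1)| ≠ 0 := abs_ne_zero.2 (mul_ne_zero hp0 (sub_ne_zero.2 hp1))
  suffices h : ∫⁻ x in Ioi 0,
      ENNReal.ofReal (x ^ (p - 2) * stopLossKernel p x y (max (y - x) 0)) =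
        ENNReal.ofReal (y ^ p / |p * (p - 1)|) by
    rw [h, ← ENNReal.ofReal_mul (abs_nonneg _), mul_div_cancel₀ _ hne,
      ENNReal.ofReal_rpow_of_pos hy]
  rcases lt_trichotomy p 0 with h0 | h0 | h0
  · have hk (x : ℝ) : stopLossKernel p x y (max (y - x) 0) = max (x - y) 0 := by
      rw [stopLossKernel, if_neg (by linarith), if_neg (by linarith), max_def, max_def]
      split_ifs <;> linarith
    simp only [hk, lintegral_rpow_mul_max_sub_of_neg h0 hy,
      abs_of_pos (mul_pos_of_neg_of_neg h0 (by linarith : p - 1 < 0))]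
  · exact absurd h0 hp0
  rcases lt_or_gt_of_ne hp1 with h1 | h1
  · have hk (x : ℝ) : stopLossKernel p x y (max (y - x) 0) = min x y := by
      rw [stopLossKernel, if_neg (by linarith), if_pos h0, max_def, min_def]
      split_ifs <;> linarith
    simp only [hk, lintegral_rpow_mul_min h0 h1 hy, abs_mul, abs_of_pos h0,
      abs_of_neg (sub_neg.2 h1), neg_sub]
  · simp only [stopLossKernel, if_pos h1, lintegral_rpow_mul_max_sub_of_one_lt h1 hy,
      abs_of_pos (mul_pos h0 (sub_pos.2 h1))]

end powers

section kernel

variable {p x m r r' y : ℝ}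

theorem stopLossKernel_nonneg (hx : 0 ≤ x) (hy : 0 ≤ y) :
    0 ≤ stopLossKernel p x y (max (y - x) 0) := by
  rw [stopLossKernel]
  split_ifs
  · exact le_max_right _ _
  · exact sub_nonneg.2 (max_le (by linarith) hy)
  · linarith [le_max_left (y - x) 0]

theorem stopLossKernel_le (hp : p ≤ 0 ∨ 1 < p) (h : r ≤ r') :
    stopLossKernel p x m r ≤ stopLossKernel p x m r' := by
  rw [stopLossKernel, stopLossKernel]
  split_ifs
  · exact h
  · rcases hp with hp | hp <;> linarith
  · linarith

theorem stopLossKernel_le_of_le_one (hp : 0 < p) (hp1 : p ≤ 1) (h : r ≤ r') :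
    stopLossKernel p x m r' ≤ stopLossKernel p x m r := by
  simp only [stopLossKernel, if_neg hp1.not_gt, if_pos hp]
  linarith

theorem integrable_stopLossKernel {α : Type*} [MeasurableSpace α] {μ : Measure α}
    [IsFiniteMeasure μ] {f g : α → ℝ} (hf : Integrable f μ) (hg : Integrable g μ) (p x : ℝ) :
    Integrable (fun a => stopLossKernel p x (f a) (g a)) μ := by
  unfold stopLossKernel
  split_ifs
  · exact hg
  · exact hf.sub hg
  · exact ((integrable_const x).sub hf).add hg

theorem integral_stopLossKernel {α : Type*} [MeasurableSpace α] {μ : Measure α}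
    [IsProbabilityMeasure μ] {f g : α → ℝ} (hf : Integrable f μ) (hg : Integrable g μ) (p x : ℝ) :
    ∫ a, stopLossKernel p x (f a) (g a) ∂μ =
      stopLossKernel p x (∫ a, f a ∂μ) (∫ a, g a ∂μ) := by
  unfold stopLossKernel
  split_ifs
  · rfl
  · exact integral_sub hf hg
  · have hxf : Integrable (fun a => x - f a) μ := (integrable_const x).sub hf
    rw [integral_add hxf hg, integral_sub (integrable_const x) hf, integral_const, probReal_univ,
      one_smul]

end kernel

theorem lintegral_enorm_rpow_eq_stopLossMoment {μ : Measure ℝ} [IsProbabilityMeasure μ]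
    [NullSingletonClass μ] (hμ : Integrable (fun y => y) μ) (hone : ∫ y, |y| ∂μ = 1) {p : ℝ}
    (hp0 : p ≠ 0) (hp1 : p ≠ 1) :
    ∫⁻ y, ‖y‖ₑ ^ p ∂μ = stopLossMoment p (stopLoss μ) := by
  have hne : ∀ᵐ y ∂μ, y ≠ 0 := by
    simp only [ae_iff, not_not, ofPred_eq_eq_singleton, measure_singleton]
  have hmeas : Measurable fun q : ℝ × ℝ =>
      ENNReal.ofReal (q.2 ^ (p - 2) * stopLossKernel p q.2 |q.1| (max (|q.1| - q.2) 0)) := by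
    unfold stopLossKernel
    split_ifs <;> fun_prop
  have hinner (x : ℝ) (hx : 0 < x) :
      ∫⁻ y, ENNReal.ofReal (x ^ (p - 2) * stopLossKernel p x |y| (max (|y| - x) 0)) ∂μ =
        ENNReal.ofReal (x ^ (p - 2) * stopLossKernel p x 1 (stopLoss μ x)) := by
    have hmax : Integrable (fun y => max (|y| - x) 0) μ :=
      (hμ.abs.sub (integrable_const x)).pos_part
    rw [← ofReal_integral_eq_lintegral_ofReal
      ((integrable_stopLossKernel hμ.abs hmax p x).const_mul _)
      (.of_forall fun y => mul_nonneg (by positivity)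
        (stopLossKernel_nonneg hx.le (abs_nonneg y))), integral_const_mul,
      integral_stopLossKernel hμ.abs hmax, hone, stopLoss]
  calc ∫⁻ y, ‖y‖ₑ ^ p ∂μ = ∫⁻ y, (ENNReal.ofReal |p * (p - 1)| * ∫⁻ x in Ioi 0,
        ENNReal.ofReal (x ^ (p - 2) * stopLossKernel p x |y| (max (|y| - x) 0))) ∂μ := by
        refine lintegral_congr_ae ?_
        filter_upwards [hne] with y hy
        rw [← ofReal_rpow_eq_lintegral_stopLossKernel hp0 hp1 (abs_pos.2 hy),
          Real.enorm_eq_ofReal_abs]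
    _ = ENNReal.ofReal |p * (p - 1)| * ∫⁻ x in Ioi 0, ∫⁻ y,
        ENNReal.ofReal (x ^ (p - 2) * stopLossKernel p x |y| (max (|y| - x) 0)) ∂μ := by
        rw [lintegral_const_mul' _ _ ENNReal.ofReal_ne_top,
          lintegral_lintegral_swap hmeas.aemeasurable]
    _ = stopLossMoment p (stopLoss μ) := by
        rw [stopLossMoment, stopLossIntegral, setLIntegral_congr_fun measurableSet_Ioi hinner]

section stopLossMoment

variable {p : ℝ} {π π' : ℝ → ℝ}

theorem stopLossMoment_mono (hp : p ≤ 0 ∨ 1 < p) (h : ∀ x, 0 < x → π x ≤ π' x) :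
    stopLossMoment p π ≤ stopLossMoment p π' :=
  mul_le_mul_right (setLIntegral_mono' measurableSet_Ioi fun x hx =>
    ENNReal.ofReal_le_ofReal (mul_le_mul_of_nonneg_left (stopLossKernel_le hp (h x hx))
      (Real.rpow_nonneg (le_of_lt hx) _))) _

theorem stopLossMoment_anti (hp : 0 < p) (hp1 : p ≤ 1) (h : ∀ x, 0 < x → π x ≤ π' x) :
    stopLossMoment p π' ≤ stopLossMoment p π :=
  mul_le_mul_right (setLIntegral_mono' measurableSet_Ioi fun x hx =>
    ENNReal.ofReal_le_ofReal (mul_le_mul_of_nonneg_left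
      (stopLossKernel_le_of_le_one hp hp1 (h x hx)) (Real.rpow_nonneg (le_of_lt hx) _))) _

theorem ofReal_abs_mul_sub_one_ne_zero (hp0 : p ≠ 0) (hp1 : p ≠ 1) :
    ENNReal.ofReal |p * (p - 1)| ≠ 0 :=
  (ENNReal.ofReal_pos.2 (abs_pos.2 (mul_ne_zero hp0 (sub_ne_zero.2 hp1)))).ne'

theorem stopLossMoment_le_iff (hp0 : p ≠ 0) (hp1 : p ≠ 1) :
    stopLossMoment p π ≤ stopLossMoment p π' ↔ stopLossIntegral p π ≤ stopLossIntegral p π' :=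
  ENNReal.mul_le_mul_iff_right (ofReal_abs_mul_sub_one_ne_zero hp0 hp1) ENNReal.ofReal_ne_top

theorem stopLossMoment_eq_top_iff (hp0 : p ≠ 0) (hp1 : p ≠ 1) :
    stopLossMoment p π = ⊤ ↔ stopLossIntegral p π = ⊤ := by
  simp only [stopLossMoment, ENNReal.mul_eq_top, ofReal_abs_mul_sub_one_ne_zero hp0 hp1,
    ENNReal.ofReal_ne_top, ne_eq, not_false_eq_true, true_and, false_and, or_false]

end stopLossMoment

/-! ### Comparison of stop-loss transforms that cross once -/

/-- The elementary bounds `max 0 (1 - x) ≤ π x ≤ 1` satisfied by the stop-loss transform of a law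
with `𝔼 |Y| = 1`; they make the stop-loss kernel nonnegative. -/
structure IsStopLoss (π : ℝ → ℝ) : Prop where
  measurable : Measurable π
  nonneg : ∀ x, 0 < x → 0 ≤ π x
  le_one : ∀ x, 0 < x → π x ≤ 1
  one_sub_le : ∀ x, 0 < x → 1 - x ≤ π x

/-- The function `π` lies below `π'` before `c` and above it after `c`. -/
def CrossesAt (c : ℝ) (π π' : ℝ → ℝ) : Prop :=
  (∀ x, 0 < x → x < c → π x ≤ π' x) ∧ ∀ x, c < x → π' x ≤ π x

section crossing

variable {π π' : ℝ → ℝ} {c k p q x : ℝ}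

theorem IsStopLoss.kernel_nonneg (h : IsStopLoss π) (p : ℝ) (hx : 0 < x) :
    0 ≤ stopLossKernel p x 1 (π x) := by
  have hnonneg := h.nonneg x hx
  have hle := h.le_one x hx
  have hge := h.one_sub_le x hx
  rw [stopLossKernel]
  split_ifs <;> linarith

theorem IsStopLoss.measurable_integrand (h : IsStopLoss π) (p : ℝ) :
    Measurable fun x => ENNReal.ofReal (x ^ (p - 2) * stopLossKernel p x 1 (π x)) := by
  have := h.measurable
  unfold stopLossKernel
  split_ifs <;> fun_prop

theorem IsStopLoss.stopLossIntegral_add_mul (h : IsStopLoss π) (h' : IsStopLoss π') (p q : ℝ)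
    (hk : 0 ≤ k) :
    stopLossIntegral p π + ENNReal.ofReal k * stopLossIntegral q π' =
      ∫⁻ x in Ioi 0, ENNReal.ofReal (x ^ (p - 2) * stopLossKernel p x 1 (π x) +
        k * x ^ (q - 2) * stopLossKernel q x 1 (π' x)) := by
  rw [stopLossIntegral, stopLossIntegral, ← lintegral_const_mul' _ _ ENNReal.ofReal_ne_top,
    ← lintegral_add_left (h.measurable_integrand p)]
  refine setLIntegral_congr_fun measurableSet_Ioi fun x (hx : 0 < x) => ?_
  have hp := h.kernel_nonneg p hx
  have hq := h'.kernel_nonneg q hx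
  rw [← ENNReal.ofReal_mul hk, ← ENNReal.ofReal_add (by positivity) (by positivity), mul_assoc]

theorem rpow_sub_two_eq_mul (hx : 0 < x) (p q : ℝ) :
    x ^ (p - 2) = x ^ (p - q) * x ^ (q - 2) := by
  rw [← Real.rpow_add hx, sub_add_sub_cancel]

namespace CrossesAt

theorem rpow_mul_sub_le (h : CrossesAt c π π') (hc : 0 < c) (hpq : p < q) (hx : 0 < x) :
    x ^ (p - 2) * (π x - π' x) ≤ c ^ (p - q) * x ^ (q - 2) * (π x - π' x) := by
  have hxq := Real.rpow_nonneg hx.le (q - 2)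
  rw [rpow_sub_two_eq_mul hx p q]
  rcases lt_trichotomy x c with hxc | rfl | hxc
  · have hpow := Real.rpow_le_rpow_of_nonpos hx hxc.le (sub_neg.2 hpq).le
    exact mul_le_mul_of_nonpos_right (mul_le_mul_of_nonneg_right hpow hxq)
      (sub_nonpos.2 (h.1 x hx hxc))
  · exact le_rfl
  · have hpow := Real.rpow_le_rpow_of_nonpos hc hxc.le (sub_neg.2 hpq).le
    exact mul_le_mul_of_nonneg_right (mul_le_mul_of_nonneg_right hpow hxq)
      (sub_nonneg.2 (h.2 x hxc))

theorem stopLossIntegral_add_le (hcr : CrossesAt c π π') (hc : 0 < c) (h : IsStopLoss π)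
    (h' : IsStopLoss π') (hpq : p < q) (hq : 1 < q) (hp : p ≤ 0 ∨ 1 < p) :
    stopLossIntegral p π + ENNReal.ofReal (c ^ (p - q)) * stopLossIntegral q π' ≤
      stopLossIntegral p π' + ENNReal.ofReal (c ^ (p - q)) * stopLossIntegral q π := by
  have hk : 0 ≤ c ^ (p - q) := Real.rpow_nonneg hc.le _
  rw [h.stopLossIntegral_add_mul h' p q hk, h'.stopLossIntegral_add_mul h p q hk]
  refine setLIntegral_mono' measurableSet_Ioi fun x hx => ENNReal.ofReal_le_ofReal ?_
  have hle := hcr.rpow_mul_sub_le hc hpq hx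
  simp only [stopLossKernel, if_pos hq]
  split_ifs
  · linarith
  · rcases hp with hp | hp <;> linarith
  · linarith

theorem stopLossIntegral_add_le_of_le_one (hcr : CrossesAt c π π') (hc : 0 < c)
    (h : IsStopLoss π) (h' : IsStopLoss π') (hq : 1 < q) (hp : 0 < p) (hp1 : p ≤ 1) :
    stopLossIntegral p π' + ENNReal.ofReal (c ^ (p - q)) * stopLossIntegral q π' ≤
      stopLossIntegral p π + ENNReal.ofReal (c ^ (p - q)) * stopLossIntegral q π := by
  have hk : 0 ≤ c ^ (p - q) := Real.rpow_nonneg hc.le _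
  rw [h'.stopLossIntegral_add_mul h' p q hk, h.stopLossIntegral_add_mul h p q hk]
  refine setLIntegral_mono' measurableSet_Ioi fun x hx => ENNReal.ofReal_le_ofReal ?_
  have hle := hcr.rpow_mul_sub_le hc (hp1.trans_lt hq) hx
  simp only [stopLossKernel, if_pos hq, if_neg hp1.not_gt, if_pos hp]
  linarith

theorem stopLossIntegral_add_lt (hcr : CrossesAt c π π') (hc : 0 < c) (h : IsStopLoss π)
    (h' : IsStopLoss π') (hpq : p < q) (hp : 1 < p) (hlt : ∀ x, c < x → π' x < π x)
    (hfp : stopLossIntegral p π' ≠ ⊤) (hfq : stopLossIntegral q π ≠ ⊤) :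
    stopLossIntegral p π + ENNReal.ofReal (c ^ (p - q)) * stopLossIntegral q π' <
      stopLossIntegral p π' + ENNReal.ofReal (c ^ (p - q)) * stopLossIntegral q π := by
  have hq : 1 < q := hp.trans hpq
  have hk : 0 < c ^ (p - q) := Real.rpow_pos_of_pos hc _
  have hfin := ne_top_of_le_ne_top
    (ENNReal.add_ne_top.2 ⟨hfp, ENNReal.mul_ne_top ENNReal.ofReal_ne_top hfq⟩)
    (hcr.stopLossIntegral_add_le hc h h' hpq hq (.inr hp))
  rw [h.stopLossIntegral_add_mul h' p q hk.le] at hfin ⊢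
  rw [h'.stopLossIntegral_add_mul h p q hk.le]
  have hm := h.measurable
  have hm' := h'.measurable
  simp only [stopLossKernel, if_pos hq, if_pos hp] at hfin ⊢
  refine lintegral_strict_mono_of_ae_le_of_ae_lt_on (s := Ioi c) (by fun_prop) hfin
    ((ae_restrict_iff' measurableSet_Ioi).2 (.of_forall fun x hx => ENNReal.ofReal_le_ofReal ?_))
    ?_ (.of_forall fun x (hx : c < x) => ?_)
  · linarith [hcr.rpow_mul_sub_le hc hpq hx]
  · rw [Measure.restrict_apply measurableSet_Ioi, Ioi_inter_Ioi, max_eq_left hc.le, Real.volume_Ioi]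
    exact ENNReal.top_ne_zero
  · have hx0 : 0 < x := hc.trans hx
    have hnonneg' := h'.nonneg x hx0
    have hpos : 0 < π x := hnonneg'.trans_lt (hlt x hx)
    have hpow := Real.rpow_lt_rpow_of_neg hc hx (sub_neg.2 hpq)
    have hmul := mul_lt_mul_of_pos_right
      (mul_lt_mul_of_pos_right hpow (Real.rpow_pos_of_pos hx0 (q - 2))) (sub_pos.2 (hlt x hx))
    rw [ENNReal.ofReal_lt_ofReal_iff (by positivity), rpow_sub_two_eq_mul hx0 p q]
    linarith

theorem stopLossMoment_le (hcr : CrossesAt c π π') (hc : 0 < c) (h : IsStopLoss π)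
    (h' : IsStopLoss π') (hpq : p < q) (hq : 1 < q) (hp : p < 0 ∨ 1 < p)
    (hfin : stopLossMoment q π' ≠ ⊤) (hle : stopLossMoment q π ≤ stopLossMoment q π') :
    stopLossMoment p π ≤ stopLossMoment p π' := by
  rw [Ne, stopLossMoment_eq_top_iff (by linarith) hq.ne'] at hfin
  rw [stopLossMoment_le_iff (by linarith) hq.ne'] at hle
  rw [stopLossMoment_le_iff (by rcases hp with hp | hp <;> linarith)
    (by rcases hp with hp | hp <;> linarith)]
  have hadd := hcr.stopLossIntegral_add_le hc h h' hpq hq (hp.imp_left le_of_lt)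
  exact (ENNReal.add_le_add_iff_right (ENNReal.mul_ne_top ENNReal.ofReal_ne_top hfin)).1
    (hadd.trans (by gcongr))

theorem le_stopLossMoment (hcr : CrossesAt c π π') (hc : 0 < c) (h : IsStopLoss π)
    (h' : IsStopLoss π') (hq : 1 < q) (hp : 0 < p) (hp1 : p < 1)
    (hfin : stopLossMoment q π' ≠ ⊤) (hle : stopLossMoment q π ≤ stopLossMoment q π') :
    stopLossMoment p π' ≤ stopLossMoment p π := by
  rw [Ne, stopLossMoment_eq_top_iff (by linarith) hq.ne'] at hfin
  rw [stopLossMoment_le_iff (by linarith) hq.ne'] at hle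
  rw [stopLossMoment_le_iff hp.ne' hp1.ne]
  have hadd := hcr.stopLossIntegral_add_le_of_le_one hc h h' hq hp hp1.le
  exact (ENNReal.add_le_add_iff_right (ENNReal.mul_ne_top ENNReal.ofReal_ne_top hfin)).1
    (hadd.trans (by gcongr))

theorem stopLossMoment_lt (hcr : CrossesAt c π π') (hc : 0 < c) (h : IsStopLoss π)
    (h' : IsStopLoss π') (hpq : p < q) (hp : 1 < p) (hlt : ∀ x, c < x → π' x < π x)
    (hfp : stopLossMoment p π' ≠ ⊤) (hfq : stopLossMoment q π' ≠ ⊤)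
    (hle : stopLossMoment q π ≤ stopLossMoment q π') :
    stopLossMoment p π < stopLossMoment p π' := by
  have hfq' := ne_top_of_le_ne_top hfq hle
  rw [Ne, stopLossMoment_eq_top_iff (by linarith) (by linarith)] at hfp hfq hfq'
  rw [stopLossMoment_le_iff (by linarith) (by linarith)] at hle
  rw [← not_le, stopLossMoment_le_iff (by linarith) (by linarith), not_le]
  have hadd := hcr.stopLossIntegral_add_lt hc h h' hpq hp hlt hfp hfq'
  refine (ENNReal.add_lt_add_iff_right
    (ENNReal.mul_ne_top ENNReal.ofReal_ne_top hfq (a := ENNReal.ofReal (c ^ (p - q))))).1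
    (hadd.trans_le (by gcongr))

end CrossesAt

end crossing

/-! ### The extremal transforms cross the exponential one exactly once -/

/-- Once the function `f` is positive at a point of `s`, it is positive from there on. -/
def StaysPosOn (f : ℝ → ℝ) (s : Set ℝ) : Prop :=
  ∀ ⦃x⦄, x ∈ s → ∀ ⦃y⦄, x < y → 0 < f x → 0 < f y

section staysPos

variable {f f' : ℝ → ℝ} {a c : ℝ}

theorem exists_deriv_pos_of_lt (hf : ∀ x, HasDerivAt f (f' x) x) (hac : a < c) (h : f a < f c) :
    ∃ x ∈ Ioo a c, 0 < f' x := by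
  obtain ⟨x, hx, hfx⟩ := exists_hasDerivAt_eq_slope f f' hac
    (fun y _ => (hf y).continuousAt.continuousWithinAt) fun y _ => hf y
  exact ⟨x, hx, hfx ▸ div_pos (sub_pos.2 h) (sub_pos.2 hac)⟩

theorem lt_of_hasDerivAt_pos (hf : ∀ x, HasDerivAt f (f' x) x) (hac : a < c)
    (h : ∀ x, a < x → 0 < f' x) : f a < f c := by
  obtain ⟨x, hx, hfx⟩ := exists_hasDerivAt_eq_slope f f' hac
    (fun y _ => (hf y).continuousAt.continuousWithinAt) fun y _ => hf y
  have hpos := h x hx.1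
  rw [hfx, div_pos_iff_of_pos_right (sub_pos.2 hac)] at hpos
  exact sub_pos.1 hpos

theorem staysPosOn_of_monotone (hf : Monotone f) (s : Set ℝ) : StaysPosOn f s :=
  fun _ _ _ hxy hx => hx.trans_le (hf hxy.le)

theorem StaysPosOn.of_hasDerivAt (hf : ∀ x, HasDerivAt f (f' x) x) (hf' : StaysPosOn f' (Ici a))
    (ha : f a ≤ 0 ∨ 0 < f' a) : StaysPosOn f (Ici a) := by
  intro x hx y hxy hfx
  obtain ⟨ξ, haξ, hξx, hξ⟩ : ∃ ξ, a ≤ ξ ∧ ξ ≤ x ∧ 0 < f' ξ := by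
    rcases ha with ha | ha
    · have hax : a < x := hx.lt_of_ne fun hax => (hax ▸ ha).not_gt hfx
      obtain ⟨ξ, hξ, hpos⟩ := exists_deriv_pos_of_lt hf hax (ha.trans_lt hfx)
      exact ⟨ξ, hξ.1.le, hξ.2.le, hpos⟩
    · exact ⟨a, le_rfl, hx, ha⟩
  exact hfx.trans (lt_of_hasDerivAt_pos hf hxy fun z hz => hf' haξ (hξx.trans_lt hz) hξ)

theorem StaysPosOn.deriv_pos (hf : ∀ x, HasDerivAt f (f' x) x) (hf' : StaysPosOn f' (Ici a))
    (ha : f a ≤ 0) (hac : a < c) (hc : 0 < f c) : 0 < f' c := by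
  obtain ⟨ξ, hξ, hpos⟩ := exists_deriv_pos_of_lt hf hac (ha.trans_lt hc)
  exact hf' hξ.1.le hξ.2 hpos

theorem staysPosOn_exp_sub_exp {b p q : ℝ} (hb : 0 ≤ b) (hpq : b = 0 ∨ p ≤ q) (s : Set ℝ) :
    StaysPosOn (fun x => a * Real.exp (-(p * x)) - b * Real.exp (-(q * x))) s := by
  rcases hpq with rfl | hpq
  · intro x _ y _ hx
    simp only [zero_mul, sub_zero, mul_pos_iff_of_pos_right (Real.exp_pos _)] at hx ⊢
    exact hx
  have hfactor (z : ℝ) : a * Real.exp (-(p * z)) - b * Real.exp (-(q * z)) =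
      Real.exp (-(p * z)) * (a - b * Real.exp (-((q - p) * z))) := by
    rw [mul_sub, mul_left_comm, ← Real.exp_add]
    ring_nf
  simp only [StaysPosOn, hfactor, mul_pos_iff_of_pos_left (Real.exp_pos _)]
  refine staysPosOn_of_monotone (fun x y hxy => ?_) s
  have : 0 ≤ q - p := sub_nonneg.2 hpq
  gcongr

theorem exists_crossesAt {π π' : ℝ → ℝ} {δ : ℝ} (h : StaysPosOn (fun x => π x - π' x) (Ioi 0))
    (hδ : 0 < δ) (hle : π δ ≤ π' δ) (hlt : ∃ x, 0 < x ∧ π' x < π x) :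
    ∃ c, 0 < c ∧ CrossesAt c π π' ∧ ∀ x, c < x → π' x < π x := by
  set S := {x | 0 < x ∧ π' x < π x}
  have hlow : δ ∈ lowerBounds S := fun x hx =>
    not_lt.1 fun hxδ => (sub_pos.1 (h hx.1 hxδ (sub_pos.2 hx.2))).not_ge hle
  have hgt (x : ℝ) (hx : sInf S < x) : π' x < π x := by
    obtain ⟨z, hz, hzx⟩ := exists_lt_of_csInf_lt hlt hx
    exact sub_pos.1 (h hz.1 hzx (sub_pos.2 hz.2))
  exact ⟨sInf S, hδ.trans_le (le_csInf hlt hlow),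
    ⟨fun x hx hxc => not_lt.1 fun hxS => hxc.not_ge (csInf_le ⟨δ, hlow⟩ ⟨hx, hxS⟩),
      fun x hx => (hgt x hx).le⟩, hgt⟩

end staysPos

section extremalRate

variable {t : ℝ}

theorem extremalRate_mul_exp_mul (ht : t ≤ 1) : extremalRate t * (Real.exp t * (2 - t)) = 2 := by
  have h2t : 2 - t ≠ 0 := by linarith
  rw [extremalRate, Real.exp_neg]
  field_simp

theorem two_lt_exp_mul_two_sub (h0 : 0 < t) (h1 : t ≤ 1) : 2 < Real.exp t * (2 - t) := by
  have hquad : (1 + t + t ^ 2 / 2) * (2 - t) ≤ Real.exp t * (2 - t) :=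
    mul_le_mul_of_nonneg_right (Real.quadratic_le_exp_of_nonneg h0.le) (by linarith)
  have hpos : 0 < t * (2 - t ^ 2) := mul_pos h0 (by nlinarith)
  linear_combination hquad + hpos / 2

theorem extremalRate_lt_one (h0 : 0 < t) (h1 : t ≤ 1) : extremalRate t < 1 := by
  rw [extremalRate, div_lt_one (by linarith), Real.exp_neg, ← div_eq_mul_inv,
    div_lt_iff₀ (Real.exp_pos t), mul_comm]
  exact two_lt_exp_mul_two_sub h0 h1

theorem extremalRate_zero : extremalRate 0 = 1 := by
  norm_num [extremalRate]

theorem extremalRate_le_one (h0 : 0 ≤ t) (h1 : t ≤ 1) : extremalRate t ≤ 1 := by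
  rcases h0.eq_or_lt with rfl | h0
  · exact extremalRate_zero.le
  · exact (extremalRate_lt_one h0 h1).le

theorem one_sub_le_extremalRate (h0 : 0 ≤ t) (h1 : t ≤ 1) : 1 - t ≤ extremalRate t := by
  rw [extremalRate, le_div_iff₀ (by linarith)]
  nlinarith [Real.add_one_le_exp (-t)]

end extremalRate

theorem isStopLoss_exp : IsStopLoss fun x => Real.exp (-x) where
  measurable := by fun_prop
  nonneg x _ := (Real.exp_pos _).le
  le_one x hx := Real.exp_le_one_iff.2 (by linarith)
  one_sub_le x _ := by linarith [Real.add_one_le_exp (-x)]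

theorem extremalStopLoss_zero {x : ℝ} (hx : 0 < x) : extremalStopLoss 0 x = Real.exp (-x) := by
  rw [extremalStopLoss, extremalRate_zero, if_neg (by linarith)]
  norm_num

section isStopLoss

variable {t v : ℝ}

theorem cosh_le_one_add (h0 : 0 ≤ v) (h1 : v ≤ 1) : Real.cosh v ≤ 1 + v := by
  have hv : v ^ 2 / 2 < 1 := by nlinarith
  calc Real.cosh v ≤ Real.exp (v ^ 2 / 2) := Real.cosh_le_exp_half_sq v
    _ ≤ 1 / (1 - v ^ 2 / 2) := Real.exp_bound_div_one_sub_of_interval (by positivity) hv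
    _ ≤ 1 + v := by
        rw [div_le_iff₀ (sub_pos.2 hv)]
        nlinarith [mul_nonneg h0 (sub_nonneg.2 h1),
          mul_nonneg (mul_nonneg h0 h0) (sub_nonneg.2 h1)]

-- The tangent bounds of `exp v` at `t` and of `exp (-v)` at `0`.
theorem exp_mul_two_sub_mul_le (hvt : v ≤ t) (ht : t ≤ 1) :
    Real.exp t * (2 - t) * v ≤ 2 * Real.cosh v := by
  have hneg := Real.add_one_le_exp (-v)
  have hpos : Real.exp t * (v - t + 1) ≤ Real.exp v := by
    rw [← add_sub_cancel t v, Real.exp_add, add_sub_cancel_left]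
    gcongr
    exact Real.add_one_le_exp _
  have hgap : 0 ≤ (1 - v) * (1 + Real.exp t * (1 - t)) :=
    mul_nonneg (by linarith) (add_nonneg zero_le_one
      (mul_nonneg (Real.exp_pos t).le (sub_nonneg.2 ht)))
  rw [Real.cosh_eq]
  linarith

theorem one_sub_sq_mul_exp_le_one (h0 : 0 ≤ t) (h1 : t ≤ 1) : (1 - t) ^ 2 * Real.exp t ≤ 1 := by
  calc (1 - t) ^ 2 * Real.exp t = (1 - t) * (1 - t) * Real.exp t := by rw [sq]
    _ ≤ Real.exp (-t) * 1 * Real.exp t := by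
        refine mul_le_mul_of_nonneg_right ?_ (Real.exp_pos t).le
        exact mul_le_mul (Real.one_sub_le_exp_neg t) (by linarith) (sub_nonneg.2 h1)
          (Real.exp_pos _).le
    _ = 1 := by rw [mul_one, ← Real.exp_add, neg_add_cancel, Real.exp_zero]

theorem two_sub_le_exp_add_exp (h0 : 0 ≤ t) (hv : t ≤ v) :
    2 - Real.exp t * (2 - t) * v ≤
      Real.exp (-v) + (1 - t) ^ 2 * Real.exp t * Real.exp (-((v - t) / (1 - t))) := by
  have hcancel : (1 - t) ^ 2 * Real.exp t * (1 - (v - t) / (1 - t)) =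
      Real.exp t * ((1 - t) ^ 2 - (1 - t) * (v - t)) := by
    rcases eq_or_ne (1 - t) 0 with h | h
    · rw [h]; ring
    · field_simp
  have hexp : (1 - t) ^ 2 * Real.exp t * (1 - (v - t) / (1 - t)) ≤
      (1 - t) ^ 2 * Real.exp t * Real.exp (-((v - t) / (1 - t))) := by
    gcongr
    exact Real.one_sub_le_exp_neg _
  have hlin : (1 + t) * (1 - t + v) ≤ Real.exp t * (1 - t + v) := by
    gcongr
    · linarith
    · linarith [Real.add_one_le_exp t]
  have hprod : 0 ≤ t * (v - t) := mul_nonneg h0 (sub_nonneg.2 hv)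
  linarith [Real.add_one_le_exp (-v)]

theorem isStopLoss_extremalStopLoss (h0 : 0 ≤ t) (h1 : t ≤ 1) :
    IsStopLoss (extremalStopLoss t) := by
  have hβ := extremalRate_pos h1
  have hx2 (x : ℝ) : Real.exp t * (2 - t) * (extremalRate t * x) = 2 * x := by
    linear_combination x * extremalRate_mul_exp_mul h1
  refine ⟨?_, fun x hx => ?_, fun x hx => ?_, fun x hx => ?_⟩
  · exact Measurable.ite (measurableSet_le (by fun_prop) (by fun_prop)) (by fun_prop) (by fun_prop)
  all_goals
    have hv : 0 < extremalRate t * x := mul_pos hβ hx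
    rw [extremalStopLoss]
    split_ifs with hvt
  · linarith [exp_mul_two_sub_mul_le hvt h1, hx2 x]
  · positivity
  · have hcosh := cosh_le_one_add hv.le (hvt.trans h1)
    have hle : extremalRate t * x ≤ x := mul_le_of_le_one_left hx.le (extremalRate_le_one h0 h1)
    linarith
  · have hexp : Real.exp (-(extremalRate t * x)) ≤ 1 := Real.exp_le_one_iff.2 (neg_nonpos.2 hv.le)
    have hexp' : Real.exp (-((extremalRate t * x - t) / (1 - t))) ≤ 1 :=
      Real.exp_le_one_iff.2 (neg_nonpos.2 (div_nonneg (by linarith) (by linarith)))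
    have hmul := mul_le_one₀ (one_sub_sq_mul_exp_le_one h0 h1) (Real.exp_pos _).le hexp'
    linarith
  · linarith [Real.one_le_cosh (extremalRate t * x)]
  · linarith [two_sub_le_exp_add_exp h0 (not_le.1 hvt).le, hx2 x]

end isStopLoss

/-- The difference between the extremal stop-loss transform and the exponential one, on the lower
range `extremalRate t * x ≤ t`. -/
def lowerGap (t x : ℝ) : ℝ := Real.cosh (extremalRate t * x) - x - Real.exp (-x)

/-- The difference between the extremal stop-loss transform and the exponential one, multiplied by
`2 exp (extremalRate t * x)`, on the upper range `t ≤ extremalRate t * x`. -/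
def upperGap (t x : ℝ) : ℝ :=
  1 + (1 - t) ^ 2 * Real.exp t * Real.exp (t * (1 - extremalRate t * x) / (1 - t)) -
    2 * Real.exp (-((1 - extremalRate t) * x))

section gap

variable {t x : ℝ}

theorem extremalStopLoss_sub_exp_of_le (h : extremalRate t * x ≤ t) :
    extremalStopLoss t x - Real.exp (-x) = lowerGap t x := by
  rw [extremalStopLoss, if_pos h, lowerGap]

theorem extremalStopLoss_sub_exp_of_lt (h : t < extremalRate t * x) :
    2 * Real.exp (extremalRate t * x) * (extremalStopLoss t x - Real.exp (-x)) = upperGap t x := by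
  rw [extremalStopLoss, if_neg h.not_ge, upperGap]
  have hright : Real.exp (extremalRate t * x) * Real.exp (-(extremalRate t * x)) = 1 := by
    rw [← Real.exp_add, add_neg_cancel, Real.exp_zero]
  have hleft : (1 - t) ^ 2 * (Real.exp (extremalRate t * x) *
      Real.exp (-((extremalRate t * x - t) / (1 - t)))) =
      (1 - t) ^ 2 * Real.exp (t * (1 - extremalRate t * x) / (1 - t)) := by
    rw [← Real.exp_add]
    rcases eq_or_ne (1 - t) 0 with h | h
    · rw [h]; ring
    · congr 2
      field_simp
      ring
  have hexp : Real.exp (-((1 - extremalRate t) * x)) =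
      Real.exp (extremalRate t * x) * Real.exp (-x) := by
    rw [← Real.exp_add]
    ring_nf
  linear_combination hright + Real.exp t * hleft + 2 * hexp

theorem hasDerivAt_lowerGap (t x : ℝ) : HasDerivAt (lowerGap t)
    (extremalRate t * Real.sinh (extremalRate t * x) - 1 + Real.exp (-x)) x := by
  have hcosh : HasDerivAt (fun x => Real.cosh (extremalRate t * x))
      (Real.sinh (extremalRate t * x) * (extremalRate t * 1)) x :=
    ((hasDerivAt_id x).const_mul _).cosh
  exact ((hcosh.sub (hasDerivAt_id x)).sub (hasDerivAt_neg x).exp).congr_deriv (by ring)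

theorem hasDerivAt_deriv_lowerGap (t x : ℝ) :
    HasDerivAt (fun x => extremalRate t * Real.sinh (extremalRate t * x) - 1 + Real.exp (-x))
      (extremalRate t ^ 2 * Real.cosh (extremalRate t * x) - Real.exp (-x)) x := by
  have hsinh : HasDerivAt (fun x => Real.sinh (extremalRate t * x))
      (Real.cosh (extremalRate t * x) * (extremalRate t * 1)) x :=
    ((hasDerivAt_id x).const_mul _).sinh
  exact (((hsinh.const_mul _).sub_const 1).add (hasDerivAt_neg x).exp).congr_deriv (by ring)

theorem hasDerivAt_upperGap (t x : ℝ) : HasDerivAt (upperGap t)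
    (2 * (1 - extremalRate t) * Real.exp (-((1 - extremalRate t) * x)) -
      t * (1 - t) * extremalRate t * Real.exp t *
        Real.exp (t * (1 - extremalRate t * x) / (1 - t))) x := by
  have hfirst : HasDerivAt (fun x => Real.exp (t * (1 - extremalRate t * x) / (1 - t)))
      (Real.exp (t * (1 - extremalRate t * x) / (1 - t)) *
        (t * -(extremalRate t * 1) / (1 - t))) x :=
    (((((hasDerivAt_id x).const_mul _).const_sub 1).const_mul t).div_const _).exp
  have hsecond : HasDerivAt (fun x => Real.exp (-((1 - extremalRate t) * x)))
      (Real.exp (-((1 - extremalRate t) * x)) * -((1 - extremalRate t) * 1)) x :=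
    ((hasDerivAt_id x).const_mul _).neg.exp
  refine (((hfirst.const_mul _).const_add 1).sub (hsecond.const_mul 2)).congr_deriv ?_
  rcases eq_or_ne (1 - t) 0 with h | _
  · rw [h]; ring
  · field_simp
    ring

theorem lowerGap_zero (t : ℝ) : lowerGap t 0 = 0 := by
  simp only [lowerGap, mul_zero, Real.cosh_zero, sub_zero, neg_zero, Real.exp_zero, sub_self]

theorem staysPosOn_deriv_lowerGap (ht : t ≤ 1) : StaysPosOn
    (fun x => extremalRate t * Real.sinh (extremalRate t * x) - 1 + Real.exp (-x)) (Ici 0) := by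
  have hβ := extremalRate_pos ht
  refine .of_hasDerivAt (hasDerivAt_deriv_lowerGap t) (fun x (hx : 0 ≤ x) y hxy hpos => ?_)
    (.inl (by norm_num))
  refine hpos.trans_le ?_
  have hcosh : Real.cosh (extremalRate t * x) ≤ Real.cosh (extremalRate t * y) := by
    rw [Real.cosh_le_cosh, abs_of_nonneg (by positivity),
      abs_of_nonneg (mul_nonneg hβ.le (hx.trans hxy.le))]
    gcongr
  gcongr

theorem staysPosOn_lowerGap (ht : t ≤ 1) : StaysPosOn (lowerGap t) (Ici 0) :=
  .of_hasDerivAt (hasDerivAt_lowerGap t) (staysPosOn_deriv_lowerGap ht) (.inl (lowerGap_zero t).le)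

theorem exists_lowerGap_nonpos (h0 : 0 < t) (h1 : t ≤ 1) {τ : ℝ} (hτ : 0 < τ) :
    ∃ x ∈ Ioo 0 τ, lowerGap t x ≤ 0 := by
  have hβ := extremalRate_pos h1
  have hderiv := funext fun x => (hasDerivAt_lowerGap t x).deriv
  have hmax : IsLocalMax (lowerGap t) 0 := by
    refine isLocalMax_of_deriv_deriv_neg ?_ ?_ (hasDerivAt_lowerGap t 0).continuousAt
    · rw [hderiv, (hasDerivAt_deriv_lowerGap t 0).deriv, mul_zero, Real.cosh_zero, mul_one,
        neg_zero, Real.exp_zero, sub_neg]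
      exact pow_lt_one₀ hβ.le (extremalRate_lt_one h0 h1) two_ne_zero
    · rw [(hasDerivAt_lowerGap t 0).deriv]
      norm_num
  have hright : ∀ᶠ x in 𝓝[>] 0, lowerGap t x ≤ lowerGap t 0 := nhdsWithin_le_nhds hmax
  obtain ⟨x, hx, hxτ⟩ := (hright.and (Ioo_mem_nhdsGT hτ)).exists
  exact ⟨x, hxτ, hx.trans_eq (lowerGap_zero t)⟩

theorem staysPosOn_deriv_upperGap (h0 : 0 ≤ t) (h1 : t ≤ 1) (s : Set ℝ) :
    StaysPosOn (fun x => 2 * (1 - extremalRate t) * Real.exp (-((1 - extremalRate t) * x)) -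
      t * (1 - t) * extremalRate t * Real.exp t *
        Real.exp (t * (1 - extremalRate t * x) / (1 - t))) s := by
  have hβ := extremalRate_pos h1
  have hs : 0 ≤ 1 - t := sub_nonneg.2 h1
  have hsplit (x : ℝ) : t * (1 - t) * extremalRate t * Real.exp t *
      Real.exp (t * (1 - extremalRate t * x) / (1 - t)) =
      t * (1 - t) * extremalRate t * Real.exp t * Real.exp (t / (1 - t)) *
        Real.exp (-(t * extremalRate t / (1 - t) * x)) := by
    rw [mul_assoc _ (Real.exp (t / (1 - t))), ← Real.exp_add]
    ring_nf
  simp only [hsplit]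
  refine staysPosOn_exp_sub_exp (by positivity) ?_ s
  rcases hs.eq_or_lt with hs | hs
  · left
    rw [← hs]
    ring
  · right
    rw [le_div_iff₀ hs]
    linarith [one_sub_le_extremalRate h0 h1]

theorem exp_one_sub_mul_of_mul_eq (hx : extremalRate t * x = t) :
    Real.exp (-((1 - extremalRate t) * x)) = Real.exp t * Real.exp (-x) := by
  rw [← Real.exp_add, sub_mul, hx]
  ring_nf

-- Both branches are continuously differentiable across the point where they meet.
theorem upperGap_of_mul_eq (h1 : t ≤ 1) (hx : extremalRate t * x = t) :
    upperGap t x = 2 * Real.exp t * lowerGap t x := by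
  have hexp : (1 - t) ^ 2 * Real.exp (t * (1 - t) / (1 - t)) = (1 - t) ^ 2 * Real.exp t := by
    rcases eq_or_ne (1 - t) 0 with h | h
    · rw [h, zero_pow two_ne_zero, zero_mul, zero_mul]
    · rw [mul_div_cancel_right₀ _ h]
  have htwo : 2 * x = Real.exp t * (2 - t) * t := by
    linear_combination -x * extremalRate_mul_exp_mul h1 + Real.exp t * (2 - t) * hx
  have hinv : Real.exp t * Real.exp (-t) = 1 := by
    rw [← Real.exp_add, add_neg_cancel, Real.exp_zero]
  rw [upperGap, exp_one_sub_mul_of_mul_eq hx, lowerGap, hx, Real.cosh_eq]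
  linear_combination Real.exp t * hexp + Real.exp t * htwo - hinv

theorem deriv_upperGap_of_mul_eq (h1 : t ≤ 1) (hx : extremalRate t * x = t) :
    2 * (1 - extremalRate t) * Real.exp (-((1 - extremalRate t) * x)) -
        t * (1 - t) * extremalRate t * Real.exp t *
          Real.exp (t * (1 - extremalRate t * x) / (1 - t)) =
      2 * Real.exp t * ((extremalRate t * Real.sinh (extremalRate t * x) - 1 + Real.exp (-x)) +
        extremalRate t * lowerGap t x) := by
  have hexp : t * (1 - t) * Real.exp (t * (1 - t) / (1 - t)) = t * (1 - t) * Real.exp t := by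
    rcases eq_or_ne (1 - t) 0 with h | h
    · rw [h, mul_zero, zero_mul, zero_mul]
    · rw [mul_div_cancel_right₀ _ h]
  rw [exp_one_sub_mul_of_mul_eq hx, lowerGap, hx, Real.cosh_eq, Real.sinh_eq]
  linear_combination -extremalRate t * Real.exp t * hexp -
    (1 + t) * Real.exp t * extremalRate_mul_exp_mul h1 + 2 * Real.exp t * hx

theorem staysPosOn_upperGap (h0 : 0 < t) (h1 : t ≤ 1) (hx : extremalRate t * x = t) :
    StaysPosOn (upperGap t) (Ici x) := by
  refine .of_hasDerivAt (hasDerivAt_upperGap t) (staysPosOn_deriv_upperGap h0.le h1 _) ?_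
  have hβ := extremalRate_pos h1
  have hx0 : 0 < x := pos_of_mul_pos_right (hx.symm ▸ h0) hβ.le
  rw [upperGap_of_mul_eq h1 hx, deriv_upperGap_of_mul_eq h1 hx]
  rcases le_or_gt (lowerGap t x) 0 with hneg | hpos
  · exact .inl (mul_nonpos_of_nonneg_of_nonpos (by positivity) hneg)
  · have hderiv := StaysPosOn.deriv_pos (hasDerivAt_lowerGap t) (staysPosOn_deriv_lowerGap h1)
      (lowerGap_zero t).le hx0 hpos
    exact .inr (by positivity)

theorem staysPosOn_extremalStopLoss_sub_exp (h0 : 0 < t) (h1 : t ≤ 1) :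
    StaysPosOn (fun x => extremalStopLoss t x - Real.exp (-x)) (Ioi 0) := by
  have hβ := extremalRate_pos h1
  set τ := t / extremalRate t
  have hτt : extremalRate t * τ = t := mul_div_cancel₀ t hβ.ne'
  have hlower {z : ℝ} (hz : z ≤ τ) : 0 < extremalStopLoss t z - Real.exp (-z) ↔
      0 < lowerGap t z := by
    rw [extremalStopLoss_sub_exp_of_le ((le_div_iff₀' hβ).1 hz)]
  have hupper {z : ℝ} (hz : τ ≤ z) : 0 < extremalStopLoss t z - Real.exp (-z) ↔
      0 < upperGap t z := by
    rcases hz.eq_or_lt with rfl | hz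
    · rw [hlower le_rfl, upperGap_of_mul_eq h1 hτt, mul_pos_iff_of_pos_left (by positivity)]
    · rw [← extremalStopLoss_sub_exp_of_lt ((div_lt_iff₀' hβ).1 hz),
        mul_pos_iff_of_pos_left (by positivity)]
  intro x hx y hxy
  simp only
  rcases le_total y τ with hy | hy
  · rw [hlower hy, hlower (hxy.le.trans hy)]
    exact staysPosOn_lowerGap h1 (Ioi_subset_Ici_self hx) hxy
  rw [hupper hy]
  rcases le_or_gt τ x with hτx | hxτ
  · rw [hupper hτx]
    exact staysPosOn_upperGap h0 h1 hτt hτx hxy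
  · rw [hlower hxτ.le]
    intro hpos
    have hpos_τ := (hupper le_rfl).1 ((hlower le_rfl).2
      (staysPosOn_lowerGap h1 (Ioi_subset_Ici_self hx) hxτ hpos))
    rcases hy.eq_or_lt with rfl | hy
    · exact hpos_τ
    · exact staysPosOn_upperGap h0 h1 hτt self_mem_Ici hy hpos_τ

theorem exists_exp_lt_extremalStopLoss (h0 : 0 < t) (h1 : t ≤ 1) :
    ∃ x, 0 < x ∧ Real.exp (-x) < extremalStopLoss t x := by
  have hβ := extremalRate_pos h1
  have hlim : Tendsto (fun x => Real.exp ((1 - extremalRate t) * x)) atTop atTop :=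
    Real.tendsto_exp_atTop.comp
      (tendsto_id.const_mul_atTop (sub_pos.2 (extremalRate_lt_one h0 h1)))
  obtain ⟨x, hx, hx0, hxt⟩ := ((hlim.eventually_gt_atTop 2).and
    ((eventually_gt_atTop 0).and (eventually_gt_atTop (t / extremalRate t)))).exists
  refine ⟨x, hx0, ?_⟩
  rw [extremalStopLoss, if_neg (not_le.2 ((div_lt_iff₀' hβ).1 hxt)), lt_div_iff₀' two_pos]
  calc 2 * Real.exp (-x) < Real.exp ((1 - extremalRate t) * x) * Real.exp (-x) := by gcongr
    _ = Real.exp (-(extremalRate t * x)) := by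
        rw [← Real.exp_add]
        ring_nf
    _ ≤ _ := le_add_of_nonneg_right (by positivity)

theorem exists_crossesAt_exp (h0 : 0 < t) (h1 : t ≤ 1) :
    ∃ c, 0 < c ∧ CrossesAt c (extremalStopLoss t) (fun x => Real.exp (-x)) ∧
      ∀ x, c < x → Real.exp (-x) < extremalStopLoss t x := by
  have hβ := extremalRate_pos h1
  obtain ⟨δ, hδ, hδτ⟩ := exists_lowerGap_nonpos h0 h1 (div_pos h0 hβ)
  refine exists_crossesAt (staysPosOn_extremalStopLoss_sub_exp h0 h1) hδ.1 ?_
    (exists_exp_lt_extremalStopLoss h0 h1)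
  rw [← sub_nonpos, extremalStopLoss_sub_exp_of_le ((le_div_iff₀' hβ).1 hδ.2.le)]
  exact hδτ

end gap

/-! ### The polynomials governing the moments of the extremal family -/

/-- The coefficient of the incomplete Gamma function in the derivative of `momentSlope`, as a
polynomial in `s = 1 - t`; see `hasDerivAt_momentSlope`. -/
def gammaCoeff (p s : ℝ) : ℝ := (1 - (p - 1) * s) ^ 2 + p * s ^ 3 * (p - (p + 2) * s + s ^ 2)

/-- The coefficient of the power `t ^ (p - 1)` in the derivative of `momentSlope`, as a polynomial
in `s = 1 - t`; see `hasDerivAt_momentSlope`. -/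
def powerCoeff (p s : ℝ) : ℝ :=
  1 - (p - 1) * s - (p - 1) * s ^ 2 + (p + 2) * s ^ 3 - s ^ 4

/-- The polynomial deciding the monotonicity of `gammaExcess`; see `hasDerivAt_gammaExcess`. -/
def excessCoeff (p s : ℝ) : ℝ :=
  1 + (p - 3) * s + (3 * p - 10) * s ^ 2 + s ^ 3 - 3 * (p - 1) * s ^ 4 + p * s ^ 5

section coeff

variable {p r s : ℝ}

theorem cube_mul_excessCoeff_le (hp : 2.94 ≤ p) (hr : 0 < r) (hrs : r ≤ s) (hs : s ≤ 1) :
    r ^ 3 * excessCoeff p s ≤ s ^ 3 * excessCoeff p r := by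
  have hm : 0 < r * s := mul_pos hr (hr.trans_le hrs)
  have hm1 : r * s ≤ 1 := mul_le_one₀ (hrs.trans hs) (hr.le.trans hrs) hs
  have hfactor : s ^ 3 * excessCoeff p r - r ^ 3 * excessCoeff p s =
      (s - r) * ((s ^ 2 + s * r + r ^ 2) + (p - 3) * (r * s) * (s + r) +
        (3 * p - 10) * (r * s) ^ 2 + 3 * (p - 1) * (r * s) ^ 3 - p * (r * s) ^ 3 * (s + r)) := by
    unfold excessCoeff
    ring
  have hsq : 3 * (r * s) ≤ s ^ 2 + s * r + r ^ 2 := by nlinarith [sq_nonneg (s - r)]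
  rw [← sub_nonneg, hfactor]
  refine mul_nonneg (sub_nonneg.2 hrs) ?_
  set m := r * s
  have hsum : s + r ≤ 2 := by linarith
  have hm2 : m ^ 2 ≤ m := pow_le_of_le_one hm.le hm1 two_ne_zero
  have hm3 : m ^ 3 ≤ m := pow_le_of_le_one hm.le hm1 three_ne_zero
  have hslope : 0 ≤ (p - 2.94) * (m * (s + r) + 3 * m ^ 2 + m ^ 3 * (3 - (s + r))) :=
    mul_nonneg (sub_nonneg.2 hp) (by
      have : 0 ≤ 3 - (s + r) := by linarith
      have : 0 ≤ s + r := by linarith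
      positivity)
  have hcube : m ^ 3 * (-0.06) ≤ m ^ 3 * (5.82 - 2.94 * (s + r)) := by
    gcongr
    linarith
  have hlin : m * (s + r) ≤ m * 2 := by gcongr
  linarith

theorem excessCoeff_nonneg_of_le (hp : 2.94 ≤ p) (hr : 0 < r) (hrs : r ≤ s) (hs : s ≤ 1)
    (h : 0 ≤ excessCoeff p s) : 0 ≤ excessCoeff p r := by
  have hs0 : 0 < s ^ 3 := pow_pos (hr.trans_le hrs) 3
  exact nonneg_of_mul_nonneg_right
    ((mul_nonneg (pow_nonneg hr.le 3) h).trans (cube_mul_excessCoeff_le hp hr hrs hs)) hs0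

theorem gammaCoeff_pos_of_le_two_thirds (hp : 2.94 ≤ p) (hs0 : 0 < s) (hs : s ≤ 2 / 3) :
    0 < gammaCoeff p s := by
  have hquad : 0 < p - (p + 2) * s + s ^ 2 := by nlinarith
  have : 0 < p := by linarith
  unfold gammaCoeff
  positivity

theorem cube_mul_gammaCoeff_le (hp : 2.94 ≤ p) (hr : 2 / 3 ≤ r) (hrs : r ≤ s) (hs : s ≤ 1) :
    r ^ 3 * gammaCoeff p s ≤ s ^ 3 * gammaCoeff p r := by
  have hfactor : s ^ 3 * gammaCoeff p r - r ^ 3 * gammaCoeff p s =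
      (s - r) * ((s + r - (p - 1) * (r * s)) ^ 2 +
        (r * s) * (p * (p + 2 - (s + r)) * (r * s) ^ 2 - 1)) := by
    unfold gammaCoeff
    ring
  have hm : 4 / 9 ≤ r * s := by nlinarith
  have hcoeff : 8 ≤ p * (p + 2 - (s + r)) := by nlinarith
  have hlast : 1 ≤ p * (p + 2 - (s + r)) * (r * s) ^ 2 :=
    calc (1 : ℝ) ≤ 8 * (4 / 9) ^ 2 := by norm_num
      _ ≤ p * (p + 2 - (s + r)) * (r * s) ^ 2 := by gcongr
  rw [← sub_nonneg, hfactor]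
  exact mul_nonneg (sub_nonneg.2 hrs)
    (add_nonneg (sq_nonneg _) (mul_nonneg (by linarith) (sub_nonneg.2 hlast)))

theorem gammaCoeff_pos_of_le (hp : 2.94 ≤ p) (hr : 0 < r) (hrs : r ≤ s) (hs : s ≤ 1)
    (h : 0 < gammaCoeff p s) : 0 < gammaCoeff p r := by
  rcases le_total r (2 / 3) with hr' | hr'
  · exact gammaCoeff_pos_of_le_two_thirds hp hr hr'
  · exact pos_of_mul_pos_right
      ((mul_pos (pow_pos hr 3) h).trans_le (cube_mul_gammaCoeff_le hp hr' hrs hs))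
      (pow_nonneg (hr.le.trans hrs) 3)

-- With `d = 4 - p` and `e = 1 - s`, this says that a certain quadratic polynomial in `d` has no
-- real root; the bound is the expansion of its discriminant in powers of `e` and `1 / 3 - e`.
theorem discriminant_bound {e : ℝ} (he : 0 ≤ e) (he1 : e ≤ 1 / 3) :
    e * (2.32 - 5.4 * e + 2.84 * e ^ 2) ^ 2 ≤ 1.28 * (1 - e - 2 * e ^ 2 + 2.6 * e ^ 3) *
      (0.12 + 3.96 * e - 12.2 * e ^ 2 + 10 * e ^ 3) := by
  have : 0 ≤ 1 / 3 - e := sub_nonneg.2 he1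
  have hterm (m n : ℕ) : 0 ≤ e ^ m * (1 / 3 - e) ^ n := by positivity
  linarith [hterm 0 6, hterm 1 5, hterm 2 4, hterm 3 3, hterm 4 2, hterm 5 1, hterm 6 0]

theorem quadratic_nonneg {d e : ℝ} (he : 0 ≤ e) (he1 : e ≤ 1 / 3) :
    0 ≤ 0.32 * (1 - e - 2 * e ^ 2 + 2.6 * e ^ 3) * d ^ 2 -
      e * (2.32 - 5.4 * e + 2.84 * e ^ 2) * d +
      e * (0.12 + 3.96 * e - 12.2 * e ^ 2 + 10 * e ^ 3) := by
  have hlead : 0 < 1 - e - 2 * e ^ 2 + 2.6 * e ^ 3 := by nlinarith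
  have hdisc := mul_nonneg he (sub_nonneg.2 (discriminant_bound he he1))
  set u := 1 - e - 2 * e ^ 2 + 2.6 * e ^ 3
  set v := 2.32 - 5.4 * e + 2.84 * e ^ 2
  set w := 0.12 + 3.96 * e - 12.2 * e ^ 2 + 10 * e ^ 3
  refine nonneg_of_mul_nonneg_right (?_ : 0 ≤ 1.28 * u * _) (mul_pos (by norm_num) hlead)
  calc 0 ≤ (0.64 * u * d - e * v) ^ 2 + e * (1.28 * u * w - e * v ^ 2) :=
        add_nonneg (sq_nonneg _) hdisc
    _ = 1.28 * u * (0.32 * u * d ^ 2 - e * v * d + e * w) := by ring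

theorem powerCoeff_add_gammaCoeff_nonneg {d e : ℝ} (hd : 0 ≤ d) (he : 0 ≤ e) (he1 : e ≤ 1 / 3) :
    0 ≤ (1 - e) ^ 2 * powerCoeff (4 - d) (1 - e) + 8 / 25 * gammaCoeff (4 - d) (1 - e) := by
  have hz : 0 ≤ 1 / 3 - e := sub_nonneg.2 he1
  have hlead : 0.32 * (1 - e - 2 * e ^ 2 + 2.6 * e ^ 3) * d ^ 2 ≤
      0.32 * (1 - e - 2 * e ^ 2 + 3 * e ^ 3 - e ^ 4) * d ^ 2 := by
    gcongr ?_ * d ^ 2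
    nlinarith [mul_nonneg (pow_nonneg he 3) hz]
  have hlinear : -(e * (2.32 - 5.4 * e + 2.84 * e ^ 2)) * d ≤
      (0.04 - 2.32 * e + 5.4 * e ^ 2 - 2.04 * e ^ 3 - 2.4 * e ^ 4 + 1.32 * e ^ 5) * d := by
    gcongr ?_ * d
    nlinarith [mul_nonneg (pow_nonneg he 3) hz, pow_nonneg he 5]
  have hconst : e * (0.12 + 3.96 * e - 12.2 * e ^ 2 + 10 * e ^ 3) ≤
      e * (0.12 + 3.96 * e - 12.2 * e ^ 2 + 10.72 * e ^ 3 - 1.28 * e ^ 4 - e ^ 5) := by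
    gcongr e * ?_
    nlinarith [mul_nonneg (pow_nonneg he 3) hz, mul_nonneg (pow_nonneg he 4) hz]
  have hexpand : (1 - e) ^ 2 * powerCoeff (4 - d) (1 - e) + 8 / 25 * gammaCoeff (4 - d) (1 - e) =
      0.32 * (1 - e - 2 * e ^ 2 + 3 * e ^ 3 - e ^ 4) * d ^ 2 +
      (0.04 - 2.32 * e + 5.4 * e ^ 2 - 2.04 * e ^ 3 - 2.4 * e ^ 4 + 1.32 * e ^ 5) * d +
      e * (0.12 + 3.96 * e - 12.2 * e ^ 2 + 10.72 * e ^ 3 - 1.28 * e ^ 4 - e ^ 5) := by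
    unfold powerCoeff gammaCoeff
    ring
  linarith [quadratic_nonneg (d := d) he he1]

theorem powerCoeff_nonneg_of_gammaCoeff_nonpos (hp : 2.94 ≤ p) (hs0 : 0 < s) (hs : s ≤ 1)
    (h : gammaCoeff p s ≤ 0) : 0 ≤ powerCoeff p s := by
  have hs2 : 2 / 3 ≤ s :=
    not_lt.1 fun hlt => (gammaCoeff_pos_of_le_two_thirds hp hs0 hlt.le).not_ge h
  have hp4 : p ≤ 4 := by
    by_contra! hlt
    have hone : 0 < gammaCoeff p 1 := by
      rw [show gammaCoeff p 1 = (p - 1) * (p - 4) by unfold gammaCoeff; ring]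
      exact mul_pos (by linarith) (by linarith)
    exact (gammaCoeff_pos_of_le hp hs0 hs le_rfl hone).not_ge h
  have hsum := powerCoeff_add_gammaCoeff_nonneg (d := 4 - p) (e := 1 - s) (by linarith)
    (by linarith) (by linarith)
  rw [sub_sub_cancel, sub_sub_cancel] at hsum
  have hmul : 0 ≤ s ^ 2 * powerCoeff p s := by linarith
  exact nonneg_of_mul_nonneg_right hmul (by positivity)

theorem hasDerivAt_mul_powerCoeff (p s : ℝ) : HasDerivAt (fun s => s * powerCoeff p s)
    (1 - 2 * (p - 1) * s - 3 * (p - 1) * s ^ 2 + 4 * (p + 2) * s ^ 3 - 5 * s ^ 4) s := by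
  have hexpand : (fun s => s * powerCoeff p s) = fun s =>
      s - (p - 1) * s ^ 2 - (p - 1) * s ^ 3 + (p + 2) * s ^ 4 - s ^ 5 := by
    funext s
    unfold powerCoeff
    ring
  rw [hexpand]
  refine (((((hasDerivAt_id s).sub ((hasDerivAt_pow 2 s).const_mul (p - 1))).sub
    ((hasDerivAt_pow 3 s).const_mul (p - 1))).add ((hasDerivAt_pow 4 s).const_mul (p + 2))).sub
    (hasDerivAt_pow 5 s)).congr_deriv ?_
  push_cast
  ring

theorem hasDerivAt_gammaCoeff (p s : ℝ) : HasDerivAt (gammaCoeff p)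
    (2 - 2 * p + 2 * (p - 1) ^ 2 * s + 3 * p ^ 2 * s ^ 2 - 4 * (p ^ 2 + 2 * p) * s ^ 3 +
      5 * p * s ^ 4) s := by
  have hexpand : gammaCoeff p = fun s => 1 + (2 - 2 * p) * s + (p - 1) ^ 2 * s ^ 2 +
      p ^ 2 * s ^ 3 - (p ^ 2 + 2 * p) * s ^ 4 + p * s ^ 5 := by
    funext s
    unfold gammaCoeff
    ring
  rw [hexpand]
  refine (((((((hasDerivAt_id s).const_mul (2 - 2 * p)).const_add 1).add
    ((hasDerivAt_pow 2 s).const_mul ((p - 1) ^ 2))).add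
    ((hasDerivAt_pow 3 s).const_mul (p ^ 2))).sub
    ((hasDerivAt_pow 4 s).const_mul (p ^ 2 + 2 * p))).add
    ((hasDerivAt_pow 5 s).const_mul p)).congr_deriv ?_
  push_cast
  ring

end coeff

/-! ### The incomplete Gamma function -/

/-- The upper incomplete Gamma function `Γ(p - 1, x)`. -/
def upperGamma (p x : ℝ) : ℝ := ∫ w in Ioi x, w ^ (p - 2) * Real.exp (-w)

section upperGamma

variable {p x : ℝ}

theorem integrableOn_rpow_mul_exp_neg (hp : 1 < p) :
    IntegrableOn (fun w : ℝ => w ^ (p - 2) * Real.exp (-w)) (Ioi 0) := by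
  refine (Real.GammaIntegral_convergent (s := p - 1) (by linarith)).congr_fun (fun w _ => ?_)
    measurableSet_Ioi
  beta_reduce
  rw [mul_comm, sub_sub, one_add_one_eq_two]

theorem continuous_rpow_mul_exp_neg (hp : 2 ≤ p) :
    Continuous fun w : ℝ => w ^ (p - 2) * Real.exp (-w) :=
  (Real.continuous_rpow_const (by linarith)).mul (by fun_prop)

theorem upperGamma_zero (hp : 1 < p) : upperGamma p 0 = Real.Gamma (p - 1) := by
  rw [upperGamma, Real.Gamma_eq_integral (by linarith)]
  refine setIntegral_congr_fun measurableSet_Ioi fun w _ => ?_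
  rw [mul_comm, sub_sub, one_add_one_eq_two]

theorem upperGamma_eq_sub (hp : 1 < p) (hx : 0 ≤ x) :
    upperGamma p x = upperGamma p 0 - ∫ w in (0 : ℝ)..x, w ^ (p - 2) * Real.exp (-w) := by
  rw [← intervalIntegral.integral_Ioi_sub_Ioi (integrableOn_rpow_mul_exp_neg hp) hx]
  exact (sub_sub_cancel _ _).symm

theorem upperGamma_pos (hp : 1 < p) (hx : 0 ≤ x) : 0 < upperGamma p x := by
  have hpos (w : ℝ) (hw : w ∈ Ioi x) : 0 < w ^ (p - 2) * Real.exp (-w) :=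
    mul_pos (Real.rpow_pos_of_pos (hx.trans_lt hw) _) (Real.exp_pos _)
  have hsupp : Function.support (fun w : ℝ => w ^ (p - 2) * Real.exp (-w)) ∩ Ioi x = Ioi x :=
    inter_eq_right.2 fun w hw => (hpos w hw).ne'
  rw [upperGamma, setIntegral_pos_iff_support_of_nonneg_ae
    (ae_restrict_of_forall_mem measurableSet_Ioi fun w hw => (hpos w hw).le)
    ((integrableOn_rpow_mul_exp_neg hp).mono_set (Ioi_subset_Ioi hx)),
    hsupp, Real.volume_Ioi]
  exact ENNReal.zero_lt_top

theorem hasDerivAt_upperGamma (hp : 2 ≤ p) (hx : 0 < x) :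
    HasDerivAt (upperGamma p) (-(x ^ (p - 2) * Real.exp (-x))) x := by
  have hcont := continuous_rpow_mul_exp_neg hp
  refine ((intervalIntegral.integral_hasDerivAt_right (hcont.intervalIntegrable 0 x)
    hcont.stronglyMeasurable.stronglyMeasurableAtFilter hcont.continuousAt).const_sub
      (upperGamma p 0)).congr_of_eventuallyEq ?_
  filter_upwards [lt_mem_nhds hx] with y hy
  exact upperGamma_eq_sub (by linarith) hy.le

theorem tendsto_upperGamma_atTop (hp : 1 < p) : Tendsto (upperGamma p) atTop (𝓝 0) := by
  have hlim := (intervalIntegral_tendsto_integral_Ioi 0 (integrableOn_rpow_mul_exp_neg hp)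
    tendsto_id).const_sub (upperGamma p 0)
  rw [← upperGamma, sub_self] at hlim
  refine hlim.congr' ?_
  filter_upwards [eventually_ge_atTop 0] with x hx
  exact (upperGamma_eq_sub hp hx).symm

end upperGamma

/-! ### The sign of the second derivative of the extremal moments -/

/-- The derivative of `momentSlope p` at `x / (1 + x)`, up to a positive factor. -/
def reducedSlopeDeriv (p x : ℝ) : ℝ :=
  gammaCoeff p (1 + x)⁻¹ * upperGamma p x -
    (1 + x)⁻¹ * powerCoeff p (1 + x)⁻¹ * (x ^ (p - 1) * Real.exp (-x))

/-- The quotient of `reducedSlopeDeriv p` by the coefficient of the incomplete Gamma function,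
which has an elementary derivative. -/
def gammaExcess (p x : ℝ) : ℝ :=
  upperGamma p x - (1 + x)⁻¹ * powerCoeff p (1 + x)⁻¹ / gammaCoeff p (1 + x)⁻¹ *
    (x ^ (p - 1) * Real.exp (-x))

section excess

variable {p x y : ℝ}

theorem gammaCoeff_mul_gammaExcess (h : gammaCoeff p (1 + x)⁻¹ ≠ 0) :
    gammaCoeff p (1 + x)⁻¹ * gammaExcess p x = reducedSlopeDeriv p x := by
  rw [gammaExcess, mul_sub, ← mul_assoc (gammaCoeff p _), mul_div_cancel₀ _ h, reducedSlopeDeriv]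

theorem hasDerivAt_rpow_sub_one_mul_exp_neg (p : ℝ) (hx : 0 < x) :
    HasDerivAt (fun x : ℝ => x ^ (p - 1) * Real.exp (-x))
      ((p - 1 - x) * (x ^ (p - 2) * Real.exp (-x))) x := by
  have hpow : HasDerivAt (fun x : ℝ => x ^ (p - 1)) ((p - 1) * x ^ (p - 1 - 1)) x :=
    Real.hasDerivAt_rpow_const (.inl hx.ne')
  refine (hpow.mul (hasDerivAt_neg x).exp).congr_deriv ?_
  rw [sub_sub, one_add_one_eq_two, ← rpow_sub_two_mul_self p hx]
  ring

theorem hasDerivAt_gammaExcess (hp : 2 ≤ p) (hx : 0 < x) (h : gammaCoeff p (1 + x)⁻¹ ≠ 0) :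
    HasDerivAt (gammaExcess p)
      (-(Real.exp (-x) * x ^ (p - 2) * (1 + x)⁻¹ ^ 2 * (1 - (1 + x)⁻¹ ^ 2) *
        excessCoeff p (1 + x)⁻¹ / gammaCoeff p (1 + x)⁻¹ ^ 2)) x := by
  have hx1 : 1 + x ≠ 0 := by linarith
  have hinv : HasDerivAt (fun x : ℝ => (1 + x)⁻¹) (-(1 + x)⁻¹ ^ 2) x :=
    (((hasDerivAt_id x).const_add 1).inv hx1).congr_deriv (by rw [inv_pow, neg_div, one_div, id])
  refine ((hasDerivAt_upperGamma hp hx).sub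
    ((((hasDerivAt_mul_powerCoeff p _).comp x hinv).div
      ((hasDerivAt_gammaCoeff p _).comp x hinv) h).mul
      (hasDerivAt_rpow_sub_one_mul_exp_neg p hx))).congr_deriv ?_
  simp only [Function.comp_apply, Pi.div_apply, ← rpow_sub_two_mul_self p hx]
  obtain ⟨s, hs⟩ : ∃ s, s = (1 + x)⁻¹ := ⟨_, rfl⟩
  have hs0 : s ≠ 0 := hs ▸ inv_ne_zero hx1
  have hxs : x = 1 / s - 1 := by rw [hs, one_div, inv_inv, add_sub_cancel_left]
  rw [← hs] at h ⊢
  generalize x ^ (p - 2) = T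
  generalize Real.exp (-x) = E
  rw [hxs]
  field_simp
  unfold gammaCoeff powerCoeff excessCoeff
  ring

theorem tendsto_gammaExcess_atTop (hp : 1 < p) : Tendsto (gammaExcess p) atTop (𝓝 0) := by
  have hinv : Tendsto (fun x : ℝ => (1 + x)⁻¹) atTop (𝓝 0) :=
    tendsto_inv_atTop_zero.comp (tendsto_atTop_add_const_left _ 1 tendsto_id)
  have hquot : ContinuousAt (fun s => s * powerCoeff p s / gammaCoeff p s) 0 :=
    (hasDerivAt_mul_powerCoeff p 0).continuousAt.div (hasDerivAt_gammaCoeff p 0).continuousAt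
      (by simp [gammaCoeff])
  have hpow := tendsto_rpow_mul_exp_neg_mul_atTop_nhds_zero (p - 1) 1 one_pos
  simp only [neg_one_mul] at hpow
  have hlim := (tendsto_upperGamma_atTop hp).sub ((hquot.tendsto.comp hinv).mul hpow)
  rwa [mul_zero, sub_zero] at hlim

theorem nonneg_of_hasDerivAt_of_tendsto {f f' : ℝ → ℝ} {a c : ℝ}
    (hf : ∀ z, a ≤ z → HasDerivAt f (f' z) z)
    (hf' : ∀ z, a ≤ z → ∀ w, z ≤ w → f' z ≤ 0 → f' w ≤ 0) (ha : 0 ≤ f a)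
    (hlim : Tendsto f atTop (𝓝 0)) (hac : a ≤ c) : 0 ≤ f c := by
  have hcont {z : ℝ} (hz : a ≤ z) (s : Set ℝ) : ContinuousWithinAt f s z :=
    (hf z hz).continuousAt.continuousWithinAt
  rcases le_or_gt (f' c) 0 with hc | hc
  · have hanti : AntitoneOn f (Ici c) :=
      antitoneOn_of_hasDerivWithinAt_nonpos (convex_Ici c) (fun z hz => hcont (hac.trans hz) _)
        (fun z hz => (hf z (hac.trans (interior_subset hz))).hasDerivWithinAt)
        fun z hz => hf' c hac z (interior_subset hz) hc
    exact le_of_tendsto hlim ((eventually_ge_atTop c).mono fun z hz => hanti self_mem_Ici hz hz)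
  · have hmono : MonotoneOn f (Icc a c) :=
      monotoneOn_of_hasDerivWithinAt_nonneg (convex_Icc a c) (fun z hz => hcont hz.1 _)
        (fun z hz => (hf z (interior_subset hz).1).hasDerivWithinAt) fun z hz => by
          obtain ⟨haz, hzc⟩ := interior_subset hz
          exact (not_le.1 fun hz0 => hc.not_ge (hf' z haz c hzc hz0)).le
    exact ha.trans (hmono (left_mem_Icc.2 hac) (right_mem_Icc.2 hac) hac)

theorem gammaCoeff_pos_of_reducedSlopeDeriv_pos (hp : 2.94 ≤ p) (hx : 0 < x)
    (h : 0 < reducedSlopeDeriv p x) : 0 < gammaCoeff p (1 + x)⁻¹ := by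
  by_contra! hneg
  have hs : 0 < (1 + x)⁻¹ := by positivity
  have hpower := powerCoeff_nonneg_of_gammaCoeff_nonpos hp hs
    (inv_le_one_of_one_le₀ (by linarith)) hneg
  refine h.not_ge (sub_nonpos.2 ?_)
  calc gammaCoeff p (1 + x)⁻¹ * upperGamma p x ≤ 0 :=
        mul_nonpos_of_nonpos_of_nonneg hneg (upperGamma_pos (by linarith) hx.le).le
    _ ≤ _ := by positivity

theorem reducedSlopeDeriv_nonneg_of_pos (hp : 2.94 ≤ p) (hx : 0 < x) (hxy : x < y)
    (h : 0 < reducedSlopeDeriv p x) : 0 ≤ reducedSlopeDeriv p y := by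
  have hinv {u v : ℝ} (hu : 0 < u) (huv : u ≤ v) : (1 + v)⁻¹ ≤ (1 + u)⁻¹ := by gcongr
  have hinv_pos {u : ℝ} (hu : 0 < u) : 0 < (1 + u)⁻¹ := by positivity
  have hinv_lt {u : ℝ} (hu : 0 < u) : (1 + u)⁻¹ < 1 := inv_lt_one_of_one_lt₀ (by linarith)
  have hx_coeff := gammaCoeff_pos_of_reducedSlopeDeriv_pos hp hx h
  have hcoeff (z : ℝ) (hz : x ≤ z) : 0 < gammaCoeff p (1 + z)⁻¹ :=
    gammaCoeff_pos_of_le hp (hinv_pos (hx.trans_le hz)) (hinv hx hz) (hinv_lt hx).le hx_coeff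
  have hderiv_nonpos (z : ℝ) (hz : x ≤ z) : -(Real.exp (-z) * z ^ (p - 2) * (1 + z)⁻¹ ^ 2 *
      (1 - (1 + z)⁻¹ ^ 2) * excessCoeff p (1 + z)⁻¹ / gammaCoeff p (1 + z)⁻¹ ^ 2) ≤ 0 ↔
      0 ≤ excessCoeff p (1 + z)⁻¹ := by
    have hz0 := hx.trans_le hz
    have hsq : 0 < 1 - (1 + z)⁻¹ ^ 2 :=
      sub_pos.2 (pow_lt_one₀ (hinv_pos hz0).le (hinv_lt hz0) two_ne_zero)
    rw [neg_nonpos, le_div_iff₀ (pow_pos (hcoeff z hz) 2), zero_mul,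
      mul_nonneg_iff_of_pos_left (by positivity)]
  rw [← gammaCoeff_mul_gammaExcess hx_coeff.ne', mul_pos_iff_of_pos_left hx_coeff] at h
  rw [← gammaCoeff_mul_gammaExcess (hcoeff y hxy.le).ne']
  refine mul_nonneg (hcoeff y hxy.le).le (nonneg_of_hasDerivAt_of_tendsto
    (fun z hz => hasDerivAt_gammaExcess (by linarith) (hx.trans_le hz) (hcoeff z hz).ne')
    (fun z hz w hzw hz0 => ?_) h.le (tendsto_gammaExcess_atTop (by linarith)) hxy.le)
  have hz' := hx.trans_le hz
  rw [hderiv_nonpos z hz] at hz0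
  rw [hderiv_nonpos w (hz.trans hzw)]
  exact excessCoeff_nonneg_of_le hp (hinv_pos (hz'.trans_le hzw)) (hinv hz' hzw)
    (hinv_lt hz').le hz0

end excess

/-! ### The moments of the extremal laws as a function of the parameter -/

theorem integrableOn_Ioi_comp_add_mul_iff (f : ℝ → ℝ) (a : ℝ) {c : ℝ} (hc : 0 < c) :
    IntegrableOn (fun x => f (a + c * x)) (Ioi 0) ↔ IntegrableOn f (Ioi a) := by
  have hshift := (measurePreserving_add_left volume a).integrableOn_comp_preimage
    (measurableEmbedding_addLeft a) (f := f) (s := Ioi a)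
  rw [preimage_const_add_Ioi, sub_self] at hshift
  rw [integrableOn_Ioi_comp_mul_left_iff (fun x => f (a + x)) 0 hc, mul_zero]
  exact hshift

theorem integral_Ioi_comp_add_mul (f : ℝ → ℝ) (a : ℝ) {c : ℝ} (hc : 0 < c) :
    ∫ x in Ioi 0, f (a + c * x) = c⁻¹ * ∫ x in Ioi a, f x := by
  have hshift := (measurePreserving_add_left volume a).setIntegral_preimage_emb
    (measurableEmbedding_addLeft a) f (Ioi a)
  rw [preimage_const_add_Ioi, sub_self] at hshift
  rw [integral_comp_mul_left_Ioi (fun x => f (a + x)) 0 hc, mul_zero, smul_eq_mul, hshift]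

/-- The mean of `(t + (1 - t) ℰ) ^ (p - 2)` for a standard exponential variable `ℰ`. -/
def tailFactor (p t : ℝ) : ℝ := ∫ w in Ioi 0, (t + (1 - t) * w) ^ (p - 2) * Real.exp (-w)

/-- The unnormalised `p`-th absolute moment of the extremal law with parameter `t`. -/
def extremalNumerator (p t : ℝ) : ℝ :=
  Real.Gamma (p + 1) + p * (p - 1) * ((∫ y in (0 : ℝ)..t, y ^ (p - 2) * Real.exp y) +
    (1 - t) ^ 3 * Real.exp t * tailFactor p t) - Real.exp t * (2 - t) * (p - 1) * t ^ p

/-- The normalised `p`-th absolute moment of the extremal law with parameter `t`. -/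
def extremalMoment (p t : ℝ) : ℝ :=
  extremalNumerator p t * (Real.exp t * (2 - t)) ^ (p - 1) / 2 ^ p

/-- The derivative of `extremalNumerator p`, up to a positive factor. -/
def numeratorSlope (p t : ℝ) : ℝ :=
  p * tailFactor p t * (1 - (p + 1) * (1 - t) + (1 - t) ^ 2) - t ^ (p - 1) * (p + t)

/-- The derivative of `extremalMoment p`, up to a positive factor. -/
def momentSlope (p t : ℝ) : ℝ :=
  Real.exp t * (2 - t) * numeratorSlope p t + extremalNumerator p t

section tailFactor

variable {p t : ℝ}

theorem integrableOn_one_add_rpow_mul_exp_neg (hp : 2 ≤ p) :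
    IntegrableOn (fun w : ℝ => (1 + w) ^ (p - 2) * Real.exp (-w)) (Ioi 0) := by
  have hshift := (integrableOn_Ioi_comp_add_mul_iff
    (fun w : ℝ => w ^ (p - 2) * Real.exp (-w)) 1 one_pos).2
    ((integrableOn_rpow_mul_exp_neg (by linarith)).mono_set (Ioi_subset_Ioi zero_le_one))
  refine IntegrableOn.congr_fun (hshift.const_mul (Real.exp 1)) (fun w _ => ?_) measurableSet_Ioi
  rw [one_mul, mul_left_comm, ← Real.exp_add]
  ring_nf

theorem continuous_rpow_add_mul (hp : 2 ≤ p) (w : ℝ) :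
    Continuous fun t : ℝ => (t + (1 - t) * w) ^ (p - 2) :=
  (Real.continuous_rpow_const (by linarith)).comp (by fun_prop)

theorem norm_tailFactor_integrand_le (hp : 2 ≤ p) (ht : t ∈ Icc (0 : ℝ) 1) {w : ℝ} (hw : 0 < w) :
    ‖(t + (1 - t) * w) ^ (p - 2) * Real.exp (-w)‖ ≤ (1 + w) ^ (p - 2) * Real.exp (-w) := by
  obtain ⟨h0, h1⟩ := ht
  have : 0 ≤ t + (1 - t) * w := add_nonneg h0 (mul_nonneg (by linarith) hw.le)
  rw [Real.norm_of_nonneg (by positivity)]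
  gcongr
  nlinarith

theorem measurable_tailFactor_integrand (p t : ℝ) :
    Measurable fun w : ℝ => (t + (1 - t) * w) ^ (p - 2) * Real.exp (-w) := by
  fun_prop

theorem integrableOn_tailFactor_integrand (hp : 2 ≤ p) (ht : t ∈ Icc (0 : ℝ) 1) :
    IntegrableOn (fun w : ℝ => (t + (1 - t) * w) ^ (p - 2) * Real.exp (-w)) (Ioi 0) :=
  (integrableOn_one_add_rpow_mul_exp_neg hp).mono'
    (measurable_tailFactor_integrand p t).aestronglyMeasurable
    (ae_restrict_of_forall_mem measurableSet_Ioi fun _ hw => norm_tailFactor_integrand_le hp ht hw)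

theorem continuousOn_tailFactor (hp : 2 ≤ p) : ContinuousOn (tailFactor p) (Icc 0 1) :=
  continuousOn_of_dominated
    (fun t _ => (measurable_tailFactor_integrand p t).aestronglyMeasurable)
    (fun _ ht => ae_restrict_of_forall_mem measurableSet_Ioi fun _ hw =>
      norm_tailFactor_integrand_le hp ht hw)
    (integrableOn_one_add_rpow_mul_exp_neg hp)
    (.of_forall fun w => ((continuous_rpow_add_mul hp w).mul_const _).continuousOn)

theorem tailFactor_zero (hp : 1 < p) : tailFactor p 0 = Real.Gamma (p - 1) := by
  rw [← upperGamma_zero hp, tailFactor, upperGamma]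
  simp only [zero_add, sub_zero, one_mul]

theorem tailFactor_eq_upperGamma (h0 : 0 ≤ t) (h1 : t < 1) :
    tailFactor p t =
      Real.exp (t / (1 - t)) * (1 - t) ^ (p - 2) * upperGamma p (t / (1 - t)) := by
  have hs : 0 < 1 - t := sub_pos.2 h1
  have : 0 ≤ t / (1 - t) := div_nonneg h0 hs.le
  have hshift := integral_Ioi_comp_add_mul
    (fun w : ℝ => w ^ (p - 2) * Real.exp (-w)) (t / (1 - t)) one_pos
  rw [inv_one, one_mul, ← upperGamma] at hshift
  rw [← hshift, ← integral_const_mul]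
  refine setIntegral_congr_fun measurableSet_Ioi fun w hw => ?_
  have hw0 : 0 ≤ w := le_of_lt hw
  have hbase : t + (1 - t) * w = (1 - t) * (t / (1 - t) + 1 * w) := by
    field_simp
  have hexp : Real.exp (t / (1 - t)) * Real.exp (-(t / (1 - t) + 1 * w)) = Real.exp (-w) := by
    rw [← Real.exp_add]
    ring_nf
  rw [hbase, Real.mul_rpow hs.le (by positivity), ← hexp]
  ring

theorem hasDerivAt_div_one_sub (h1 : t < 1) :
    HasDerivAt (fun t : ℝ => t / (1 - t)) (1 / (1 - t) ^ 2) t := by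
  refine ((hasDerivAt_id t).div ((hasDerivAt_id t).const_sub 1)
    (sub_ne_zero.2 h1.ne')).congr_deriv ?_
  simp

theorem hasDerivAt_tailFactor (hp : 2 ≤ p) (h0 : 0 < t) (h1 : t < 1) :
    HasDerivAt (tailFactor p)
      ((tailFactor p t - t ^ (p - 2)) / (1 - t) ^ 2 - (p - 2) * tailFactor p t / (1 - t)) t := by
  have hs : 0 < 1 - t := sub_pos.2 h1
  have hquot := hasDerivAt_div_one_sub h1
  have hpow : HasDerivAt (fun t : ℝ => (1 - t) ^ (p - 2))
      (-1 * (p - 2) * (1 - t) ^ (p - 2 - 1)) t :=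
    ((hasDerivAt_id t).const_sub 1).rpow_const (.inl hs.ne')
  have hformula : tailFactor p =ᶠ[𝓝 t] fun t =>
      Real.exp (t / (1 - t)) * (1 - t) ^ (p - 2) * upperGamma p (t / (1 - t)) := by
    filter_upwards [lt_mem_nhds h0, gt_mem_nhds h1] with u hu0 hu1
    exact tailFactor_eq_upperGamma hu0.le hu1
  refine (((hquot.exp.mul hpow).mul ((hasDerivAt_upperGamma hp (div_pos h0 hs)).comp t
    hquot)).congr_of_eventuallyEq hformula).congr_deriv ?_
  simp only [Pi.mul_apply, Function.comp_apply, Real.rpow_sub_one hs.ne',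
    Real.div_rpow h0.le hs.le, Real.exp_neg, tailFactor_eq_upperGamma h0.le h1]
  have hpow_ne : (1 - t) ^ (p - 2) ≠ 0 := (Real.rpow_pos_of_pos hs _).ne'
  field_simp
  ring

end tailFactor

section monotonicity

variable {p t : ℝ}

theorem hasDerivAt_extremalNumerator (hp : 2 ≤ p) (h0 : 0 < t) (h1 : t < 1) :
    HasDerivAt (extremalNumerator p) ((p - 1) * (1 - t) * Real.exp t * numeratorSlope p t) t := by
  have : 1 - t ≠ 0 := by linarith
  have hcont : Continuous fun y : ℝ => y ^ (p - 2) * Real.exp y :=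
    (Real.continuous_rpow_const (by linarith)).mul Real.continuous_exp
  have hintegral := intervalIntegral.integral_hasDerivAt_right (hcont.intervalIntegrable 0 t)
    hcont.stronglyMeasurable.stronglyMeasurableAtFilter hcont.continuousAt
  have htail := ((((hasDerivAt_id t).const_sub 1).pow 3).mul (Real.hasDerivAt_exp t)).mul
    (hasDerivAt_tailFactor hp h0 h1)
  have hpow := (((Real.hasDerivAt_exp t).mul ((hasDerivAt_id t).const_sub 2)).mul_const
    (p - 1)).mul (Real.hasDerivAt_rpow_const (p := p) (.inl h0.ne'))
  refine ((((hintegral.add htail).const_mul (p * (p - 1))).const_add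
    (Real.Gamma (p + 1))).sub hpow).congr_deriv ?_
  have hpow_eq : t ^ p = t ^ (p - 2) * t * t := by
    rw [rpow_sub_two_mul_self p h0, ← Real.rpow_add_one h0.ne', sub_add_cancel]
  simp only [Pi.mul_apply, Pi.pow_apply, id, numeratorSlope, ← rpow_sub_two_mul_self p h0, hpow_eq]
  field_simp
  push_cast
  ring

theorem hasDerivAt_extremalMoment (hp : 2 ≤ p) (h0 : 0 < t) (h1 : t < 1) :
    HasDerivAt (extremalMoment p) ((Real.exp t * (2 - t)) ^ (p - 2) / 2 ^ p *
      ((p - 1) * (1 - t) * Real.exp t) * momentSlope p t) t := by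
  have h2 : 0 < 2 - t := by linarith
  have hnorm : 0 < Real.exp t * (2 - t) := by positivity
  have hpow := ((Real.hasDerivAt_exp t).mul ((hasDerivAt_id t).const_sub 2)).rpow_const
    (p := p - 1) (.inl hnorm.ne')
  refine (((hasDerivAt_extremalNumerator hp h0 h1).mul hpow).div_const (2 ^ p)).congr_deriv ?_
  simp only [Pi.mul_apply, id, momentSlope, sub_sub p 1 1, one_add_one_eq_two,
    ← rpow_sub_two_mul_self p hnorm]
  field_simp
  ring

theorem hasDerivAt_momentSlope (hp : 2 ≤ p) (h0 : 0 < t) (h1 : t < 1) :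
    HasDerivAt (momentSlope p) (Real.exp t * p / (1 - t) ^ 2 *
      (gammaCoeff p (1 - t) * tailFactor p t - powerCoeff p (1 - t) * t ^ (p - 1))) t := by
  have hs : 1 - t ≠ 0 := by linarith
  have hsub := (hasDerivAt_id t).const_sub 1
  have hpow : HasDerivAt (fun t : ℝ => t ^ (p - 1)) ((p - 1) * t ^ (p - 2)) t := by
    have hderiv := Real.hasDerivAt_rpow_const (x := t) (p := p - 1) (.inl h0.ne')
    rwa [sub_sub, one_add_one_eq_two] at hderiv
  have hslope := (((hasDerivAt_tailFactor hp h0 h1).const_mul p).mul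
    (((hsub.const_mul (p + 1)).const_sub 1).add (hsub.pow 2))).sub
    (hpow.mul ((hasDerivAt_id t).const_add p))
  refine ((((Real.hasDerivAt_exp t).mul ((hasDerivAt_id t).const_sub 2)).mul hslope).add
    (hasDerivAt_extremalNumerator hp h0 h1)).congr_deriv ?_
  simp only [Pi.mul_apply, Pi.pow_apply, Pi.sub_apply, Pi.add_apply, numeratorSlope,
    ← rpow_sub_two_mul_self p h0, id, powerCoeff, gammaCoeff]
  field_simp
  push_cast
  ring

theorem gammaCoeff_mul_tailFactor_sub (h0 : 0 < t) (h1 : t < 1) :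
    gammaCoeff p (1 - t) * tailFactor p t - powerCoeff p (1 - t) * t ^ (p - 1) =
      Real.exp (t / (1 - t)) * (1 - t) ^ (p - 2) * reducedSlopeDeriv p (t / (1 - t)) := by
  have hs : 0 < 1 - t := sub_pos.2 h1
  have hinv : (1 + t / (1 - t))⁻¹ = 1 - t := by
    rw [one_add_div hs.ne', sub_add_cancel, inv_div, div_one]
  have hpow_ne : (1 - t) ^ (p - 2) ≠ 0 := (Real.rpow_pos_of_pos hs _).ne'
  rw [reducedSlopeDeriv, hinv, Real.div_rpow h0.le hs.le, ← rpow_sub_two_mul_self p hs,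
    Real.exp_neg, tailFactor_eq_upperGamma h0.le h1]
  field_simp

theorem Gamma_add_one_eq_mul_Gamma_sub_one (hp0 : p ≠ 0) (hp1 : p ≠ 1) :
    Real.Gamma (p + 1) = p * (p - 1) * Real.Gamma (p - 1) := by
  have hsub := Real.Gamma_add_one (sub_ne_zero.2 hp1)
  rw [sub_add_cancel] at hsub
  rw [Real.Gamma_add_one hp0, hsub, mul_assoc]

theorem momentSlope_zero (hp : 1 < p) : momentSlope p 0 = 0 := by
  simp only [momentSlope, numeratorSlope, extremalNumerator, tailFactor_zero hp,
    Gamma_add_one_eq_mul_Gamma_sub_one (by linarith) hp.ne', Real.zero_rpow (sub_pos.2 hp).ne',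
    Real.zero_rpow (show p ≠ 0 by linarith), intervalIntegral.integral_same, Real.exp_zero]
  ring

theorem continuousOn_extremalNumerator (hp : 2 ≤ p) :
    ContinuousOn (extremalNumerator p) (Icc 0 1) := by
  have hcont : Continuous fun y : ℝ => y ^ (p - 2) * Real.exp y :=
    (Real.continuous_rpow_const (by linarith)).mul Real.continuous_exp
  have hintegral : Continuous fun t => ∫ y in (0 : ℝ)..t, y ^ (p - 2) * Real.exp y :=
    intervalIntegral.continuous_primitive (fun a b => hcont.intervalIntegrable a b) 0
  have hpow : Continuous fun t : ℝ => t ^ p := Real.continuous_rpow_const (by linarith)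
  have htail := continuousOn_tailFactor hp
  unfold extremalNumerator
  fun_prop

theorem continuousOn_momentSlope (hp : 2 ≤ p) : ContinuousOn (momentSlope p) (Icc 0 1) := by
  have hpow : Continuous fun t : ℝ => t ^ (p - 1) := Real.continuous_rpow_const (by linarith)
  have htail := continuousOn_tailFactor hp
  have hnum := continuousOn_extremalNumerator hp
  unfold momentSlope numeratorSlope
  fun_prop

theorem continuousOn_extremalMoment (hp : 2 ≤ p) : ContinuousOn (extremalMoment p) (Icc 0 1) :=
  ((continuousOn_extremalNumerator hp).mul (ContinuousOn.rpow_const (by fun_prop)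
    fun _ _ => .inr (by linarith))).div_const _

theorem le_max_of_hasDerivAt {f f' : ℝ → ℝ} {a b : ℝ} (hc : ContinuousOn f (Icc a b))
    (hf : ∀ x ∈ Ioo a b, HasDerivAt f (f' x) x)
    (hf' : ∀ x ∈ Ioo a b, ∀ y ∈ Ioo a b, x < y → 0 < f' x → 0 ≤ f' y) {x : ℝ}
    (hx : x ∈ Icc a b) : f x ≤ max (f a) (f b) := by
  by_cases hpos : ∃ u ∈ Ioo a b, u < x ∧ 0 < f' u
  · obtain ⟨u, hu, hux, hpos⟩ := hpos
    have hsub : Ioo x b ⊆ Ioo a b := Ioo_subset_Ioo_left hx.1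
    have hmono : MonotoneOn f (Icc x b) := by
      refine monotoneOn_of_hasDerivWithinAt_nonneg (f' := f') (convex_Icc x b)
        (hc.mono (Icc_subset_Icc_left hx.1)) ?_ ?_ <;> rw [interior_Icc]
      · exact fun z hz => (hf z (hsub hz)).hasDerivWithinAt
      · exact fun z hz => hf' u hu z (hsub hz) (hux.trans hz.1) hpos
    exact le_max_of_le_right (hmono (left_mem_Icc.2 hx.2) (right_mem_Icc.2 hx.2) hx.2)
  · push Not at hpos
    have hsub : Ioo a x ⊆ Ioo a b := Ioo_subset_Ioo_right hx.2
    have hanti : AntitoneOn f (Icc a x) := by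
      refine antitoneOn_of_hasDerivWithinAt_nonpos (f' := f') (convex_Icc a x)
        (hc.mono (Icc_subset_Icc_right hx.2)) ?_ ?_ <;> rw [interior_Icc]
      · exact fun z hz => (hf z (hsub hz)).hasDerivWithinAt
      · exact fun z hz => hpos z (hsub hz) hz.2
    exact le_max_of_le_left (hanti (left_mem_Icc.2 hx.1) (right_mem_Icc.2 hx.1) hx.1)

theorem nonneg_of_hasDerivAt_of_pos {f f' : ℝ → ℝ} {a b : ℝ} (hc : ContinuousOn f (Icc a b))
    (hf : ∀ x ∈ Ioo a b, HasDerivAt f (f' x) x) (ha : f a = 0)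
    (hf' : ∀ x ∈ Ioo a b, ∀ y ∈ Ioo a b, x < y → 0 < f' x → 0 ≤ f' y) {x y : ℝ}
    (hx : x ∈ Icc a b) (hy : y ∈ Icc a b) (hxy : x ≤ y) (hpos : 0 < f x) : 0 ≤ f y := by
  have hax : f a < f x := ha.trans_lt hpos
  obtain hle | hle := le_max_iff.1 (le_max_of_hasDerivAt (hc.mono (Icc_subset_Icc_right hy.2))
    (fun z hz => hf z (Ioo_subset_Ioo_right hy.2 hz))
    (fun u hu v hv => hf' u (Ioo_subset_Ioo_right hy.2 hu) v (Ioo_subset_Ioo_right hy.2 hv))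
    (x := x) ⟨hx.1, hxy⟩)
  · exact absurd hle hax.not_ge
  · exact hpos.le.trans hle

theorem momentSlope_nonneg_of_pos (hp : 2.94 ≤ p) {u v : ℝ} (hu : u ∈ Ioo (0 : ℝ) 1)
    (hv : v ∈ Ioo (0 : ℝ) 1) (huv : u < v) (h : 0 < momentSlope p u) : 0 ≤ momentSlope p v := by
  have hp2 : 2 ≤ p := by linarith
  refine nonneg_of_hasDerivAt_of_pos (continuousOn_momentSlope hp2)
    (fun t ht => hasDerivAt_momentSlope hp2 ht.1 ht.2) (momentSlope_zero (by linarith)) ?_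
    (Ioo_subset_Icc_self hu) (Ioo_subset_Icc_self hv) huv.le h
  intro x hx y hy hxy hpos
  have hfactor {t : ℝ} (ht : t ∈ Ioo (0 : ℝ) 1) : 0 < Real.exp t * p / (1 - t) ^ 2 ∧
      0 < Real.exp (t / (1 - t)) * (1 - t) ^ (p - 2) := by
    have hs : 0 < 1 - t := sub_pos.2 ht.2
    have : 0 < p := by linarith
    exact ⟨by positivity, by positivity⟩
  have hxy' : x / (1 - x) < y / (1 - y) := by
    rw [div_lt_div_iff₀ (sub_pos.2 hx.2) (sub_pos.2 hy.2)]
    linarith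
  rw [gammaCoeff_mul_tailFactor_sub hx.1 hx.2, mul_pos_iff_of_pos_left (hfactor hx).1,
    mul_pos_iff_of_pos_left (hfactor hx).2] at hpos
  rw [gammaCoeff_mul_tailFactor_sub hy.1 hy.2]
  exact mul_nonneg (hfactor hy).1.le (mul_nonneg (hfactor hy).2.le
    (reducedSlopeDeriv_nonneg_of_pos hp (div_pos hx.1 (sub_pos.2 hx.2)) hxy' hpos))

theorem extremalMoment_le_max (hp : 2.94 ≤ p) (ht : t ∈ Icc (0 : ℝ) 1) :
    extremalMoment p t ≤ max (extremalMoment p 0) (extremalMoment p 1) := by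
  have hp2 : 2 ≤ p := by linarith
  have hfactor {t : ℝ} (ht : t ∈ Ioo (0 : ℝ) 1) : 0 < (Real.exp t * (2 - t)) ^ (p - 2) / 2 ^ p *
      ((p - 1) * (1 - t) * Real.exp t) := by
    have h2 : 0 < 2 - t := by linarith [ht.2]
    have h1 : 0 < 1 - t := sub_pos.2 ht.2
    have hp1 : 0 < p - 1 := by linarith
    positivity
  refine le_max_of_hasDerivAt (continuousOn_extremalMoment hp2)
    (fun t ht => hasDerivAt_extremalMoment hp2 ht.1 ht.2) (fun u hu v hv huv hpos => ?_) ht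
  exact mul_nonneg (hfactor hv).le (momentSlope_nonneg_of_pos hp hu hv huv
    ((mul_pos_iff_of_pos_left (hfactor hu)).1 hpos))

end monotonicity

/-- The difference between twice the extremal stop-loss transform and `exp (-v)`, in the variable
`v = extremalRate t * x`. -/
def rescaledExcess (t v : ℝ) : ℝ :=
  if v ≤ t then Real.exp v - Real.exp t * (2 - t) * v
  else (1 - t) ^ 2 * Real.exp t * Real.exp (-((v - t) / (1 - t)))

section stopLossMoment

variable {p t : ℝ}

theorem extremalStopLoss_eq_rescaledExcess (ht : t ≤ 1) (x : ℝ) : extremalStopLoss t x =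
    (Real.exp (-(extremalRate t * x)) + rescaledExcess t (extremalRate t * x)) / 2 := by
  rw [extremalStopLoss, rescaledExcess]
  split_ifs
  · rw [Real.cosh_eq]
    linear_combination (x / 2) * extremalRate_mul_exp_mul ht
  · rfl

theorem integrableOn_Ioi_rescaledExcess (hp : 2 ≤ p) (h0 : 0 ≤ t) (h1 : t ≤ 1) :
    IntegrableOn (fun v => v ^ (p - 2) * rescaledExcess t v) (Ioi t) ∧
    ∫ v in Ioi t, v ^ (p - 2) * rescaledExcess t v =
      (1 - t) ^ 3 * Real.exp t * tailFactor p t := by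
  have hcongr : EqOn (fun v => v ^ (p - 2) * rescaledExcess t v) (fun v => (1 - t) ^ 2 *
      Real.exp t * (v ^ (p - 2) * Real.exp (-((v - t) / (1 - t))))) (Ioi t) := fun v hv => by
    simp only [rescaledExcess, if_neg (not_le.2 (mem_Ioi.1 hv))]
    ring
  rw [setIntegral_congr_fun measurableSet_Ioi hcongr, integrableOn_congr_fun hcongr
    measurableSet_Ioi, integral_const_mul]
  rcases h1.eq_or_lt with rfl | h1
  · norm_num
  have hs : 0 < 1 - t := sub_pos.2 h1
  set f : ℝ → ℝ := fun v => v ^ (p - 2) * Real.exp (-((v - t) / (1 - t))) with hf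
  have hcomp (w : ℝ) : f (t + (1 - t) * w) = (t + (1 - t) * w) ^ (p - 2) * Real.exp (-w) := by
    simp only [hf, add_sub_cancel_left, mul_div_cancel_left₀ w hs.ne']
  have hint := integrableOn_Ioi_comp_add_mul_iff f t hs
  have hval := integral_Ioi_comp_add_mul f t hs
  simp only [hcomp] at hint hval
  refine ⟨(hint.1 (integrableOn_tailFactor_integrand hp ⟨h0, h1.le⟩)).const_mul _, ?_⟩
  rw [tailFactor, hval]
  field_simp

theorem integrableOn_Ioc_rescaledExcess (hp : 2 ≤ p) (ht : 0 ≤ t) :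
    IntegrableOn (fun v => v ^ (p - 2) * rescaledExcess t v) (Ioc 0 t) ∧
    ∫ v in Ioc 0 t, v ^ (p - 2) * rescaledExcess t v =
      (∫ y in (0 : ℝ)..t, y ^ (p - 2) * Real.exp y) - Real.exp t * (2 - t) * (t ^ p / p) := by
  have hcongr : EqOn (fun v => v ^ (p - 2) * rescaledExcess t v) (fun v => v ^ (p - 2) *
      Real.exp v - Real.exp t * (2 - t) * v ^ (p - 1)) (Ioc 0 t) := fun v hv => by
    simp only [rescaledExcess, if_pos hv.2, ← rpow_sub_two_mul_self p hv.1]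
    ring
  have hcont : Continuous fun y : ℝ => y ^ (p - 2) * Real.exp y :=
    (Real.continuous_rpow_const (by linarith)).mul Real.continuous_exp
  have hexp : IntegrableOn (fun y : ℝ => y ^ (p - 2) * Real.exp y) (Ioc 0 t) :=
    (hcont.intervalIntegrable 0 t).1
  have hpow : IntegrableOn (fun y : ℝ => Real.exp t * (2 - t) * y ^ (p - 1)) (Ioc 0 t) :=
    (integrableOn_Ioc_rpow (by linarith) t).const_mul _
  refine ⟨(integrableOn_congr_fun hcongr measurableSet_Ioc).2 (hexp.sub hpow), ?_⟩
  rw [setIntegral_congr_fun measurableSet_Ioc hcongr, integral_sub hexp hpow, integral_const_mul,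
    integral_Ioc_rpow (by linarith) ht, sub_add_cancel, intervalIntegral.integral_of_le ht]

theorem integrableOn_exp_neg_add_rescaledExcess (hp : 2 ≤ p) (h0 : 0 ≤ t) (h1 : t ≤ 1) :
    IntegrableOn (fun v => v ^ (p - 2) * (Real.exp (-v) + rescaledExcess t v)) (Ioi 0) ∧
    p * (p - 1) * ∫ v in Ioi 0, v ^ (p - 2) * (Real.exp (-v) + rescaledExcess t v) =
      extremalNumerator p t := by
  obtain ⟨hleft, hleft_eq⟩ := integrableOn_Ioc_rescaledExcess hp h0
  obtain ⟨hright, hright_eq⟩ := integrableOn_Ioi_rescaledExcess hp h0 h1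
  have hgamma := integrableOn_rpow_mul_exp_neg (p := p) (by linarith)
  have hexcess := hleft.union hright
  rw [Ioc_union_Ioi_eq_Ioi h0] at hexcess
  simp only [mul_add]
  refine ⟨hgamma.add hexcess, ?_⟩
  rw [integral_add hgamma hexcess, ← Ioc_union_Ioi_eq_Ioi h0,
    setIntegral_union Ioc_disjoint_Ioi_same measurableSet_Ioi hleft hright, hleft_eq, hright_eq,
    Ioc_union_Ioi_eq_Ioi h0, ← upperGamma, upperGamma_zero (by linarith), extremalNumerator,
    Gamma_add_one_eq_mul_Gamma_sub_one (by linarith) (by linarith)]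
  have hp0 : p ≠ 0 := by linarith
  field_simp
  ring

theorem extremalRate_rpow_two_sub_div (p : ℝ) (ht : t ≤ 1) :
    extremalRate t ^ (2 - p) * (extremalRate t)⁻¹ =
      (Real.exp t * (2 - t)) ^ (p - 1) / 2 ^ p * 2 := by
  have hnorm : 0 < Real.exp t * (2 - t) := mul_pos (Real.exp_pos t) (by linarith)
  have hrate : extremalRate t = 2 / (Real.exp t * (2 - t)) :=
    eq_div_of_mul_eq hnorm.ne' (extremalRate_mul_exp_mul ht)
  rw [← Real.rpow_neg_one, ← Real.rpow_add (extremalRate_pos ht), hrate,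
    show 2 - p + -1 = -(p - 1) by ring, Real.rpow_neg (by positivity),
    Real.div_rpow zero_le_two hnorm.le, inv_div, Real.rpow_sub_one two_ne_zero]
  field_simp

theorem stopLossMoment_extremal (hp : 2 ≤ p) (h0 : 0 ≤ t) (h1 : t ≤ 1) :
    stopLossMoment p (extremalStopLoss t) = ENNReal.ofReal (extremalMoment p t) := by
  obtain ⟨hint, hval⟩ := integrableOn_exp_neg_add_rescaledExcess hp h0 h1
  have hrate := extremalRate_pos h1
  set β := extremalRate t with hβ
  set f : ℝ → ℝ := fun v => v ^ (p - 2) * (Real.exp (-v) + rescaledExcess t v)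
  have hscale : EqOn (fun x => x ^ (p - 2) * extremalStopLoss t x)
      (fun x => β ^ (2 - p) / 2 * f (0 + β * x)) (Ioi 0) := fun x hx => by
    have hpow : β ^ (2 - p) * β ^ (p - 2) = 1 := by
      rw [← Real.rpow_add hrate, sub_add_sub_cancel, sub_self, Real.rpow_zero]
    simp only [f, zero_add, extremalStopLoss_eq_rescaledExcess h1, ← hβ,
      Real.mul_rpow hrate.le (le_of_lt hx)]
    linear_combination -(x ^ (p - 2) * (Real.exp (-(β * x)) + rescaledExcess t (β * x)) / 2) * hpow
  have hscaled := (integrableOn_Ioi_comp_add_mul_iff f 0 hrate).2 hint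
  have hintegrable := (integrableOn_congr_fun hscale measurableSet_Ioi).2 (hscaled.const_mul _)
  have hintegral : stopLossIntegral p (extremalStopLoss t) =
      ENNReal.ofReal (β ^ (2 - p) / 2 * (β⁻¹ * ∫ v in Ioi 0, f v)) := by
    simp only [stopLossIntegral, stopLossKernel, if_pos (by linarith : 1 < p)]
    refine setLIntegral_ofReal_eq measurableSet_Ioi hintegrable (fun x hx => ?_) ?_
    · exact mul_nonneg (Real.rpow_nonneg (le_of_lt hx) _)
        ((isStopLoss_extremalStopLoss h0 h1).nonneg x hx)
    · rw [setIntegral_congr_fun measurableSet_Ioi hscale, integral_const_mul,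
        integral_Ioi_comp_add_mul f 0 hrate]
  rw [stopLossMoment, hintegral, ← ENNReal.ofReal_mul (abs_nonneg _), abs_of_nonneg (by nlinarith),
    extremalMoment, ← hval]
  congr 1
  linear_combination (p * (p - 1) * ∫ v in Ioi 0, f v) / 2 * extremalRate_rpow_two_sub_div p h1

theorem stopLossMoment_extremal_le_max (hp : 2.94 ≤ p) (ht : t ∈ Icc (0 : ℝ) 1) :
    stopLossMoment p (extremalStopLoss t) ≤
      max (stopLossMoment p fun x => Real.exp (-x)) (stopLossMoment p (extremalStopLoss 1)) := by
  have hp2 : 2 ≤ p := by linarith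
  have hzero : stopLossMoment p (extremalStopLoss 0) ≤ stopLossMoment p fun x => Real.exp (-x) :=
    stopLossMoment_mono (.inr (by linarith)) fun x hx => (extremalStopLoss_zero hx).le
  calc stopLossMoment p (extremalStopLoss t)
    _ ≤ max (stopLossMoment p (extremalStopLoss 0)) (stopLossMoment p (extremalStopLoss 1)) := by
      rw [stopLossMoment_extremal hp2 ht.1 ht.2, stopLossMoment_extremal hp2 le_rfl zero_le_one,
        stopLossMoment_extremal hp2 zero_le_one le_rfl, ← ENNReal.ofReal_max]
      exact ENNReal.ofReal_le_ofReal (extremalMoment_le_max hp ht)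
    _ ≤ _ := max_le_max_right _ hzero

end stopLossMoment

/-! ### The exponential and double-exponential laws -/

section Exponential

theorem expMeasure_one : expMeasure 1 =
    (volume.restrict (Ioi (0 : ℝ))).withDensity fun x => ENNReal.ofReal (Real.exp (-x)) := by
  rw [Measure.restrict_congr_set Ioi_ae_eq_Ici, ← withDensity_indicator measurableSet_Ici,
    expMeasure, gammaMeasure]
  congr 1
  funext x
  change exponentialPDF 1 x = _
  rw [exponentialPDF_eq, indicator_apply]
  by_cases hx : 0 ≤ x <;> simp [hx]

instance : IsProbabilityMeasure (expMeasure 1) := isProbabilityMeasure_expMeasure one_pos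

instance : NullSingletonClass (expMeasure 1) := by rw [expMeasure_one]; infer_instance

theorem integral_expMeasure_one (f : ℝ → ℝ) :
    ∫ y, f y ∂expMeasure 1 = ∫ y in Ioi 0, Real.exp (-y) * f y := by
  rw [expMeasure_one, integral_withDensity_eq_integral_toReal_smul (by fun_prop) (by simp)]
  simp [Real.exp_nonneg]

theorem integrable_expMeasure_one_iff {f : ℝ → ℝ} :
    Integrable f (expMeasure 1) ↔ IntegrableOn (fun y => Real.exp (-y) * f y) (Ioi 0) := by
  rw [expMeasure_one, integrable_withDensity_iff_integrable_smul' (by fun_prop) (by simp)]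
  simp [Real.exp_nonneg, IntegrableOn]

theorem integrableOn_and_integral_exp_neg_mul_sub (b : ℝ) :
    IntegrableOn (fun y : ℝ => Real.exp (-y) * (y - b)) (Ioi b) ∧
      ∫ y in Ioi b, Real.exp (-y) * (y - b) = Real.exp (-b) := by
  have hderiv : ∀ y ∈ Ici b, HasDerivAt (fun y : ℝ => -(Real.exp (-y) * (y - b + 1)))
      (Real.exp (-y) * (y - b)) y := fun y _ => by
    convert! ((hasDerivAt_neg y).exp.mul (((hasDerivAt_id y).sub_const b).add_const 1)).neg using 1
    simp only [id]
    ring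
  have hlim : Tendsto (fun y : ℝ => -(Real.exp (-y) * (y - b + 1))) atTop (𝓝 0) := by
    have hmul : Tendsto (fun y : ℝ => y * Real.exp (-y)) atTop (𝓝 0) := by
      simpa using Real.tendsto_pow_mul_exp_neg_atTop_nhds_zero 1
    have hsum := (hmul.add (Real.tendsto_exp_neg_atTop_nhds_zero.const_mul (1 - b))).neg
    simp only [mul_zero, add_zero, neg_zero] at hsum
    exact hsum.congr fun y => by ring
  have hint := integrableOn_Ioi_deriv_of_nonneg' hderiv
    (fun y hy => mul_nonneg (Real.exp_nonneg _) (sub_nonneg.2 (le_of_lt hy))) hlim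
  refine ⟨hint, ?_⟩
  rw [integral_Ioi_of_hasDerivAt_of_tendsto' hderiv hint hlim]
  simp

theorem integrable_id_expMeasure_one : Integrable (fun y => y) (expMeasure 1) := by
  rw [integrable_expMeasure_one_iff]
  simpa using (integrableOn_and_integral_exp_neg_mul_sub 0).1

theorem integral_id_expMeasure_one : ∫ y, y ∂expMeasure 1 = 1 := by
  rw [integral_expMeasure_one]
  simpa using (integrableOn_and_integral_exp_neg_mul_sub 0).2

theorem upperStopLoss_expMeasure_one {b : ℝ} (hb : 0 ≤ b) :
    upperStopLoss (expMeasure 1) b = Real.exp (-b) := by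
  have hvanish : ∀ y ∈ Ioi 0 \ Ioi b, Real.exp (-y) * max (y - b) 0 = 0 := fun y hy => by
    rw [max_eq_right (sub_nonpos.2 (not_lt.1 hy.2)), mul_zero]
  rw [upperStopLoss, integral_expMeasure_one, ← (integrableOn_and_integral_exp_neg_mul_sub b).2,
    setIntegral_eq_of_subset_of_forall_sdiff_eq_zero measurableSet_Ioi (Ioi_subset_Ioi hb) hvanish]
  exact setIntegral_congr_fun measurableSet_Ioi fun y hy => by
    rw [max_eq_left (sub_nonneg.2 (le_of_lt hy))]

theorem upperStopLoss_expMeasure_one_of_nonpos {b : ℝ} (hb : b ≤ 0) :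
    upperStopLoss (expMeasure 1) b = 1 - b := by
  have hmax : ∀ᵐ y ∂expMeasure 1, max (y - b) 0 = y - b := by
    rw [expMeasure_one]
    refine (withDensity_absolutelyContinuous _ _).ae_le ?_
    filter_upwards [ae_restrict_mem measurableSet_Ioi] with y hy
    exact max_eq_left (sub_nonneg.2 (hb.trans (le_of_lt hy)))
  rw [upperStopLoss, integral_congr_ae hmax, integral_sub integrable_id_expMeasure_one
    (integrable_const b), integral_id_expMeasure_one]
  simp

end Exponential

section DoubleExponential

theorem lintegral_comp_abs {f : ℝ → ℝ≥0∞} (hf : Measurable f) :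
    ∫⁻ x, f |x| = 2 * ∫⁻ x in Ioi 0, f x := by
  have hpos : ∫⁻ x in Ioi 0, f |x| = ∫⁻ x in Ioi 0, f x :=
    setLIntegral_congr_fun measurableSet_Ioi fun x hx => by rw [abs_of_pos hx]
  have hneg : ∫⁻ x in (Ioi (0 : ℝ))ᶜ, f |x| = ∫⁻ x in Ioi 0, f x := by
    rw [compl_Ioi, ← setLIntegral_congr Iio_ae_eq_Iic,
      ← (Measure.measurePreserving_neg (volume : Measure ℝ)).setLIntegral_comp_preimage
        measurableSet_Ioi hf, neg_preimage, neg_Ioi, neg_zero]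
    exact setLIntegral_congr_fun measurableSet_Iio fun x hx => by rw [abs_of_neg hx]
  rw [← lintegral_add_compl _ (measurableSet_Ioi (a := (0 : ℝ))), hpos, hneg, two_mul]

theorem map_abs_doubleExp : doubleExp.map (fun x => |x|) = expMeasure 1 := by
  ext s hs
  have habs : Measurable (fun x : ℝ => |x|) := by fun_prop
  have hcomp (x : ℝ) : ((fun x : ℝ => |x|) ⁻¹' s).indicator
      (fun x => ENNReal.ofReal (Real.exp (-|x|) / 2)) x =
      s.indicator (fun x => ENNReal.ofReal (Real.exp (-x) / 2)) |x| := by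
    by_cases hx : |x| ∈ s <;> simp [hx]
  have hmeas : Measurable (s.indicator fun x => ENNReal.ofReal (Real.exp (-x) / 2)) :=
    Measurable.indicator (by fun_prop) hs
  rw [Measure.map_apply habs hs, doubleExp, withDensity_apply _ (habs hs),
    ← lintegral_indicator (habs hs), lintegral_congr hcomp, lintegral_comp_abs hmeas,
    ← lintegral_const_mul _ hmeas, expMeasure_one, withDensity_apply _ hs, ← lintegral_indicator hs]
  refine lintegral_congr fun x => ?_
  by_cases hx : x ∈ s
  · rw [indicator_of_mem hx, indicator_of_mem hx, ← ENNReal.ofReal_ofNat,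
      ← ENNReal.ofReal_mul zero_le_two, mul_div_cancel₀ _ two_ne_zero]
  · simp [hx]

instance : IsProbabilityMeasure doubleExp where
  measure_univ := by
    rw [← preimage_univ (f := fun x : ℝ => |x|), ← Measure.map_apply (by fun_prop) .univ,
      map_abs_doubleExp, measure_univ]

instance : NullSingletonClass doubleExp := by rw [doubleExp]; infer_instance

theorem integrable_id_doubleExp : Integrable (fun y => y) doubleExp := by
  have habs := integrable_id_expMeasure_one
  rw [← map_abs_doubleExp, integrable_map_measure (by fun_prop) (by fun_prop)] at habs
  exact (integrable_norm_iff (f := fun y : ℝ => y) (by fun_prop)).1 habs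

theorem integral_abs_doubleExp : ∫ y, |y| ∂doubleExp = 1 := by
  rw [← integral_id_expMeasure_one, ← map_abs_doubleExp, integral_map (by fun_prop) (by fun_prop)]

theorem map_neg_withDensity {f : ℝ → ℝ≥0∞} (hf : Measurable f) :
    (volume.withDensity f).map Neg.neg = volume.withDensity fun x => f (-x) := by
  ext s hs
  have hcomp := (Measure.measurePreserving_neg (volume : Measure ℝ)).setLIntegral_comp_preimage hs
    (hf.comp measurable_neg)
  simp only [Function.comp_apply, neg_neg] at hcomp
  rw [Measure.map_apply measurable_neg hs, withDensity_apply _ (measurable_neg hs),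
    withDensity_apply _ hs, hcomp]

theorem map_neg_doubleExp : doubleExp.map Neg.neg = doubleExp := by
  rw [doubleExp, map_neg_withDensity (by fun_prop)]
  simp only [abs_neg]

theorem integral_id_doubleExp : ∫ y, y ∂doubleExp = 0 := by
  have hsymm : ∫ y, y ∂doubleExp = -∫ y, y ∂doubleExp := by
    conv_lhs => rw [← map_neg_doubleExp, integral_map (by fun_prop) (by fun_prop), integral_neg]
  linarith

theorem stopLoss_doubleExp {x : ℝ} (hx : 0 ≤ x) : stopLoss doubleExp x = Real.exp (-x) := by
  rw [← upperStopLoss_expMeasure_one hx, upperStopLoss, ← map_abs_doubleExp,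
    integral_map (by fun_prop) (by fun_prop), stopLoss]

theorem isConvexPotential_coe {f : ℝ → ℝ} (hf : ConvexOn ℝ univ f) :
    IsConvexPotential fun x => (f x : EReal) where
  ne_bot x := EReal.coe_ne_bot _
  convex x y a b ha hb hab := by
    exact_mod_cast hf.2 (mem_univ x) (mem_univ y) ha.le hb.le hab

theorem isLogConcave_doubleExp : IsLogConcave (fun x : ℝ => x) doubleExp := by
  refine ⟨fun x => ((|x| + Real.log 2 : ℝ) : EReal),
    isConvexPotential_coe ((convexOn_norm convex_univ).add_const _), ?_⟩
  have hdensity : doubleExp =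
      volume.withDensity fun x : ℝ => EReal.exp (-((|x| + Real.log 2 : ℝ) : EReal)) := by
    rw [doubleExp]
    congr 1
    funext x
    rw [← EReal.coe_neg, EReal.exp_coe, neg_add, Real.exp_add, Real.exp_neg (Real.log 2),
      Real.exp_log two_pos, div_eq_mul_inv]
  rw [← hdensity]
  exact HasLaw.id

end DoubleExponential

section OneSided

/-- The potential `φ` for which the centred standard exponential law has density `exp (-φ)`. -/
def centredExpPotential (x : ℝ) : EReal := if 0 < x + 1 then ((x + 1 : ℝ) : EReal) else ⊤

theorem centredExpPotential_ne_bot (x : ℝ) : centredExpPotential x ≠ ⊥ := by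
  rw [centredExpPotential]
  split_ifs
  exacts [EReal.coe_ne_bot _, top_ne_bot]

theorem isConvexPotential_centredExpPotential : IsConvexPotential centredExpPotential where
  ne_bot := centredExpPotential_ne_bot
  convex x y a b ha hb hab := by
    have hmul_ne_bot {c z : ℝ} (hc : 0 < c) : (c : EReal) * centredExpPotential z ≠ ⊥ :=
      EReal.mul_ne_bot _ _ |>.2 ⟨.inl (EReal.coe_ne_bot c), .inr (centredExpPotential_ne_bot z),
        .inl (EReal.coe_ne_top c), .inl (EReal.coe_nonneg.2 hc.le)⟩
    by_cases hx : 0 < x + 1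
    · by_cases hy : 0 < y + 1
      · have hxy : 0 < a * x + b * y + 1 := by
          linear_combination add_pos (mul_pos ha hx) (mul_pos hb hy) + hab
        rw [centredExpPotential, centredExpPotential, centredExpPotential, if_pos hx, if_pos hy,
          if_pos hxy]
        norm_cast
        linear_combination -hab
      · rw [show centredExpPotential y = ⊤ from if_neg hy,
          EReal.mul_top_of_pos (EReal.coe_pos.2 hb), EReal.add_top_of_ne_bot (hmul_ne_bot ha)]
        exact le_top
    · rw [show centredExpPotential x = ⊤ from if_neg hx,
        EReal.mul_top_of_pos (EReal.coe_pos.2 ha), EReal.top_add_of_ne_bot (hmul_ne_bot hb)]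
      exact le_top

theorem isLogConcave_sub_one_expMeasure : IsLogConcave (fun x : ℝ => x - 1) (expMeasure 1) := by
  refine ⟨centredExpPotential, isConvexPotential_centredExpPotential, by fun_prop, ?_⟩
  ext s hs
  have hsub : Measurable fun x : ℝ => x - 1 := by fun_prop
  have hdensity : Measurable fun x => EReal.exp (-centredExpPotential x) :=
    EReal.measurable_exp.comp isConvexPotential_centredExpPotential.measurable.neg
  rw [Measure.map_apply hsub hs, withDensity_apply _ hs,
    ← (measurePreserving_sub_right volume (1 : ℝ)).setLIntegral_comp_preimage hs hdensity,
    expMeasure_one, ← withDensity_indicator measurableSet_Ioi, withDensity_apply _ (hsub hs)]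
  refine lintegral_congr fun x => ?_
  rw [centredExpPotential, sub_add_cancel, indicator_apply]
  by_cases hx : 0 < x
  · rw [if_pos hx, if_pos (mem_Ioi.2 hx), ← EReal.coe_neg, EReal.exp_coe]
  · simp [hx]

theorem hasMeanZero_sub_one_expMeasure : HasMeanZero (fun x : ℝ => x - 1) (expMeasure 1) := by
  refine ⟨integrable_id_expMeasure_one.sub (integrable_const 1), ?_⟩
  rw [integral_sub integrable_id_expMeasure_one (integrable_const 1), integral_id_expMeasure_one]
  simp

/-- The law of `(e / 2) (ℰ - 1)` for a standard exponential variable `ℰ`, the centred exponential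
law normalised to have first absolute moment `1`. -/
def oneSidedLaw : Measure ℝ := (expMeasure 1).map fun y => Real.exp 1 / 2 * (y - 1)

instance : IsProbabilityMeasure oneSidedLaw := Measure.isProbabilityMeasure_map (by fun_prop)

instance : NullSingletonClass oneSidedLaw :=
  nullSingletonClass_map_of_injective (by fun_prop) fun x y h =>
    sub_left_injective (mul_left_cancel₀ (by positivity : Real.exp 1 / 2 ≠ 0) h)

theorem integrable_id_oneSidedLaw : Integrable (fun y => y) oneSidedLaw := by
  rw [oneSidedLaw, integrable_map_measure (by fun_prop) (by fun_prop)]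
  exact hasMeanZero_sub_one_expMeasure.1.const_mul _

theorem integral_id_oneSidedLaw : ∫ y, y ∂oneSidedLaw = 0 := by
  rw [oneSidedLaw, integral_map (by fun_prop) (by fun_prop), integral_const_mul,
    hasMeanZero_sub_one_expMeasure.2, mul_zero]

theorem upperStopLoss_oneSidedLaw (x : ℝ) : upperStopLoss oneSidedLaw (Real.exp 1 / 2 * x) =
    Real.exp 1 / 2 * upperStopLoss (expMeasure 1) (1 + x) := by
  rw [upperStopLoss, oneSidedLaw, integral_map (by fun_prop) (by fun_prop), upperStopLoss,
    ← integral_const_mul]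
  refine integral_congr_ae (.of_forall fun y => ?_)
  beta_reduce
  rw [mul_max_of_nonneg _ _ (by positivity), mul_zero, ← mul_sub, sub_sub]

theorem stopLoss_oneSidedLaw {x : ℝ} (hx : 0 ≤ x) :
    stopLoss oneSidedLaw x = extremalStopLoss 1 x := by
  obtain ⟨a, rfl⟩ : ∃ a, x = Real.exp 1 / 2 * a := ⟨x / (Real.exp 1 / 2), by field_simp⟩
  have ha : 0 ≤ a := nonneg_of_mul_nonneg_right hx (by positivity)
  have hrate : extremalRate 1 * (Real.exp 1 / 2 * a) = a := by
    linear_combination (a / 2) * extremalRate_mul_exp_mul le_rfl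
  have hexp (s : ℝ) : Real.exp 1 / 2 * Real.exp (-(1 + s)) = Real.exp (-s) / 2 := by
    rw [neg_add, Real.exp_add, Real.exp_neg 1]
    field_simp
  rw [stopLoss_eq_add integrable_id_oneSidedLaw hx,
    upperStopLoss_map_neg integrable_id_oneSidedLaw integral_id_oneSidedLaw, ← mul_neg,
    upperStopLoss_oneSidedLaw, upperStopLoss_oneSidedLaw, extremalStopLoss, hrate,
    upperStopLoss_expMeasure_one (by positivity), hexp]
  split_ifs with h
  · rw [upperStopLoss_expMeasure_one (by linarith), hexp, neg_neg, Real.cosh_eq]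
    ring
  · rw [upperStopLoss_expMeasure_one_of_nonpos (by linarith), sub_self]
    ring

theorem integral_abs_oneSidedLaw : ∫ y, |y| ∂oneSidedLaw = 1 := by
  simpa [stopLoss, extremalStopLoss] using stopLoss_oneSidedLaw le_rfl

end OneSided

section StopLossMoment

variable {p : ℝ}

theorem stopLossMoment_congr {π π' : ℝ → ℝ} (h : ∀ x, 0 < x → π x = π' x) :
    stopLossMoment p π = stopLossMoment p π' := by
  rw [stopLossMoment, stopLossMoment, stopLossIntegral, stopLossIntegral]
  congr 1
  exact setLIntegral_congr_fun measurableSet_Ioi fun x hx => by rw [h x hx]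

theorem stopLossMoment_extremal_one (hp0 : p ≠ 0) (hp1 : p ≠ 1) :
    stopLossMoment p (extremalStopLoss 1) =
      ∫⁻ y, ‖Real.exp 1 / 2 * (y - 1)‖ₑ ^ p ∂expMeasure 1 := by
  rw [← stopLossMoment_congr fun x hx => stopLoss_oneSidedLaw hx.le,
    ← lintegral_enorm_rpow_eq_stopLossMoment integrable_id_oneSidedLaw integral_abs_oneSidedLaw
      hp0 hp1, oneSidedLaw, lintegral_map (by fun_prop) (by fun_prop)]

theorem lintegral_enorm_rpow_doubleExp (hp : -1 < p) :
    ∫⁻ y, ‖y‖ₑ ^ p ∂doubleExp = ENNReal.ofReal (Real.Gamma (p + 1)) := by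
  have habs : ∫⁻ y, ‖y‖ₑ ^ p ∂doubleExp = ∫⁻ y, ‖y‖ₑ ^ p ∂expMeasure 1 := by
    rw [← map_abs_doubleExp, lintegral_map (by fun_prop) (by fun_prop)]
    simp
  have hint : IntegrableOn (fun x : ℝ => Real.exp (-x) * x ^ (p + 1 - 1)) (Ioi 0) :=
    Real.GammaIntegral_convergent (by linarith)
  have hnonneg : 0 ≤ᵐ[volume.restrict (Ioi 0)] fun x : ℝ => Real.exp (-x) * x ^ (p + 1 - 1) := by
    filter_upwards [ae_restrict_mem measurableSet_Ioi] with x hx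
    exact mul_nonneg (Real.exp_nonneg _) (Real.rpow_nonneg (le_of_lt hx) _)
  rw [habs, expMeasure_one, lintegral_withDensity_eq_lintegral_mul _ (by fun_prop) (by fun_prop),
    Real.Gamma_eq_integral (by linarith), ofReal_integral_eq_lintegral_ofReal hint hnonneg]
  refine setLIntegral_congr_fun measurableSet_Ioi fun x (hx : 0 < x) => ?_
  simp only [Pi.mul_apply]
  rw [Real.enorm_eq_ofReal hx.le, ENNReal.ofReal_rpow_of_pos hx,
    ← ENNReal.ofReal_mul (Real.exp_nonneg _), add_sub_cancel_right]

theorem stopLossMoment_exp (hp : -1 < p) (hp0 : p ≠ 0) (hp1 : p ≠ 1) :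
    stopLossMoment p (fun x => Real.exp (-x)) = ENNReal.ofReal (Real.Gamma (p + 1)) := by
  rw [← stopLossMoment_congr fun x hx => stopLoss_doubleExp hx.le, ← lintegral_enorm_rpow_doubleExp
    hp, lintegral_enorm_rpow_eq_stopLossMoment integrable_id_doubleExp integral_abs_doubleExp
    hp0 hp1]

end StopLossMoment

/-! ### The exponent where the two extremal moments agree -/

section GammaBounds

theorem Gamma_add_nat {x : ℝ} (hx : 0 < x) (n : ℕ) :
    Real.Gamma (x + n) = Real.Gamma x * ∏ k ∈ Finset.range n, (x + k) := by
  induction n with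
  | zero => simp
  | succ n ih =>
    rw [Nat.cast_succ, ← add_assoc, Real.Gamma_add_one (by positivity), ih, Finset.prod_range_succ]
    ring

theorem Gamma_add_three {x : ℝ} (hx : 0 < x) :
    Real.Gamma (x + 3) = x * (x + 1) * (x + 2) * Real.Gamma x := by
  have h := Gamma_add_nat hx 3
  norm_num [Finset.prod_range_succ] at h
  rw [h, mul_comm]

section

variable {n : ℕ} {x : ℝ}

-- Log-convexity of `Γ` on `[n, n + 1]`.
theorem Gamma_add_nat_le (hn : 0 < n) (h0 : 0 < x) (h1 : x < 1) :
    Real.Gamma (x + n) ≤ n.factorial * (n : ℝ) ^ (x - 1) := by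
  have hn' : (0 : ℝ) < n := by exact_mod_cast hn
  have hΓ := Real.Gamma_pos_of_pos hn'
  have hfact : (n.factorial : ℝ) = n * Real.Gamma n := by
    rw [← Real.Gamma_add_one hn'.ne', Real.Gamma_nat_eq_factorial]
  have hconv := Real.Gamma_mul_add_mul_le_rpow_Gamma_mul_rpow_Gamma (s := n) (t := n + 1)
    (a := 1 - x) (b := x) hn' (by positivity) (by linarith) h0 (by ring)
  rw [show (1 - x) * n + x * (n + 1) = x + n by ring, Real.Gamma_add_one hn'.ne',
    Real.mul_rpow hn'.le hΓ.le, mul_left_comm, ← Real.rpow_add hΓ, sub_add_cancel,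
    Real.rpow_one] at hconv
  rw [hfact, Real.rpow_sub_one hn'.ne']
  refine hconv.trans_eq ?_
  field_simp

-- Log-convexity of `Γ` on `[x + n, x + n + 1]`.
theorem le_Gamma_add_nat (h0 : 0 < x) (h1 : x < 1) :
    n.factorial * (x + n) ^ (x - 1) ≤ Real.Gamma (x + n) := by
  have hxn : 0 < x + n := by positivity
  have hΓ := Real.Gamma_pos_of_pos hxn
  have hconv := Real.Gamma_mul_add_mul_le_rpow_Gamma_mul_rpow_Gamma (s := x + n) (t := x + n + 1)
    (a := x) (b := 1 - x) hxn (by positivity) h0 (by linarith) (by ring)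
  rw [show x * (x + n) + (1 - x) * (x + n + 1) = n + 1 by ring, Real.Gamma_nat_eq_factorial,
    Real.Gamma_add_one hxn.ne', Real.mul_rpow hxn.le hΓ.le, mul_left_comm, ← Real.rpow_add hΓ,
    add_sub_cancel, Real.rpow_one] at hconv
  calc (n.factorial : ℝ) * (x + n) ^ (x - 1)
      ≤ (x + n) ^ (1 - x) * Real.Gamma (x + n) * (x + n) ^ (x - 1) := by gcongr
    _ = (x + n) ^ (1 - x + (x - 1)) * Real.Gamma (x + n) := by rw [Real.rpow_add hxn]; ring
    _ = Real.Gamma (x + n) := by simp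

theorem Gamma_le_factorial_div_prod_mul (hn : 0 < n) (h0 : 0 < x) (h1 : x < 1) :
    Real.Gamma x ≤ n.factorial / (∏ k ∈ Finset.range n, (x + k)) * (n : ℝ) ^ (x - 1) := by
  rw [div_mul_eq_mul_div, le_div_iff₀ (Finset.prod_pos fun k _ => by positivity),
    ← Gamma_add_nat h0]
  exact Gamma_add_nat_le hn h0 h1

theorem factorial_div_prod_mul_le_Gamma (h0 : 0 < x) (h1 : x < 1) :
    n.factorial / (∏ k ∈ Finset.range n, (x + k)) * (x + n) ^ (x - 1) ≤ Real.Gamma x := by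
  rw [div_mul_eq_mul_div, div_le_iff₀ (Finset.prod_pos fun k _ => by positivity),
    ← Gamma_add_nat h0]
  exact le_Gamma_add_nat h0 h1

end

/-- The product of `q * (a + k) + r` over `k < 2 ^ m`. It is the rising factorial of `r / q` cleared
of denominators when `a = 0`; binary splitting lets the kernel evaluate it. -/
def blockProd (q r : ℕ) : ℕ → ℕ → ℕ
  | 0, a => q * a + r
  | m + 1, a => blockProd q r m a * blockProd q r m (a + 2 ^ m)

theorem blockProd_eq_prod (q r m a : ℕ) :
    blockProd q r m a = ∏ k ∈ Finset.range (2 ^ m), (q * (a + k) + r) := by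
  induction m generalizing a with
  | zero => simp [blockProd]
  | succ m ih =>
    rw [blockProd, ih, ih, pow_succ, mul_two, Finset.prod_range_add]
    simp only [add_assoc]

section

variable {q r m A B : ℕ}

theorem blockProd_zero_eq_pow_mul_prod (hq : 0 < q) :
    (blockProd q r m 0 : ℝ) = q ^ 2 ^ m * ∏ k ∈ Finset.range (2 ^ m), ((r / q : ℝ) + k) := by
  have hq' : (q : ℝ) ≠ 0 := by positivity
  rw [blockProd_eq_prod, ← Finset.card_range (2 ^ m), ← Finset.prod_const, Finset.card_range,
    ← Finset.prod_mul_distrib, Nat.cast_prod]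
  refine Finset.prod_congr rfl fun k _ => ?_
  push_cast
  field_simp
  ring

theorem factorial_div_prod_eq_blockProd_div (hq : 0 < q) :
    ((2 ^ m).factorial / ∏ k ∈ Finset.range (2 ^ m), ((r / q : ℝ) + k) : ℝ) =
      blockProd q q m 0 / blockProd q r m 0 := by
  have hq' : (q : ℝ) ≠ 0 := by positivity
  rw [blockProd_zero_eq_pow_mul_prod hq, blockProd_zero_eq_pow_mul_prod hq, div_self hq',
    mul_div_mul_left _ _ (pow_ne_zero _ hq'), ← Finset.prod_range_add_one_eq_factorial,
    Nat.cast_prod]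
  push_cast
  simp only [add_comm]

theorem blockProd_pos (hq : 0 < q) (hr : 0 < r) : (0 : ℝ) < blockProd q r m 0 := by
  rw [blockProd_zero_eq_pow_mul_prod hq]
  exact mul_pos (by positivity) (Finset.prod_pos fun k _ => by positivity)

theorem Gamma_le_of_blockProd_le (hr : 0 < r) (hrq : r < q) (hB : 0 < B)
    (h : blockProd q q m 0 * B ≤ A * blockProd q r m 0) :
    Real.Gamma (r / q) ≤ A / B * (2 ^ m : ℝ) ^ ((r : ℝ) / q - 1) := by
  have hq : 0 < q := hr.trans hrq
  have hratio : (blockProd q q m 0 / blockProd q r m 0 : ℝ) ≤ A / B := by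
    rw [div_le_div_iff₀ (blockProd_pos hq hr) (by exact_mod_cast hB)]
    exact_mod_cast h
  have hΓ := Gamma_le_factorial_div_prod_mul (n := 2 ^ m) (x := r / q) (by positivity)
    (by positivity) ((div_lt_one (by positivity)).2 (by exact_mod_cast hrq))
  rw [factorial_div_prod_eq_blockProd_div hq] at hΓ
  push_cast at hΓ
  exact hΓ.trans (by gcongr)

theorem le_Gamma_of_le_blockProd (hr : 0 < r) (hrq : r < q) (hB : 0 < B)
    (h : A * blockProd q r m 0 ≤ blockProd q q m 0 * B) :
    A / B * (r / q + 2 ^ m : ℝ) ^ ((r : ℝ) / q - 1) ≤ Real.Gamma (r / q) := by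
  have hq : 0 < q := hr.trans hrq
  have hratio : (A / B : ℝ) ≤ blockProd q q m 0 / blockProd q r m 0 := by
    rw [div_le_div_iff₀ (by exact_mod_cast hB) (blockProd_pos hq hr)]
    exact_mod_cast h
  have hΓ := factorial_div_prod_mul_le_Gamma (n := 2 ^ m) (x := r / q) (by positivity)
    ((div_lt_one (by positivity)).2 (by exact_mod_cast hrq))
  rw [factorial_div_prod_eq_blockProd_div hq] at hΓ
  push_cast at hΓ
  exact le_trans (by gcongr) hΓ

end

theorem exp_neg_le_of_le {x a c : ℝ} (n : ℕ) (hx : 0 ≤ x) (hxa : x ≤ a) (hc : 0 < c)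
    (h : c⁻¹ ≤ ∑ k ∈ Finset.range n, x ^ k / k.factorial) : Real.exp (-a) ≤ c := by
  rw [Real.exp_neg, inv_le_comm₀ (Real.exp_pos _) hc]
  exact h.trans ((Real.sum_le_exp_of_nonneg hx n).trans (Real.exp_le_exp.2 hxa))

theorem Gamma_add_one_le_at_upper_endpoint : Real.Gamma (2.9415 + 1) ≤ 5.577787 := by
  have hΓ : Real.Gamma (9415 / 10000) ≤
      1556101 / 1000000 * (2 ^ 10 : ℝ) ^ (9415 / 10000 - 1 : ℝ) := by
    exact_mod_cast Gamma_le_of_blockProd_le (q := 10000) (r := 9415) (m := 10) (A := 1556101)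
      (B := 1000000) (by norm_num) (by norm_num) (by norm_num) (by decide +kernel)
  have hpow : (2 ^ 10 : ℝ) ^ (9415 / 10000 - 1 : ℝ) ≤ 0.6666494 := by
    rw [Real.rpow_def_of_pos (by positivity), Real.log_pow, show ((10 : ℕ) : ℝ) * Real.log 2 *
      (9415 / 10000 - 1) = -(0.585 * Real.log 2) by norm_num; ring]
    exact exp_neg_le_of_le (x := 0.405491100) 8 (by norm_num) (by linarith [Real.log_two_gt_d9])
      (by norm_num) (by norm_num [Finset.sum_range_succ, Nat.factorial])
  rw [show (2.9415 : ℝ) + 1 = 9415 / 10000 + 3 by norm_num, Gamma_add_three (by norm_num)]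
  grw [hΓ, hpow]
  norm_num

theorem le_Gamma_add_one_at_lower_endpoint : 5.57676 ≤ Real.Gamma (2.9414 + 1) := by
  have hΓ : 1557285 / 1000000 * (9414 / 10000 + 2 ^ 10 : ℝ) ^ (9414 / 10000 - 1 : ℝ) ≤
      Real.Gamma (9414 / 10000) := by
    exact_mod_cast le_Gamma_of_le_blockProd (q := 10000) (r := 9414) (m := 10) (A := 1557285)
      (B := 1000000) (by norm_num) (by norm_num) (by norm_num) (by decide +kernel)
  have hlog : Real.log (9414 / 10000 + 2 ^ 10) ≤ 10 * Real.log 2 + 1 / 2 ^ 10 := by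
    rw [show (9414 / 10000 + 2 ^ 10 : ℝ) = 2 ^ 10 * (1 + 9414 / 10000 / 2 ^ 10) by norm_num,
      Real.log_mul (by norm_num) (by norm_num), Real.log_pow]
    have := Real.log_le_sub_one_of_pos (x := 1 + 9414 / 10000 / 2 ^ 10) (by norm_num)
    norm_num at this ⊢
    linarith
  have hexponent : Real.log (9414 / 10000 + 2 ^ 10) * (1 - 9414 / 10000) ≤ 0.406241476 := by
    grw [hlog]
    linarith [Real.log_two_lt_d9]
  have hpow : 0.666149 ≤ (9414 / 10000 + 2 ^ 10 : ℝ) ^ (9414 / 10000 - 1 : ℝ) := by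
    rw [Real.rpow_def_of_pos (by positivity), ← neg_sub, mul_neg, Real.exp_neg,
      le_inv_comm₀ (by norm_num) (Real.exp_pos _)]
    refine (Real.exp_le_exp.2 hexponent).trans ((Real.exp_bound' (by norm_num) (by norm_num)
      (n := 8) (by norm_num)).trans ?_)
    norm_num [Finset.sum_range_succ, Nat.factorial]
  rw [show (2.9414 : ℝ) + 1 = 9414 / 10000 + 3 by norm_num, Gamma_add_three (by norm_num)]
  grw [← hΓ, ← hpow]
  norm_num

end GammaBounds

/-- The truncated moment `∫₀¹ y ^ p e ^ y dy`, the contribution of the negative half-line to the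
`p`-th absolute moment of the centred exponential law. -/
def unitExpMoment (p : ℝ) : ℝ := ∫ y in (0 : ℝ)..1, y ^ p * Real.exp y

section unitExpMoment

variable {p : ℝ}

theorem continuousOn_unitExpMoment : ContinuousOn unitExpMoment (Ioi 0) := by
  intro p (hp : 0 < p)
  refine (intervalIntegral.continuousAt_of_dominated_interval (bound := fun _ => Real.exp 1) ?_ ?_
    (by simp) ?_).continuousWithinAt
  · exact .of_forall fun q => Measurable.aestronglyMeasurable (by fun_prop)
  · filter_upwards [lt_mem_nhds hp] with q hq
    refine .of_forall fun y hy => ?_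
    rw [uIoc_of_le zero_le_one] at hy
    rw [Real.norm_of_nonneg (mul_nonneg (Real.rpow_nonneg hy.1.le _) (Real.exp_nonneg _)),
      ← one_mul (Real.exp 1)]
    gcongr
    exacts [Real.rpow_le_one hy.1.le hy.2 hq.le, hy.2]
  · refine .of_forall fun y hy => ?_
    rw [uIoc_of_le zero_le_one] at hy
    exact (Real.continuousAt_const_rpow hy.1.ne').mul continuousAt_const

theorem integral_rpow_mul_sum (hp : -1 < p) (n : ℕ) (c : ℕ → ℝ) :
    ∫ y in (0 : ℝ)..1, y ^ p * ∑ k ∈ Finset.range n, c k * y ^ k =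
      ∑ k ∈ Finset.range n, c k / (p + k + 1) := by
  have hexpand : ∀ y ∈ uIoc (0 : ℝ) 1, y ^ p * ∑ k ∈ Finset.range n, c k * y ^ k =
      ∑ k ∈ Finset.range n, c k * y ^ (p + k) := fun y hy => by
    rw [uIoc_of_le zero_le_one] at hy
    rw [Finset.mul_sum]
    exact Finset.sum_congr rfl fun k _ => by rw [Real.rpow_add_natCast hy.1.ne']; ring
  have hexponent (k : ℕ) : -1 < p + k := by linarith [k.cast_nonneg (α := ℝ)]
  rw [intervalIntegral.integral_congr_ae (.of_forall hexpand), intervalIntegral.integral_finsetSum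
    fun k _ => (intervalIntegral.intervalIntegrable_rpow' (hexponent k)).const_mul _]
  refine Finset.sum_congr rfl fun k _ => ?_
  rw [intervalIntegral.integral_const_mul, integral_rpow (.inl (hexponent k)), Real.one_rpow,
    Real.zero_rpow (by linarith [hexponent k]), sub_zero, mul_one_div]

theorem intervalIntegrable_rpow_mul (hp : 0 ≤ p) {f : ℝ → ℝ} (hf : Continuous f) (a b : ℝ) :
    IntervalIntegrable (fun y : ℝ => y ^ p * f y) volume a b :=
  ((Real.continuous_rpow_const hp).mul hf).intervalIntegrable a b

theorem sum_le_unitExpMoment (hp : 0 ≤ p) (n : ℕ) :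
    ∑ k ∈ Finset.range n, (1 / k.factorial : ℝ) / (p + k + 1) ≤ unitExpMoment p := by
  rw [← integral_rpow_mul_sum (by linarith), unitExpMoment]
  refine intervalIntegral.integral_mono_on zero_le_one
    (intervalIntegrable_rpow_mul hp (by fun_prop) _ _)
    (intervalIntegrable_rpow_mul hp (by fun_prop) _ _) fun y hy => ?_
  refine mul_le_mul_of_nonneg_left ?_ (Real.rpow_nonneg hy.1 _)
  simpa only [one_div_mul_eq_div] using Real.sum_le_exp_of_nonneg hy.1 n

theorem unitExpMoment_le_sum (hp : 0 ≤ p) {n : ℕ} {c : ℕ → ℝ}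
    (hc : ∀ y ∈ Icc (0 : ℝ) 1, Real.exp y ≤ ∑ k ∈ Finset.range n, c k * y ^ k) :
    unitExpMoment p ≤ ∑ k ∈ Finset.range n, c k / (p + k + 1) := by
  rw [← integral_rpow_mul_sum (by linarith), unitExpMoment]
  exact intervalIntegral.integral_mono_on zero_le_one
    (intervalIntegrable_rpow_mul hp (by fun_prop) _ _)
    (intervalIntegrable_rpow_mul hp (by fun_prop) _ _) fun y hy =>
      mul_le_mul_of_nonneg_left (hc y hy) (Real.rpow_nonneg hy.1 _)

theorem unitExpMoment_le (hp : 0 ≤ p) {n : ℕ} (hn : 0 < n) :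
    unitExpMoment p ≤ ∑ k ∈ Finset.range n, (1 / k.factorial : ℝ) / (p + k + 1) +
      (n + 1) / (n.factorial * n) / (p + n + 1) := by
  set c : ℕ → ℝ := fun k => if k < n then 1 / k.factorial else (n + 1) / (n.factorial * n)
  have hlt : ∀ k ∈ Finset.range n, c k = 1 / k.factorial := fun k hk =>
    if_pos (Finset.mem_range.1 hk)
  have hn_eq : c n = (n + 1) / (n.factorial * n) := if_neg (lt_irrefl n)
  refine (unitExpMoment_le_sum hp (n := n + 1) (c := c) fun y hy => ?_).trans_eq ?_
  · refine (Real.exp_bound' hy.1 hy.2 hn).trans_eq ?_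
    rw [Finset.sum_range_succ, hn_eq]
    congr 1
    · exact Finset.sum_congr rfl fun k hk => by rw [hlt k hk]; ring
    · ring
  · rw [Finset.sum_range_succ, hn_eq]
    congr 1
    exact Finset.sum_congr rfl fun k hk => by rw [hlt k hk]

theorem mul_unitExpMoment_sub_one (hp : 1 ≤ p) :
    p * unitExpMoment (p - 1) = Real.exp 1 - unitExpMoment p := by
  have hcont : Continuous fun y : ℝ => p * y ^ (p - 1) :=
    (Real.continuous_rpow_const (by linarith)).const_mul p
  have hparts := intervalIntegral.integral_mul_deriv_eq_deriv_mul (a := 0) (b := 1)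
    (fun y _ => Real.hasDerivAt_rpow_const (x := y) (.inr hp)) (fun y _ => Real.hasDerivAt_exp y)
    (hcont.intervalIntegrable _ _) (Real.continuous_exp.intervalIntegrable _ _)
  rw [Real.one_rpow, Real.zero_rpow (by linarith)] at hparts
  simp only [mul_assoc] at hparts
  rw [intervalIntegral.integral_const_mul] at hparts
  rw [unitExpMoment, unitExpMoment]
  linarith

theorem extremalMoment_one (hp : 2 ≤ p) : extremalMoment p 1 =
    (Real.Gamma (p + 1) + unitExpMoment p) * Real.exp (p * (1 - Real.log 2) - 1) := by
  have hrec := mul_unitExpMoment_sub_one (p := p) (by linarith)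
  have hrec' := mul_unitExpMoment_sub_one (p := p - 1) (by linarith)
  have hnum : extremalNumerator p 1 = Real.Gamma (p + 1) + unitExpMoment p := by
    rw [extremalNumerator, show p - 2 = p - 1 - 1 by ring, ← unitExpMoment, Real.one_rpow]
    linear_combination p * hrec' - hrec
  have hexp : Real.exp (p * (1 - Real.log 2) - 1) = Real.exp 1 ^ (p - 1) / 2 ^ p := by
    rw [← Real.exp_mul, Real.rpow_def_of_pos two_pos, ← Real.exp_sub]
    ring_nf
  rw [extremalMoment, hnum, hexp]
  ring_nf

theorem extremalMoment_one_sub_Gamma (hp : 2 ≤ p) : extremalMoment p 1 - Real.Gamma (p + 1) =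
    Real.exp (p * (1 - Real.log 2) - 1) * (unitExpMoment p -
      Real.Gamma (p + 1) * (Real.exp (1 - p * (1 - Real.log 2)) - 1)) := by
  have hexp : Real.exp (p * (1 - Real.log 2) - 1) * Real.exp (1 - p * (1 - Real.log 2)) = 1 := by
    rw [← Real.exp_add, sub_add_sub_cancel', sub_self, Real.exp_zero]
  rw [extremalMoment_one hp]
  linear_combination Real.Gamma (p + 1) * hexp

end unitExpMoment

theorem Gamma_lt_extremalMoment_one : Real.Gamma (2.9415 + 1) < extremalMoment 2.9415 1 := by
  rw [← sub_pos, extremalMoment_one_sub_Gamma (by norm_num)]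
  refine mul_pos (Real.exp_pos _) (sub_pos.2 ?_)
  have hexp : Real.exp (1 - 2.9415 * (1 - Real.log 2)) ≤ 1.1022929 := by
    have hle : 1 - 2.9415 * (1 - Real.log 2) ≤ 0.097392433 := by linarith [Real.log_two_lt_d9]
    refine (Real.exp_le_exp.2 hle).trans ((Real.exp_bound' (by norm_num) (by norm_num) (n := 6)
      (by norm_num)).trans ?_)
    norm_num [Finset.sum_range_succ, Nat.factorial]
  calc Real.Gamma (2.9415 + 1) * (Real.exp (1 - 2.9415 * (1 - Real.log 2)) - 1)
      ≤ 5.577787 * 0.1022929 :=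
        (mul_le_mul_of_nonneg_left (by linarith) (Real.Gamma_nonneg_of_nonneg (by norm_num))).trans
          (mul_le_mul_of_nonneg_right Gamma_add_one_le_at_upper_endpoint (by norm_num))
    _ < ∑ k ∈ Finset.range 8, (1 / k.factorial : ℝ) / (2.9415 + k + 1) := by
        norm_num [Finset.sum_range_succ, Nat.factorial]
    _ ≤ unitExpMoment 2.9415 := sum_le_unitExpMoment (by norm_num) 8

theorem extremalMoment_one_lt_Gamma : extremalMoment 2.9414 1 < Real.Gamma (2.9414 + 1) := by
  rw [← sub_neg, extremalMoment_one_sub_Gamma (by norm_num)]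
  refine mul_neg_of_pos_of_neg (Real.exp_pos _) (sub_neg.2 ?_)
  have hexp : 1.1023266 ≤ Real.exp (1 - 2.9414 * (1 - Real.log 2)) := by
    have hle : 0.097423115 ≤ 1 - 2.9414 * (1 - Real.log 2) := by linarith [Real.log_two_gt_d9]
    refine le_trans ?_ ((Real.sum_le_exp_of_nonneg (by norm_num) 6).trans (Real.exp_le_exp.2 hle))
    norm_num [Finset.sum_range_succ, Nat.factorial]
  calc unitExpMoment 2.9414
      ≤ ∑ k ∈ Finset.range 6, (1 / k.factorial : ℝ) / (2.9414 + k + 1) +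
          ((6 : ℕ) + 1) / ((6 : ℕ).factorial * (6 : ℕ)) / (2.9414 + (6 : ℕ) + 1) :=
        unitExpMoment_le (by norm_num) (by norm_num)
    _ < 5.57676 * 0.1023266 := by norm_num [Finset.sum_range_succ, Nat.factorial]
    _ ≤ Real.Gamma (2.9414 + 1) * (Real.exp (1 - 2.9414 * (1 - Real.log 2)) - 1) :=
        mul_le_mul le_Gamma_add_one_at_lower_endpoint (by linarith) (by norm_num)
          (Real.Gamma_nonneg_of_nonneg (by norm_num))

theorem continuousOn_Gamma_Ioi : ContinuousOn Real.Gamma (Ioi 0) := fun x (hx : 0 < x) =>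
  (Real.differentiableAt_Gamma fun m =>
    (by linarith [m.cast_nonneg (α := ℝ)] : -(m : ℝ) < x).ne').continuousAt.continuousWithinAt

theorem continuousOn_extremalMoment_one : ContinuousOn (extremalMoment · 1) (Ici 2) := by
  have hΓ : ContinuousOn (fun p : ℝ => Real.Gamma (p + 1)) (Ici 2) :=
    continuousOn_Gamma_Ioi.comp (by fun_prop) fun p (hp : 2 ≤ p) => by
      simp only [mem_Ioi]; linarith
  have hmoment : ContinuousOn unitExpMoment (Ici 2) :=
    continuousOn_unitExpMoment.mono (Ici_subset_Ioi.2 two_pos)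
  exact ((hΓ.add hmoment).mul (by fun_prop)).congr fun p hp => extremalMoment_one hp

theorem exists_extremalMoment_one_eq_Gamma : ∃ p : ℝ, 2.9414 < p ∧ p < 2.9415 ∧
    extremalMoment p 1 = Real.Gamma (p + 1) := by
  have hcont : ContinuousOn (fun p => extremalMoment p 1 - Real.Gamma (p + 1))
      (Icc 2.9414 2.9415) :=
    (continuousOn_extremalMoment_one.mono (Icc_subset_Ici_self.trans (Ici_subset_Ici.2
      (by norm_num)))).sub (continuousOn_Gamma_Ioi.comp (by fun_prop) fun p hp => by
        simp only [mem_Ioi]; linarith [hp.1])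
  obtain ⟨p, hp, hzero⟩ := intermediate_value_Ioo (by norm_num) hcont
    ⟨sub_neg.2 extremalMoment_one_lt_Gamma, sub_pos.2 Gamma_lt_extremalMoment_one⟩
  exact ⟨p, hp.1, hp.2, sub_eq_zero.1 hzero⟩

/-! ### Moment comparison -/

section ENNReal

variable {x y : ℝ≥0∞} {z : ℝ}

theorem ennreal_mul_rpow (h0 : x ≠ 0) (ht : x ≠ ⊤) : (x * y) ^ z = x ^ z * y ^ z := by
  simp [ENNReal.mul_rpow_eq_ite, h0, ht]

theorem ennreal_rpow_le_rpow_of_nonpos (hz : z ≤ 0) (h : x ≤ y) : y ^ z ≤ x ^ z := by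
  rw [← neg_neg z, ENNReal.rpow_neg, ENNReal.rpow_neg x, ENNReal.inv_le_inv]
  exact ENNReal.rpow_le_rpow h (neg_nonneg.2 hz)

end ENNReal

section IsLogConcave

theorem TailLogConcave.map_const_mul {μ : Measure ℝ} (h : TailLogConcave μ) {c : ℝ} (hc : 0 < c) :
    TailLogConcave (μ.map (c * ·)) := by
  have htail (x : ℝ) : μ.map (c * ·) (Ioi x) = μ (Ioi (x / c)) := by
    rw [Measure.map_apply (by fun_prop) measurableSet_Ioi, preimage_const_mul_Ioi₀ _ hc]
  intro x y d hxy hd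
  simp only [htail, add_div]
  exact h (by gcongr) (by positivity)

variable {Ω : Type*} [MeasurableSpace Ω] {P : Measure Ω} {X : Ω → ℝ}

namespace IsLogConcave

theorem aemeasurable (hX : IsLogConcave X P) : AEMeasurable X P := by
  obtain ⟨φ, -, hlaw⟩ := hX
  exact hlaw.aemeasurable

theorem neg (hX : IsLogConcave X P) : IsLogConcave (fun ω => -X ω) P := by
  obtain ⟨φ, hφ, hlaw⟩ := hX
  have hdensity : Measurable fun x => EReal.exp (-φ x) :=
    EReal.measurable_exp.comp hφ.measurable.neg
  refine ⟨fun x => φ (-x), hφ.comp_neg, hlaw.aemeasurable.neg, ?_⟩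
  rw [← map_neg_withDensity hdensity, ← hlaw.map_eq,
    AEMeasurable.map_map_of_aemeasurable (by fun_prop) hlaw.aemeasurable]
  rfl

theorem tailLogConcave_map (hX : IsLogConcave X P) : TailLogConcave (P.map X) := by
  obtain ⟨φ, hφ, hlaw⟩ := hX
  rw [hlaw.map_eq]
  exact hφ.tailLogConcave

theorem nullSingletonClass_map (hX : IsLogConcave X P) : NullSingletonClass (P.map X) := by
  obtain ⟨φ, -, hlaw⟩ := hX
  rw [hlaw.map_eq]
  infer_instance

theorem ae_ne_zero (hX : IsLogConcave X P) : ∀ᵐ ω ∂P, X ω ≠ 0 := by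
  have := hX.nullSingletonClass_map
  exact ae_of_ae_map hX.aemeasurable (Measure.ae_ne (P.map X) 0)

theorem integral_abs_pos [NeZero P] (hX : IsLogConcave X P) (hint : Integrable X P) :
    0 < ∫ ω, |X ω| ∂P := by
  refine (integral_nonneg fun ω => abs_nonneg _).lt_of_ne' fun hzero => ?_
  rw [integral_eq_zero_iff_of_nonneg (fun ω => abs_nonneg _) hint.abs] at hzero
  obtain ⟨ω, hω, hne⟩ := (hzero.and hX.ae_ne_zero).exists
  exact hne (abs_eq_zero.1 hω)

theorem isNormalizedLogConcave_map [IsProbabilityMeasure P] (hX : IsLogConcave X P)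
    (hm : HasMeanZero X P) :
    IsNormalizedLogConcave (P.map fun ω => (∫ ω', |X ω'| ∂P)⁻¹ * X ω) := by
  have hmX := hX.aemeasurable
  have hpos := hX.integral_abs_pos hm.1
  set m := ∫ ω, |X ω| ∂P with hm_def
  have hc : 0 < m⁻¹ := inv_pos.2 hpos
  have hmY : AEMeasurable (fun ω => m⁻¹ * X ω) P := hmX.const_mul _
  have hmap {Y : Ω → ℝ} (hY : AEMeasurable Y P) :
      P.map (fun ω => m⁻¹ * Y ω) = (P.map Y).map (m⁻¹ * ·) :=
    (AEMeasurable.map_map_of_aemeasurable (by fun_prop) hY).symm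
  have hmap_neg : (P.map fun ω => m⁻¹ * X ω).map Neg.neg = P.map fun ω => m⁻¹ * -X ω := by
    rw [AEMeasurable.map_map_of_aemeasurable (by fun_prop) hmY]
    simp only [mul_neg]
    rfl
  have := hX.nullSingletonClass_map
  exact
  { isProbabilityMeasure := Measure.isProbabilityMeasure_map hmY
    nullSingletonClass := by
      rw [hmap hmX]
      exact nullSingletonClass_map_of_injective (by fun_prop) (mul_right_injective₀ hc.ne')
    tailLogConcave := by
      rw [hmap hmX]
      exact hX.tailLogConcave_map.map_const_mul hc
    tailLogConcave_neg := by
      rw [hmap_neg, hmap hX.neg.aemeasurable]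
      exact hX.neg.tailLogConcave_map.map_const_mul hc
    integrable := by
      rw [integrable_map_measure (by fun_prop) hmY]
      exact hm.1.const_mul _
    integral_eq_zero := by
      rw [integral_map hmY (by fun_prop), integral_const_mul, hm.2, mul_zero]
    integral_abs := by
      rw [integral_map hmY (by fun_prop)]
      simp only [abs_mul, abs_of_pos hc]
      rw [integral_const_mul, ← hm_def, inv_mul_cancel₀ hpos.ne'] }

end IsLogConcave

theorem momentNorm_const_mul {c : ℝ} (hc : 0 < c) {p : ℝ} (hp : p ≠ 0) :
    momentNorm (fun ω => c * X ω) p P = ENNReal.ofReal c * momentNorm X p P := by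
  have hc0 : ENNReal.ofReal c ≠ 0 := (ENNReal.ofReal_pos.2 hc).ne'
  have hcp0 : ENNReal.ofReal c ^ p ≠ 0 := (ENNReal.rpow_pos hc0.bot_lt ENNReal.ofReal_ne_top).ne'
  have hcp_top : ENNReal.ofReal c ^ p ≠ ⊤ :=
    ENNReal.rpow_ne_top_of_ne_zero hc0 ENNReal.ofReal_ne_top
  simp only [momentNorm, if_neg hp, enorm_mul, Real.enorm_eq_ofReal hc.le,
    ennreal_mul_rpow hc0 ENNReal.ofReal_ne_top]
  rw [lintegral_const_mul' _ _ hcp_top, ennreal_mul_rpow hcp0 hcp_top, ← ENNReal.rpow_mul,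
    mul_one_div_cancel hp, ENNReal.rpow_one]

theorem momentNorm_one (hX : Integrable X P) :
    momentNorm X 1 P = ENNReal.ofReal (∫ ω, |X ω| ∂P) := by
  rw [momentNorm, if_neg one_ne_zero]
  simp only [ENNReal.rpow_one, one_div, inv_one]
  exact (ofReal_integral_norm_eq_lintegral_enorm hX).symm

theorem exists_stopLossMoment_rpow_mul_eq_momentNorm [IsProbabilityMeasure P]
    (hX : IsLogConcave X P) (hm : HasMeanZero X P) :
    ∃ t ∈ Icc (0 : ℝ) 1, ∃ π : ℝ → ℝ, (∀ x, 0 < x → π x ≤ extremalStopLoss t x) ∧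
      ∀ p, p ≠ 0 → p ≠ 1 →
        momentNorm X p P = stopLossMoment p π ^ (1 / p) * momentNorm X 1 P := by
  have hpos := hX.integral_abs_pos hm.1
  have hnorm := hX.isNormalizedLogConcave_map hm
  rw [momentNorm_one hm.1]
  set m := ∫ ω, |X ω| ∂P
  have hmY : AEMeasurable (fun ω => m⁻¹ * X ω) P := hX.aemeasurable.const_mul _
  have := hnorm.isProbabilityMeasure
  have := hnorm.nullSingletonClass
  obtain ⟨t, ht, hle⟩ := hnorm.exists_stopLoss_le_extremal
  refine ⟨t, ht, _, fun x hx => hle x hx.le, fun p hp0 hp1 => ?_⟩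
  rw [← lintegral_enorm_rpow_eq_stopLossMoment hnorm.integrable hnorm.integral_abs hp0 hp1,
    lintegral_map' (by fun_prop) hmY, mul_comm]
  have hscale := momentNorm_const_mul (P := P) (X := fun ω => m⁻¹ * X ω) hpos hp0
  simp only [mul_inv_cancel_left₀ hpos.ne'] at hscale
  rw [hscale, momentNorm, if_neg hp0]

end IsLogConcave

section GeometricMean

variable {Ω : Type*} [MeasurableSpace Ω] {P : Measure Ω} {X : Ω → ℝ} {q : ℝ}

theorem lintegral_enorm_rpow_eq_lintegral_exp (h0 : ∀ᵐ ω ∂P, X ω ≠ 0) (q : ℝ) :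
    ∫⁻ ω, ‖X ω‖ₑ ^ q ∂P = ∫⁻ ω, ENNReal.ofReal (Real.exp (Real.log |X ω| * q)) ∂P := by
  refine lintegral_congr_ae ?_
  filter_upwards [h0] with ω hω
  rw [Real.enorm_eq_ofReal_abs, ENNReal.ofReal_rpow_of_pos (abs_pos.2 hω),
    Real.rpow_def_of_pos (abs_pos.2 hω)]

theorem integrable_exp_log_abs_mul (hX : AEMeasurable X P) (h0 : ∀ᵐ ω ∂P, X ω ≠ 0)
    (hfin : ∫⁻ ω, ‖X ω‖ₑ ^ q ∂P ≠ ⊤) : Integrable (fun ω => Real.exp (Real.log |X ω| * q)) P := by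
  rw [lintegral_enorm_rpow_eq_lintegral_exp h0] at hfin
  exact (lintegral_ofReal_ne_top_iff_integrable (AEMeasurable.aestronglyMeasurable (by fun_prop))
    (.of_forall fun ω => Real.exp_nonneg _)).1 hfin

theorem integrable_log_abs (hX : Integrable X P) (h0 : ∀ᵐ ω ∂P, X ω ≠ 0) (hq : q < 0)
    (hfin : ∫⁻ ω, ‖X ω‖ₑ ^ q ∂P ≠ ⊤) : Integrable (fun ω => Real.log |X ω|) P := by
  have hmeas : AEMeasurable X P := hX.aemeasurable
  refine (hX.abs.add ((integrable_exp_log_abs_mul hmeas h0 hfin).div_const (-q))).mono'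
    (AEMeasurable.aestronglyMeasurable (by fun_prop)) ?_
  filter_upwards [h0] with ω hω
  have hupper := Real.log_le_sub_one_of_pos (abs_pos.2 hω)
  have hlower : -Real.log |X ω| ≤ Real.exp (Real.log |X ω| * q) / -q := by
    rw [le_div_iff₀ (neg_pos.2 hq)]
    linarith [Real.add_one_le_exp (Real.log |X ω| * q)]
  have hexp : 0 ≤ Real.exp (Real.log |X ω| * q) / -q := by
    have := neg_pos.2 hq
    positivity
  rw [Pi.add_apply, Real.norm_eq_abs, abs_le]
  constructor <;> linarith [abs_nonneg (X ω)]

theorem momentNorm_zero (hlog : Integrable (fun ω => Real.log |X ω|) P)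
    (h0 : ∀ᵐ ω ∂P, X ω ≠ 0) :
    momentNorm X 0 P = ENNReal.ofReal (Real.exp (∫ ω, Real.log |X ω| ∂P)) := by
  have hcoe : ∀ᵐ ω ∂P, ENNReal.log ‖X ω‖ₑ = (Real.log |X ω| : EReal) := by
    filter_upwards [h0] with ω hω
    rw [Real.enorm_eq_ofReal_abs, ENNReal.log_ofReal_of_pos (abs_pos.2 hω)]
  have hpos : ∫⁻ ω, (ENNReal.log ‖X ω‖ₑ).toENNReal ∂P =
      ∫⁻ ω, ENNReal.ofReal (Real.log |X ω|) ∂P :=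
    lintegral_congr_ae (hcoe.mono fun ω hω => by
      simp only [hω, EReal.toENNReal_of_ne_top (EReal.coe_ne_top _), EReal.toReal_coe])
  have hneg : ∫⁻ ω, (-ENNReal.log ‖X ω‖ₑ).toENNReal ∂P =
      ∫⁻ ω, ENNReal.ofReal (-Real.log |X ω|) ∂P :=
    lintegral_congr_ae (hcoe.mono fun ω hω => by
      simp only [hω, ← EReal.coe_neg, EReal.toENNReal_of_ne_top (EReal.coe_ne_top _),
        EReal.toReal_coe])
  rw [momentNorm, if_pos rfl, expLogAbs, hpos, hneg, ← EReal.exp_coe,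
    integral_eq_lintegral_pos_part_sub_lintegral_neg_part hlog, EReal.coe_sub,
    EReal.coe_ennreal_toReal hlog.lintegral_lt_top.ne,
    EReal.coe_ennreal_toReal hlog.fun_neg.lintegral_lt_top.ne]

theorem momentNorm_zero_rpow_le [IsProbabilityMeasure P] (hX : AEMeasurable X P)
    (hlog : Integrable (fun ω => Real.log |X ω|) P) (h0 : ∀ᵐ ω ∂P, X ω ≠ 0) (q : ℝ) :
    momentNorm X 0 P ^ q ≤ ∫⁻ ω, ‖X ω‖ₑ ^ q ∂P := by
  by_cases hfin : ∫⁻ ω, ‖X ω‖ₑ ^ q ∂P = ⊤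
  · exact hfin ▸ le_top
  have hexp := integrable_exp_log_abs_mul hX h0 hfin
  rw [momentNorm_zero hlog h0, ENNReal.ofReal_rpow_of_pos (Real.exp_pos _), ← Real.exp_mul,
    ← integral_mul_const, lintegral_enorm_rpow_eq_lintegral_exp h0,
    ← ofReal_integral_eq_lintegral_ofReal hexp (.of_forall fun ω => Real.exp_nonneg _)]
  exact ENNReal.ofReal_le_ofReal (convexOn_exp.map_integral_le Real.continuous_exp.continuousOn
    isClosed_univ (.of_forall fun ω => mem_univ _) (hlog.mul_const q) hexp)

theorem momentNorm_le_momentNorm_zero [IsProbabilityMeasure P] (hX : Integrable X P)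
    (h0 : ∀ᵐ ω ∂P, X ω ≠ 0) (hq : q < 0) : momentNorm X q P ≤ momentNorm X 0 P := by
  have hq_inv : 1 / q < 0 := one_div_neg.2 hq
  rw [momentNorm.eq_def X q, if_neg hq.ne]
  by_cases hfin : ∫⁻ ω, ‖X ω‖ₑ ^ q ∂P = ⊤
  · rw [hfin, ENNReal.top_rpow_of_neg hq_inv]
    exact zero_le
  calc (∫⁻ ω, ‖X ω‖ₑ ^ q ∂P) ^ (1 / q) ≤ (momentNorm X 0 P ^ q) ^ (1 / q) :=
        ennreal_rpow_le_rpow_of_nonpos hq_inv.le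
          (momentNorm_zero_rpow_le hX.aemeasurable (integrable_log_abs hX h0 hq hfin) h0 q)
    _ = momentNorm X 0 P := by rw [← ENNReal.rpow_mul, mul_one_div_cancel hq.ne, ENNReal.rpow_one]

theorem momentNorm_zero_le_momentNorm [IsProbabilityMeasure P] (hX : AEMeasurable X P)
    (hlog : Integrable (fun ω => Real.log |X ω|) P) (h0 : ∀ᵐ ω ∂P, X ω ≠ 0) (hq : 0 < q) :
    momentNorm X 0 P ≤ momentNorm X q P := by
  rw [momentNorm.eq_def X q, if_neg hq.ne']
  calc momentNorm X 0 P = (momentNorm X 0 P ^ q) ^ (1 / q) := by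
        rw [← ENNReal.rpow_mul, mul_one_div_cancel hq.ne', ENNReal.rpow_one]
    _ ≤ (∫⁻ ω, ‖X ω‖ₑ ^ q ∂P) ^ (1 / q) :=
        ENNReal.rpow_le_rpow (momentNorm_zero_rpow_le hX hlog h0 q) (one_div_pos.2 hq).le

end GeometricMean

section SharpConst

variable {p : ℝ}

theorem ofReal_gammaRoot (hp : -1 < p) (hp0 : p ≠ 0) :
    ENNReal.ofReal (gammaRoot p) = ENNReal.ofReal (Real.Gamma (p + 1)) ^ (1 / p) := by
  rw [gammaRoot, if_neg hp0, ENNReal.ofReal_rpow_of_pos (Real.Gamma_pos_of_pos (by linarith))]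

theorem gammaRoot_one : gammaRoot 1 = 1 := by
  rw [gammaRoot, if_neg one_ne_zero, one_add_one_eq_two, Real.Gamma_two, Real.one_rpow]

theorem ofReal_gammaRoot_eq_stopLossMoment_rpow (hp : -1 < p) (hp0 : p ≠ 0) (hp1 : p ≠ 1) :
    ENNReal.ofReal (gammaRoot p) = (stopLossMoment p fun x => Real.exp (-x)) ^ (1 / p) := by
  rw [ofReal_gammaRoot hp hp0, stopLossMoment_exp hp hp0 hp1]

theorem oneSidedConst_eq_stopLossMoment_rpow (hp0 : p ≠ 0) (hp1 : p ≠ 1) :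
    oneSidedConst p = stopLossMoment p (extremalStopLoss 1) ^ (1 / p) := by
  rw [stopLossMoment_extremal_one hp0 hp1, oneSidedConst,
    ← momentNorm_const_mul (by positivity) hp0, momentNorm, if_neg hp0]

theorem oneSidedConst_one : oneSidedConst 1 = 1 := by
  have habs := integral_abs_oneSidedLaw
  rw [oneSidedLaw, integral_map (by fun_prop) (by fun_prop)] at habs
  rw [oneSidedConst, ← momentNorm_const_mul (by positivity) one_ne_zero,
    momentNorm_one (hasMeanZero_sub_one_expMeasure.1.const_mul _), habs, ENNReal.ofReal_one]

theorem momentNorm_sub_one_expMeasure (p : ℝ) :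
    momentNorm (fun x : ℝ => x - 1) p (expMeasure 1) =
      oneSidedConst p * momentNorm (fun x : ℝ => x - 1) 1 (expMeasure 1) := by
  have hone := oneSidedConst_one
  rw [oneSidedConst] at hone
  rw [oneSidedConst, mul_right_comm, hone, one_mul]

theorem tendsto_ofReal_gammaRoot :
    Tendsto (fun p => ENNReal.ofReal (gammaRoot p)) (𝓝[≠] 0)
      (𝓝 (ENNReal.ofReal (gammaRoot 0))) := by
  refine ENNReal.tendsto_ofReal (tendsto_gammaRoot_zero.congr' ?_)
  filter_upwards [self_mem_nhdsWithin] with p hp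
  rw [gammaRoot, if_neg (show p ≠ 0 from hp)]

theorem ofReal_gammaRoot_zero_mul_le_momentNorm {Ω : Type*} [MeasurableSpace Ω] {P : Measure Ω}
    [IsProbabilityMeasure P] {X : Ω → ℝ} (hX : Integrable X P) (h0 : ∀ᵐ ω ∂P, X ω ≠ 0)
    {c : ℝ≥0∞} (hc : c ≠ ⊤)
    (h : ∀ q ∈ Ioo (-1 : ℝ) 0, ENNReal.ofReal (gammaRoot q) * c ≤ momentNorm X q P) :
    ENNReal.ofReal (gammaRoot 0) * c ≤ momentNorm X 0 P := by
  refine le_of_tendsto (ENNReal.Tendsto.mul_const (tendsto_ofReal_gammaRoot.mono_left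
    (nhdsLT_le_nhdsNE 0)) (.inr hc)) ?_
  filter_upwards [Ioo_mem_nhdsLT (neg_one_lt_zero (R := ℝ))] with q hq
  exact (h q hq).trans (momentNorm_le_momentNorm_zero hX h0 hq.2)

theorem hasMeanZero_doubleExp : HasMeanZero (fun x : ℝ => x) doubleExp :=
  ⟨integrable_id_doubleExp, integral_id_doubleExp⟩

theorem momentNorm_one_doubleExp : momentNorm (fun x : ℝ => x) 1 doubleExp = 1 := by
  rw [momentNorm_one integrable_id_doubleExp, integral_abs_doubleExp, ENNReal.ofReal_one]

theorem momentNorm_doubleExp_of_ne_zero (hp : -1 < p) (hp0 : p ≠ 0) :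
    momentNorm (fun x : ℝ => x) p doubleExp = ENNReal.ofReal (gammaRoot p) := by
  rw [momentNorm, if_neg hp0, lintegral_enorm_rpow_doubleExp hp, ofReal_gammaRoot hp hp0]

theorem momentNorm_zero_doubleExp :
    momentNorm (fun x : ℝ => x) 0 doubleExp = ENNReal.ofReal (gammaRoot 0) := by
  have h0 := isLogConcave_doubleExp.ae_ne_zero
  have hlog : Integrable (fun x => Real.log |x|) doubleExp := by
    refine integrable_log_abs (q := -(1 / 2)) integrable_id_doubleExp h0 (by norm_num) ?_
    rw [lintegral_enorm_rpow_doubleExp (by norm_num)]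
    exact ENNReal.ofReal_ne_top
  refine le_antisymm ?_ ?_
  · refine ge_of_tendsto (tendsto_ofReal_gammaRoot.mono_left (nhdsGT_le_nhdsNE 0)) ?_
    filter_upwards [self_mem_nhdsWithin] with q (hq : 0 < q)
    rw [← momentNorm_doubleExp_of_ne_zero (by linarith) hq.ne']
    exact momentNorm_zero_le_momentNorm (by fun_prop) hlog h0 hq
  · simpa only [mul_one] using ofReal_gammaRoot_zero_mul_le_momentNorm integrable_id_doubleExp h0
      ENNReal.one_ne_top fun q hq =>
        (mul_one _).trans_le (momentNorm_doubleExp_of_ne_zero hq.1 hq.2.ne).ge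

theorem momentNorm_doubleExp (hp : -1 < p) :
    momentNorm (fun x : ℝ => x) p doubleExp =
      ENNReal.ofReal (gammaRoot p) * momentNorm (fun x : ℝ => x) 1 doubleExp := by
  rw [momentNorm_one_doubleExp, mul_one]
  rcases eq_or_ne p 0 with rfl | hp0
  exacts [momentNorm_zero_doubleExp, momentNorm_doubleExp_of_ne_zero hp hp0]

theorem stopLossMoment_exp_ne_top (hp : 1 < p) :
    stopLossMoment p (fun x => Real.exp (-x)) ≠ ⊤ := by
  rw [stopLossMoment_exp (by linarith) (by linarith) hp.ne']
  exact ENNReal.ofReal_ne_top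

theorem stopLossMoment_extremal_one_lt {q : ℝ} (hp : 1 < p) (hpq : p < q)
    (hle : stopLossMoment q (extremalStopLoss 1) ≤ stopLossMoment q fun x => Real.exp (-x)) :
    stopLossMoment p (extremalStopLoss 1) < stopLossMoment p fun x => Real.exp (-x) := by
  obtain ⟨c, hc, hcross, hlt⟩ := exists_crossesAt_exp one_pos le_rfl
  exact hcross.stopLossMoment_lt hc (isStopLoss_extremalStopLoss zero_le_one le_rfl) isStopLoss_exp
    hpq hp hlt (stopLossMoment_exp_ne_top hp) (stopLossMoment_exp_ne_top (hp.trans hpq)) hle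

end SharpConst

/-- The transition exponent `p₀`: the double-exponential and the centred one-sided exponential laws,
normalised in `L¹`, have the same `p₀`-th absolute moment. The bound `2.94` is the one above which
`stopLossMoment_extremal_le_max` applies. -/
structure IsTransition (p : ℝ) : Prop where
  le : 2.94 ≤ p
  extremalMoment_one : extremalMoment p 1 = Real.Gamma (p + 1)

namespace IsTransition

variable {p₀ p t : ℝ}

theorem one_lt (h : IsTransition p₀) : 1 < p₀ := by
  have := h.le
  linarith

theorem stopLossMoment_extremal_one_eq (h : IsTransition p₀) :
    stopLossMoment p₀ (extremalStopLoss 1) = stopLossMoment p₀ fun x => Real.exp (-x) := by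
  have hle := h.le
  rw [stopLossMoment_exp (by linarith) (by linarith) (by linarith),
    stopLossMoment_extremal (by linarith) zero_le_one le_rfl, h.extremalMoment_one]

theorem stopLossMoment_extremal_le (h : IsTransition p₀) (ht : t ∈ Icc (0 : ℝ) 1) :
    stopLossMoment p₀ (extremalStopLoss t) ≤ stopLossMoment p₀ fun x => Real.exp (-x) :=
  (stopLossMoment_extremal_le_max h.le ht).trans (max_le le_rfl h.stopLossMoment_extremal_one_eq.le)

theorem stopLossMoment_extremal_le_of_le (h : IsTransition p₀) (ht : t ∈ Icc (0 : ℝ) 1)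
    (hp : p < 0 ∨ 1 < p) (hpp : p ≤ p₀) :
    stopLossMoment p (extremalStopLoss t) ≤ stopLossMoment p fun x => Real.exp (-x) := by
  rcases hpp.eq_or_lt with rfl | hpp
  · exact h.stopLossMoment_extremal_le ht
  rcases ht.1.eq_or_lt with rfl | ht0
  · exact stopLossMoment_mono (hp.imp_left le_of_lt) fun x hx => (extremalStopLoss_zero hx).le
  obtain ⟨c, hc, hcross, -⟩ := exists_crossesAt_exp ht0 ht.2
  exact hcross.stopLossMoment_le hc (isStopLoss_extremalStopLoss ht.1 ht.2) isStopLoss_exp hpp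
    h.one_lt hp (stopLossMoment_exp_ne_top h.one_lt) (h.stopLossMoment_extremal_le ht)

theorem le_stopLossMoment_extremal (h : IsTransition p₀) (ht : t ∈ Icc (0 : ℝ) 1) (hp : 0 < p)
    (hp1 : p < 1) :
    stopLossMoment p (fun x => Real.exp (-x)) ≤ stopLossMoment p (extremalStopLoss t) := by
  rcases ht.1.eq_or_lt with rfl | ht0
  · exact stopLossMoment_anti hp hp1.le fun x hx => (extremalStopLoss_zero hx).le
  obtain ⟨c, hc, hcross, -⟩ := exists_crossesAt_exp ht0 ht.2
  exact hcross.le_stopLossMoment hc (isStopLoss_extremalStopLoss ht.1 ht.2) isStopLoss_exp h.one_lt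
    hp hp1 (stopLossMoment_exp_ne_top h.one_lt) (h.stopLossMoment_extremal_le ht)

theorem oneSidedConst_lt (h : IsTransition p₀) (hp : 1 < p) (hpp : p < p₀) :
    oneSidedConst p < ENNReal.ofReal (gammaRoot p) := by
  rw [oneSidedConst_eq_stopLossMoment_rpow (by linarith) hp.ne',
    ofReal_gammaRoot_eq_stopLossMoment_rpow (by linarith) (by linarith) hp.ne']
  exact ENNReal.rpow_lt_rpow
    (stopLossMoment_extremal_one_lt hp hpp h.stopLossMoment_extremal_one_eq.le)
    (one_div_pos.2 (by linarith))

theorem gammaRoot_eq_oneSidedConst (h : IsTransition p₀) :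
    ENNReal.ofReal (gammaRoot p₀) = oneSidedConst p₀ := by
  have := h.one_lt
  rw [oneSidedConst_eq_stopLossMoment_rpow (by linarith) this.ne',
    ofReal_gammaRoot_eq_stopLossMoment_rpow (by linarith) (by linarith) this.ne',
    h.stopLossMoment_extremal_one_eq]

theorem lt_oneSidedConst (h : IsTransition p₀) (hpp : p₀ < p) :
    ENNReal.ofReal (gammaRoot p) < oneSidedConst p := by
  have hp₀ := h.one_lt
  have hlt : (stopLossMoment p fun x => Real.exp (-x)) < stopLossMoment p (extremalStopLoss 1) := by
    by_contra! hle
    exact (stopLossMoment_extremal_one_lt hp₀ hpp hle).ne h.stopLossMoment_extremal_one_eq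
  rw [oneSidedConst_eq_stopLossMoment_rpow (by linarith) (by linarith),
    ofReal_gammaRoot_eq_stopLossMoment_rpow (by linarith) (by linarith) (by linarith)]
  exact ENNReal.rpow_lt_rpow hlt (one_div_pos.2 (by linarith))

theorem gammaRoot_eq_oneSidedConst_iff (h : IsTransition p₀) (hp : 1 < p) :
    ENNReal.ofReal (gammaRoot p) = oneSidedConst p ↔ p = p₀ := by
  refine ⟨fun heq => ?_, fun heq => heq ▸ h.gammaRoot_eq_oneSidedConst⟩
  rcases lt_trichotomy p p₀ with hlt | hp_eq | hgt
  · exact absurd heq (h.oneSidedConst_lt hp hlt).ne'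
  · exact hp_eq
  · exact absurd heq (h.lt_oneSidedConst hgt).ne

theorem sharpConst_of_le (h : IsTransition p₀) (hp : 1 ≤ p) (hpp : p ≤ p₀) :
    sharpConst p = ENNReal.ofReal (gammaRoot p) := by
  refine max_eq_left ?_
  rcases hp.eq_or_lt with rfl | hp
  · rw [oneSidedConst_one, gammaRoot_one, ENNReal.ofReal_one]
  rcases hpp.eq_or_lt with rfl | hpp
  · exact h.gammaRoot_eq_oneSidedConst.ge
  · exact (h.oneSidedConst_lt hp hpp).le

theorem sharpConst_of_ge (h : IsTransition p₀) (hpp : p₀ ≤ p) : sharpConst p = oneSidedConst p := by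
  refine max_eq_right ?_
  rcases hpp.eq_or_lt with rfl | hpp
  · exact h.gammaRoot_eq_oneSidedConst.le
  · exact (h.lt_oneSidedConst hpp).le

theorem sharpConst_ne_top (h : IsTransition p₀) (hp : 1 ≤ p) : sharpConst p ≠ ⊤ := by
  rcases le_total p p₀ with hpp | hpp
  · rw [h.sharpConst_of_le hp hpp]
    exact ENNReal.ofReal_ne_top
  · have := h.le
    rw [h.sharpConst_of_ge hpp,
      oneSidedConst_eq_stopLossMoment_rpow (by linarith) (by linarith),
      stopLossMoment_extremal (by linarith) zero_le_one le_rfl]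
    exact ENNReal.rpow_ne_top_of_nonneg (by positivity) ENNReal.ofReal_ne_top

theorem stopLossMoment_extremal_rpow_le_sharpConst (h : IsTransition p₀) (ht : t ∈ Icc (0 : ℝ) 1)
    (hp : 1 < p) : stopLossMoment p (extremalStopLoss t) ^ (1 / p) ≤ sharpConst p := by
  have hp0 : p ≠ 0 := by linarith
  have hp_inv : 0 ≤ 1 / p := by positivity
  rcases le_total p p₀ with hpp | hpp
  · rw [h.sharpConst_of_le hp.le hpp,
      ofReal_gammaRoot_eq_stopLossMoment_rpow (by linarith) hp0 hp.ne']
    exact ENNReal.rpow_le_rpow (h.stopLossMoment_extremal_le_of_le ht (.inr hp) hpp) hp_inv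
  · rw [sharpConst, ofReal_gammaRoot_eq_stopLossMoment_rpow (by linarith) hp0 hp.ne',
      oneSidedConst_eq_stopLossMoment_rpow hp0 hp.ne',
      ← (ENNReal.monotone_rpow_of_nonneg hp_inv).map_max]
    exact ENNReal.rpow_le_rpow (stopLossMoment_extremal_le_max (h.le.trans hpp) ht) hp_inv

section momentNorm

variable {Ω : Type*} [MeasurableSpace Ω] {P : Measure Ω} [IsProbabilityMeasure P] {X : Ω → ℝ}

theorem momentNorm_le (h : IsTransition p₀) (hX : IsLogConcave X P) (hm : HasMeanZero X P)
    (hp : 1 ≤ p) : momentNorm X p P ≤ sharpConst p * momentNorm X 1 P := by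
  rcases hp.eq_or_lt with rfl | hp
  · rw [h.sharpConst_of_le le_rfl h.one_lt.le, gammaRoot_one, ENNReal.ofReal_one, one_mul]
  obtain ⟨t, ht, π, hπ, hnorm⟩ := exists_stopLossMoment_rpow_mul_eq_momentNorm hX hm
  rw [hnorm p (by linarith) hp.ne']
  gcongr
  exact (ENNReal.rpow_le_rpow (stopLossMoment_mono (.inr hp) hπ) (by positivity)).trans
    (h.stopLossMoment_extremal_rpow_le_sharpConst ht hp)

theorem le_momentNorm_of_ne_zero (h : IsTransition p₀) (hX : IsLogConcave X P)
    (hm : HasMeanZero X P) (hp : -1 < p) (hp1 : p ≤ 1) (hp0 : p ≠ 0) :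
    ENNReal.ofReal (gammaRoot p) * momentNorm X 1 P ≤ momentNorm X p P := by
  rcases hp1.eq_or_lt with rfl | hp1
  · rw [gammaRoot_one, ENNReal.ofReal_one, one_mul]
  have hp₀ := h.one_lt
  obtain ⟨t, ht, π, hπ, hnorm⟩ := exists_stopLossMoment_rpow_mul_eq_momentNorm hX hm
  rw [hnorm p hp0 hp1.ne, ofReal_gammaRoot_eq_stopLossMoment_rpow hp hp0 hp1.ne]
  gcongr ?_ * _
  rcases hp0.lt_or_gt with hneg | hpos
  · exact ennreal_rpow_le_rpow_of_nonpos (one_div_neg.2 hneg).le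
      ((stopLossMoment_mono (.inl hneg.le) hπ).trans
        (h.stopLossMoment_extremal_le_of_le ht (.inl hneg) (by linarith)))
  · exact ENNReal.rpow_le_rpow ((h.le_stopLossMoment_extremal ht hpos hp1).trans
      (stopLossMoment_anti hpos hp1.le hπ)) (one_div_pos.2 hpos).le

theorem le_momentNorm (h : IsTransition p₀) (hX : IsLogConcave X P) (hm : HasMeanZero X P)
    (hp : -1 < p) (hp1 : p ≤ 1) :
    ENNReal.ofReal (gammaRoot p) * momentNorm X 1 P ≤ momentNorm X p P := by
  rcases eq_or_ne p 0 with rfl | hp0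
  · refine ofReal_gammaRoot_zero_mul_le_momentNorm hm.1 hX.ae_ne_zero ?_ fun q hq =>
      h.le_momentNorm_of_ne_zero hX hm hq.1 (hq.2.le.trans zero_le_one) hq.2.ne
    rw [momentNorm_one hm.1]
    exact ENNReal.ofReal_ne_top
  · exact h.le_momentNorm_of_ne_zero hX hm hp hp1 hp0

end momentNorm

end IsTransition

end LogConcaveMoments

end

theorem theorem2 :
    -- the two moment comparison inequalities
    (∀ (Ω : Type*) [MeasurableSpace Ω] (P : Measure Ω) [IsProbabilityMeasure P] (X : Ω → ℝ),
      IsLogConcave X P → HasMeanZero X P →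
        (∀ p : ℝ, -1 < p → p ≤ 1 →
          ENNReal.ofReal (gammaRoot p) * momentNorm X 1 P ≤ momentNorm X p P) ∧
        (∀ p : ℝ, 1 ≤ p →
          momentNorm X p P ≤ sharpConst p * momentNorm X 1 P)) ∧
    (∀ p : ℝ, 1 ≤ p → sharpConst p ≠ ⊤) ∧
    -- the double-exponential and the centred one-sided exponential variables are admissible
    (IsProbabilityMeasure doubleExp ∧
      IsLogConcave (fun x : ℝ => x) doubleExp ∧ HasMeanZero (fun x : ℝ => x) doubleExp) ∧
    (IsProbabilityMeasure (expMeasure 1) ∧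
      IsLogConcave (fun x : ℝ => x - 1) (expMeasure 1) ∧
      HasMeanZero (fun x : ℝ => x - 1) (expMeasure 1)) ∧
    -- sharpness of the lower bound
    (∀ p : ℝ, -1 < p → p ≤ 1 →
      momentNorm (fun x : ℝ => x) p doubleExp =
        ENNReal.ofReal (gammaRoot p) * momentNorm (fun x : ℝ => x) 1 doubleExp) ∧
    -- the phase transition, and sharpness of the upper bound
    (∃ p₀ : ℝ, 2.9414 < p₀ ∧ p₀ < 2.9415 ∧
      (∀ p : ℝ, 1 < p → (ENNReal.ofReal (gammaRoot p) = oneSidedConst p ↔ p = p₀)) ∧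
      (∀ p : ℝ, 1 ≤ p → p ≤ p₀ →
        sharpConst p = ENNReal.ofReal (gammaRoot p) ∧
        momentNorm (fun x : ℝ => x) p doubleExp =
          sharpConst p * momentNorm (fun x : ℝ => x) 1 doubleExp) ∧
      (∀ p : ℝ, p₀ ≤ p →
        sharpConst p = oneSidedConst p ∧
        momentNorm (fun x : ℝ => x - 1) p (expMeasure 1) =
          sharpConst p * momentNorm (fun x : ℝ => x - 1) 1 (expMeasure 1))) := by
  obtain ⟨p₀, hlo, hhi, heq⟩ := exists_extremalMoment_one_eq_Gamma
  have h : IsTransition p₀ := ⟨by linarith, heq⟩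
  refine ⟨fun Ω _ P _ X hX hm => ⟨fun p hp hp1 => h.le_momentNorm hX hm hp hp1,
    fun p hp => h.momentNorm_le hX hm hp⟩, fun p hp => h.sharpConst_ne_top hp,
    ⟨inferInstance, isLogConcave_doubleExp, hasMeanZero_doubleExp⟩,
    ⟨inferInstance, isLogConcave_sub_one_expMeasure, hasMeanZero_sub_one_expMeasure⟩,
    fun p hp _ => momentNorm_doubleExp hp,
    p₀, hlo, hhi, fun p hp => h.gammaRoot_eq_oneSidedConst_iff hp,
    fun p hp hpp => ⟨h.sharpConst_of_le hp hpp, ?_⟩, fun p hpp => ⟨h.sharpConst_of_ge hpp, ?_⟩⟩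
  · rw [h.sharpConst_of_le hp hpp, momentNorm_doubleExp (by linarith)]
  · rw [h.sharpConst_of_ge hpp, momentNorm_sub_one_expMeasure]
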